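/- Let $n,p$ be integers with $p\ge 1$, let $\lambda>0$, let $X$ be an $n\times p$ real matrix whose columns each sum to zero, and let $Y\in\mathbb{R}^n$ be a response vector whose entries are not all equal (so that $n\ge 2$). Put $\tilde Y=Y-\bar Y\mathbf 1_n$, $D_\tau=\mathrm{Diag}(\tau_1,\dots,\tau_p)$ and $A_\tau=X^{T}X+D_\tau^{-1}$ for $\tau\in\mathbb{R}_+^p$. Consider the Bayesian lasso model $$Y\mid\mu,\beta,\sigma^2\sim N_n(\mu\mathbf 1_n+X\beta,\sigma^2I_n),\qquad \beta\mid\sigma^2,\tau\sim N_p(0,\sigma^2D_\tau),\qquad \tau_1,\dots,\tau_p\ \text{i.i.d. Exponential}(\lambda^2/2),$$ with the improper prior $\pi(\sigma^2,\mu)=1/\sigma^2$, independent of $\tau$. Let $\pi(\beta,\sigma^2\mid Y)$ be the posterior distribution on $\mathbb{R}^p\times\mathbb{R}_+$ (with $\mu$ and $\tau$ integrated out). The Gibbs samplers use the following conditional distributions (whose densities are written $\pi(\cdot\mid\cdot)$ below): * $\tau\mid\beta,\sigma^2,Y$: the $1/\tau_j$ are independent, inverse Gaussian with mean $\sqrt{\lambda^2\sigma^2/\beta_j^2}$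 and shape $\lambda^2$ (if $\beta_j=0$, read: $\tau_j$ is gamma distributed with shape $1/2$ and rate $\lambda^2/2$); * $\beta\mid\sigma^2,\tau,Y\sim N_p(A_\tau^{-1}X^{T}\tilde Y,\ \sigma^2A_\tau^{-1})$; * $\sigma^2\mid\beta,\tau,Y\sim\text{Inverse-Gamma}\big(\tfrac{n+p-1}{2},\ \tfrac12\|\tilde Y-X\beta\|_2^2+\tfrac12\beta^{T}D_\tau^{-1}\beta\big)$; * $\sigma^2\mid\tau,Y\sim\text{Inverse-Gamma}\big(\tfrac{n-1}{2},\ \tfrac12\tilde Y^{T}(I_n-XA_\tau^{-1}X^{T})\tilde Y\big)$. Let $\hat k$ and $k$ be the transition densities, with respect to Lebesgue measure on $\mathbb{R}^p\times\mathbb{R}_+$, of the original three-step and of the blocked two-step Gibbs sampler: $$\hat k\big[(\beta_0,\sigma_0^2),(\beta_1,\sigma_1^2)\big]=\int_{\mathbb{R}_+^p}\pi(\sigma_1^2\mid\beta_1,\tau,Y)\,\pi(\beta_1\mid\tau,\sigma_0^2,Y)\,\pi(\tau\mid\beta_0,\sigma_0^2,Y)\,d\tau,$$ $$k\big[(\beta_0,\sigma_0^2),(\beta_1,\sigma_1^2)\big]=\int_{\mathbb{R}_+^p}\pi(\tau\mid\beta_0,\sigma_0^2,Y)\,\pi(\sigma_1^2\mid\tau,Y)\,\pi(\beta_1\mid\sigma_1^2,\tau,Y)\,d\tau.$$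 Then the posterior is proper, and $g\mapsto\int\hat k(\cdot,y)g(y)\,dy$ and $g\mapsto\int k(\cdot,y)g(y)\,dy$ define bounded linear operators (the Markov operators) on the real Hilbert space $L^2(\pi(\cdot\mid Y))$. The Markov operator of $\hat k$ is not Hilbert–Schmidt, whereas the Markov operator of $k$ is trace class, and hence Hilbert–Schmidt. This holds for all such $n$, $p$, $\lambda$, $X$ and $Y$. -/

import Mathlib

open MeasureTheory ProbabilityTheory Matrix
open scoped ENNReal InnerProductSpace

noncomputable section

/-! ### Hilbert–Schmidt and trace class operators -/

section Operators

variable {𝕜 H : Type*} [RCLike 𝕜] [NormedAddCommGroup H] [InnerProductSpace 𝕜 H]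
  [CompleteSpace H]

/-- `T` is Hilbert–Schmidt: `∑ ‖T eᵢ‖² < ∞` for some orthonormal (Hilbert) basis `e`; the sum does
not depend on the basis. -/
def IsHilbertSchmidt (T : H →L[𝕜] H) : Prop :=
  ∃ (w : Set H) (e : HilbertBasis w 𝕜 H), Summable fun i => ‖T (e i)‖ ^ 2

/-- `T` is trace class: `∑ ⟨|T| eᵢ, eᵢ⟩ < ∞` for some orthonormal (Hilbert) basis `e`, where
`P = |T|` is the (unique) positive square root of `T* T`; the sum does not depend on the basis. -/
def IsTraceClass (T : H →L[𝕜] H) : Prop :=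
  ∃ P : H →L[𝕜] H, P.IsPositive ∧ P ∘L P = ContinuousLinearMap.adjoint T ∘L T ∧
    ∃ (w : Set H) (e : HilbertBasis w 𝕜 H), Summable fun i => RCLike.re ⟪P (e i), e i⟫_𝕜

end Operators

/-! ### Densities of standard distributions -/

/-- Density of the inverse gamma distribution with shape `a` and scale `b`. -/
def inverseGammaPDFReal (a b x : ℝ) : ℝ :=
  if 0 < x then b ^ a / Real.Gamma a * x ^ (-a - 1) * Real.exp (-b / x) else 0

/-- Density of the multivariate normal distribution `N_p(m, S)`. -/
def multivariateNormalPDFReal {p : ℕ} (m : Fin p → ℝ) (S : Matrix (Fin p) (Fin p) ℝ)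
    (x : Fin p → ℝ) : ℝ :=
  (Real.sqrt ((2 * Real.pi) ^ p * S.det))⁻¹ *
    Real.exp (-((x - m) ⬝ᵥ (S⁻¹ *ᵥ (x - m))) / 2)

namespace BayesLasso

variable {n p : ℕ}

/-- The parameter space `ℝ^p × ℝ₊` of `(β, σ²)`, as a subset of `ℝ^p × ℝ`. -/
def paramSet (p : ℕ) : Set ((Fin p → ℝ) × ℝ) := Set.univ ×ˢ Set.Ioi 0

/-- The orthant `ℝ₊^p` in which `τ` lives. -/
def orthant (p : ℕ) : Set (Fin p → ℝ) := Set.univ.pi fun _ => Set.Ioi 0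

/-! ### The model and its posterior

In all definitions `s` stands for the variance `σ²`. -/

/-- Joint density (up to normalization) of `(β, σ², τ)` given `Y` for the Bayesian lasso
`Y ∣ μ, β, σ² ∼ N_n(μ 1 + X β, σ² I)`, `β ∣ σ², τ ∼ N_p(0, σ² D_τ)`,
`τ_j ∼ Exponential(λ²/2)` independent, `π(σ², μ) = 1/σ²`, with the intercept `μ` integrated out. -/
def jointDensity (lam : ℝ) (X : Matrix (Fin n) (Fin p) ℝ) (Y : Fin n → ℝ)
    (β : Fin p → ℝ) (s : ℝ) (τ : Fin p → ℝ) : ℝ≥0∞ :=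
  ∫⁻ μ : ℝ, ENNReal.ofReal
    ((∏ i, gaussianPDFReal (μ + (X *ᵥ β) i) s.toNNReal (Y i)) *
      (∏ j, gaussianPDFReal 0 (s * τ j).toNNReal (β j)) *
      (∏ j, exponentialPDFReal (lam ^ 2 / 2) (τ j)) * (1 / s))

/-- Unnormalized marginal density of `(β, σ²)` given `Y`. -/
def marginalDensity (lam : ℝ) (X : Matrix (Fin n) (Fin p) ℝ) (Y : Fin n → ℝ)
    (x : (Fin p → ℝ) × ℝ) : ℝ≥0∞ :=
  ∫⁻ τ in orthant p, jointDensity lam X Y x.1 x.2 τ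

/-- The unnormalized posterior of `(β, σ²)`, as a measure. -/
def unnormalizedPosterior (lam : ℝ) (X : Matrix (Fin n) (Fin p) ℝ) (Y : Fin n → ℝ) :
    Measure ((Fin p → ℝ) × ℝ) :=
  (volume.restrict (paramSet p)).withDensity (marginalDensity lam X Y)

/-- The posterior distribution of `(β, σ²)` given `Y`. -/
def posterior (lam : ℝ) (X : Matrix (Fin n) (Fin p) ℝ) (Y : Fin n → ℝ) :
    Measure ((Fin p → ℝ) × ℝ) :=
  (unnormalizedPosterior lam X Y Set.univ)⁻¹ • unnormalizedPosterior lam X Y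

/-! ### The conditional distributions used by the two Gibbs samplers -/

/-- The centered response `Ỹ = Y - Ȳ 1`. -/
def centered (Y : Fin n → ℝ) : Fin n → ℝ := fun i => Y i - (∑ k, Y k) / n

/-- `D_τ⁻¹`, where `D_τ = Diag(τ₁, …, τ_p)`. -/
def Dinv (τ : Fin p → ℝ) : Matrix (Fin p) (Fin p) ℝ := Matrix.diagonal fun j => (τ j)⁻¹

/-- `A_τ = Xᵀ X + D_τ⁻¹`. -/
def A (X : Matrix (Fin n) (Fin p) ℝ) (τ : Fin p → ℝ) : Matrix (Fin p) (Fin p) ℝ :=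
  Xᵀ * X + Dinv τ

/-- Density of `τ ∣ β, σ², Y`: the `1/τ_j` are independent, inverse Gaussian with mean
`√(λ² σ² / β_j²)` and shape `λ²`. The density of `τ_j`, written out, is
`(λ² / 2π)^{1/2} τ_j^{-1/2} exp(-(|β_j| - λ σ τ_j)² / (2 σ² τ_j))`
(for `β_j = 0`: the gamma distribution with shape `1/2` and rate `λ²/2`). -/
def tauPDF (lam : ℝ) (β : Fin p → ℝ) (s : ℝ) (τ : Fin p → ℝ) : ℝ :=
  ∏ j, lam / Real.sqrt (2 * Real.pi) * (Real.sqrt (τ j))⁻¹ *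
    Real.exp (-(|β j| - lam * Real.sqrt s * τ j) ^ 2 / (2 * s * τ j))

/-- Density of `β ∣ σ², τ, Y ∼ N_p(A_τ⁻¹ Xᵀ Ỹ, σ² A_τ⁻¹)`. -/
def betaPDF (X : Matrix (Fin n) (Fin p) ℝ) (Y : Fin n → ℝ) (s : ℝ) (τ : Fin p → ℝ)
    (β : Fin p → ℝ) : ℝ :=
  multivariateNormalPDFReal ((A X τ)⁻¹ *ᵥ (Xᵀ *ᵥ centered Y)) (s • (A X τ)⁻¹) β

/-- Density of
`σ² ∣ β, τ, Y ∼ Inverse-Gamma((n + p - 1)/2, ‖Ỹ - X β‖²/2 + βᵀ D_τ⁻¹ β/2)`. -/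
def sigmaPDF (X : Matrix (Fin n) (Fin p) ℝ) (Y : Fin n → ℝ) (β τ : Fin p → ℝ) (s : ℝ) : ℝ :=
  inverseGammaPDFReal (((n : ℝ) + p - 1) / 2)
    ((centered Y - X *ᵥ β) ⬝ᵥ (centered Y - X *ᵥ β) / 2 + β ⬝ᵥ (Dinv τ *ᵥ β) / 2) s

/-- Density of `σ² ∣ τ, Y ∼ Inverse-Gamma((n - 1)/2, Ỹᵀ (I - X A_τ⁻¹ Xᵀ) Ỹ/2)`. -/
def sigmaBlockedPDF (X : Matrix (Fin n) (Fin p) ℝ) (Y : Fin n → ℝ) (τ : Fin p → ℝ) (s : ℝ) : ℝ :=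
  inverseGammaPDFReal (((n : ℝ) - 1) / 2)
    (centered Y ⬝ᵥ ((1 - X * (A X τ)⁻¹ * Xᵀ) *ᵥ centered Y) / 2) s

/-! ### The transition densities and their Markov operators -/

/-- Transition density `k̂` of the original three-step Gibbs sampler: draw `τ ∣ β₀, σ₀²`, then
`β₁ ∣ τ, σ₀²`, then `σ₁² ∣ β₁, τ`. -/
def threeStepKernel (lam : ℝ) (X : Matrix (Fin n) (Fin p) ℝ) (Y : Fin n → ℝ)
    (x₀ x₁ : (Fin p → ℝ) × ℝ) : ℝ≥0∞ :=
  ∫⁻ τ in orthant p, ENNReal.ofReal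
    (sigmaPDF X Y x₁.1 τ x₁.2 * betaPDF X Y x₀.2 τ x₁.1 * tauPDF lam x₀.1 x₀.2 τ)

/-- Transition density `k` of the blocked two-step Gibbs sampler: draw `τ ∣ β₀, σ₀²`, then
`(β₁, σ₁²) ∣ τ` by drawing `σ₁² ∣ τ` and `β₁ ∣ σ₁², τ`. -/
def blockedKernel (lam : ℝ) (X : Matrix (Fin n) (Fin p) ℝ) (Y : Fin n → ℝ)
    (x₀ x₁ : (Fin p → ℝ) × ℝ) : ℝ≥0∞ :=
  ∫⁻ τ in orthant p, ENNReal.ofReal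
    (tauPDF lam x₀.1 x₀.2 τ * sigmaBlockedPDF X Y τ x₁.2 * betaPDF X Y x₁.2 τ x₁.1)

/-- The law of the next state, from the state `x`, of the chain on `ℝ^p × ℝ₊` with transition
density `k` with respect to Lebesgue measure. -/
def transitionMeasure (k : (Fin p → ℝ) × ℝ → (Fin p → ℝ) × ℝ → ℝ≥0∞) (x : (Fin p → ℝ) × ℝ) :
    Measure ((Fin p → ℝ) × ℝ) :=
  (volume.restrict (paramSet p)).withDensity (k x)

/-- `K` is the Markov operator on `L²(π)` of the transition density `k`:
`(K g)(x) = ∫ k(x, y) g(y) dy` for `π`-almost all `x`, the integral being absolutely convergent. -/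
def IsMarkovOperator (π : Measure ((Fin p → ℝ) × ℝ))
    (k : (Fin p → ℝ) × ℝ → (Fin p → ℝ) × ℝ → ℝ≥0∞) (K : Lp ℝ 2 π →L[ℝ] Lp ℝ 2 π) : Prop :=
  ∀ g : Lp ℝ 2 π, ∀ᵐ x ∂π, Integrable g (transitionMeasure k x) ∧
    K g x = ∫ y, g y ∂(transitionMeasure k x)

end BayesLasso

end

/-! The two samplers behave differently at large scales.

Three-step sampler. The law of `τ` given `(β, σ²)` depends only on `β/σ`, and once `β` and `σ` are
large the data `Ỹ` are negligible in the other two updates. So the chain is nearly invariant under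
`(β, σ²) ↦ (cβ, c²σ²)`, and a start at scale `2^j` stays at that scale with probability at least
some `δ > 0` that does not depend on `j`. The dyadic shells `4^j ≤ σ² < 4^(j+1)`, `|β_i| ≤ 2^j` are
disjoint. Their normalized indicators `f_j` are therefore orthonormal with `‖K f_j‖ ≥ δ`, whereas a
Hilbert–Schmidt operator tends to zero along any orthonormal sequence
(`IsHilbertSchmidt.tendsto_norm_apply`). The uniform bound is `exists_le_lintegral_threeStepKernel`,
and `not_isHilbertSchmidt_of_minorization` concludes.

Blocked sampler. The blocks `x = (β, σ²)` and `τ` alternate, so this is a data augmentation chain: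
with `a(x, τ)` and `b(τ, x)` the two conditional densities and `G`, `T` the marginals, `G a = T b`.
Its operator is `B† B`, where `B` maps `g` to its conditional expectation given `τ`. By Bessel's
inequality the Hilbert–Schmidt sum of `B` is at most `∫∫ T b²/G = ∫∫ a b`, which is the integral of
the kernel over the diagonal (`exists_traceClass_markovOperator`). That integral is finite by an
explicit Gaussian estimate (`exponent_le`, `lintegral_trace_lt_top`): after `β` and `σ²` are
integrated out, what remains is a multiple of `√det A_τ · exp(-λ²/10 ∑ τ_j)`, whose singularities at
`τ_j = 0` are of order `τ_j^(-1/2)`.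

Existence of both operators rests on invariance of the posterior: a kernel of mass at most one that
preserves a measure contracts `L²`. Invariance comes from factoring one closed-form joint density,
`jointReal`, through each conditional density. Properness comes from integrating out `τ`, which
leaves an `ℓ¹` penalty. Since `Ỹ ≠ 0`, the residual and the penalty cannot both be small, which
controls `σ² → 0`. -/

/-! ### Hilbert–Schmidt sums in Hilbert space -/

theorem Orthonormal.tsum_enorm_inner_sq_le {𝕜 H ι : Type*} [RCLike 𝕜]
    [NormedAddCommGroup H] [InnerProductSpace 𝕜 H] {f : ι → H} (hf : Orthonormal 𝕜 f) (x : H) :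
    ∑' i, ‖⟪f i, x⟫_𝕜‖ₑ ^ 2 ≤ ‖x‖ₑ ^ 2 := by
  simp_rw [← ofReal_norm, ← ENNReal.ofReal_pow (norm_nonneg _)]
  rw [← ENNReal.ofReal_tsum_of_nonneg (fun i => by positivity) (hf.inner_products_summable x)]
  exact ENNReal.ofReal_le_ofReal (hf.tsum_inner_products_le x)

section HilbertSpace

variable {𝕜 H H' : Type*} [RCLike 𝕜] [NormedAddCommGroup H] [InnerProductSpace 𝕜 H]

/-- Parseval's identity, with values in `ℝ≥0∞`. -/
theorem HilbertBasis.tsum_enorm_inner_sq {ι : Type*} (e : HilbertBasis ι 𝕜 H) (x : H) :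
    ∑' i, ‖⟪e i, x⟫_𝕜‖ₑ ^ 2 = ‖x‖ₑ ^ 2 := by
  have h := (e.hasSum_inner_mul_inner x x).mapL (RCLike.reCLM (K := 𝕜))
  have h' : HasSum (fun i => ‖⟪e i, x⟫_𝕜‖ ^ 2) (‖x‖ ^ 2) := by
    rw [RCLike.reCLM_apply, inner_self_eq_norm_sq] at h
    refine h.congr_fun fun i => ?_
    rw [← inner_conj_symm x (e i), RCLike.conj_mul]
    norm_cast
  have e1 : ∀ z : ℝ, 0 ≤ z → ENNReal.ofReal (z ^ 2) = ENNReal.ofReal z ^ 2 := fun z hz =>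
    ENNReal.ofReal_pow hz 2
  simp_rw [← ofReal_norm, ← e1 _ (norm_nonneg _)]
  rw [← h'.tsum_eq, ENNReal.ofReal_tsum_of_nonneg (fun i => by positivity) h'.summable]

variable [CompleteSpace H] [NormedAddCommGroup H'] [InnerProductSpace 𝕜 H'] [CompleteSpace H']

/-- The Hilbert–Schmidt sum over an orthonormal family is at most the one over a Hilbert basis. -/
theorem Orthonormal.tsum_enorm_apply_sq_le {ι ι' : Type*} {f : ι' → H} (hf : Orthonormal 𝕜 f)
    (e : HilbertBasis ι 𝕜 H) (T : H →L[𝕜] H) :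
    ∑' j, ‖T (f j)‖ₑ ^ 2 ≤ ∑' i, ‖T (e i)‖ₑ ^ 2 := by
  -- Expanding in `e` and moving `T` to its adjoint turns both sides into sums involving `T† e_i`;
  -- the only loss is Bessel's inequality for `f`.
  calc ∑' j, ‖T (f j)‖ₑ ^ 2
      = ∑' i, ∑' j, ‖⟪f j, ContinuousLinearMap.adjoint T (e i)⟫_𝕜‖ₑ ^ 2 := by
        simp_rw [← e.tsum_enorm_inner_sq (T _)]
        rw [ENNReal.tsum_comm]
        simp_rw [ContinuousLinearMap.adjoint_inner_right, ← ofReal_norm, norm_inner_symm (T _)]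
    _ ≤ ∑' i, ‖ContinuousLinearMap.adjoint T (e i)‖ₑ ^ 2 :=
        ENNReal.tsum_le_tsum fun i => hf.tsum_enorm_inner_sq_le _
    _ = ∑' i, ‖T (e i)‖ₑ ^ 2 := by
        simp_rw [← e.tsum_enorm_inner_sq (T _), ← e.tsum_enorm_inner_sq (_ : H)]
        rw [ENNReal.tsum_comm]
        simp_rw [ContinuousLinearMap.adjoint_inner_right, ← ofReal_norm, norm_inner_symm (T _)]

/-- A Hilbert–Schmidt operator tends to zero along every orthonormal sequence. -/
theorem IsHilbertSchmidt.tendsto_norm_apply {T : H →L[𝕜] H} (hT : IsHilbertSchmidt T)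
    {f : ℕ → H} (hf : Orthonormal 𝕜 f) :
    Filter.Tendsto (fun j => ‖T (f j)‖ₑ ^ 2) Filter.atTop (nhds 0) := by
  obtain ⟨w, e, he⟩ := hT
  refine ENNReal.tendsto_atTop_zero_of_tsum_ne_top (ne_top_of_le_ne_top ?_
    (hf.tsum_enorm_apply_sq_le e T))
  simp_rw [← ofReal_norm, ← ENNReal.ofReal_pow (norm_nonneg _)]
  rw [← ENNReal.ofReal_tsum_of_nonneg (fun i => by positivity) he]
  exact ENNReal.ofReal_ne_top

/-- If `B` has finite Hilbert–Schmidt sum then `B† B` is trace class and Hilbert–Schmidt. -/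
theorem isTraceClass_adjoint_comp_self (B : H →L[𝕜] H') (C : ℝ)
    (hB : ∀ (w : Set H) (e : HilbertBasis w 𝕜 H) (s : Finset w), ∑ i ∈ s, ‖B (e i)‖ ^ 2 ≤ C) :
    IsTraceClass (ContinuousLinearMap.adjoint B ∘L B) ∧
      IsHilbertSchmidt (ContinuousLinearMap.adjoint B ∘L B) := by
  obtain ⟨w, e, -⟩ := exists_hilbertBasis 𝕜 H
  have hs : Summable fun i => ‖B (e i)‖ ^ 2 :=
    summable_of_sum_le (fun _ => by positivity) (hB w e)
  have hpos := ContinuousLinearMap.isPositive_adjoint_comp_self B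
  -- A positive operator is its own absolute value, and the diagonal entries of `B† B` are `‖B
  -- e_i‖²`. The Hilbert–Schmidt sum is then bounded through `‖B† (B e_i)‖ ≤ ‖B†‖ ‖B e_i‖`.
  refine ⟨⟨_, hpos, ?_, w, e, ?_⟩, w, e, ?_⟩
  · rw [hpos.isSelfAdjoint.adjoint_eq]
  · refine hs.congr fun i => ?_
    rw [ContinuousLinearMap.comp_apply, ContinuousLinearMap.adjoint_inner_left,
      inner_self_eq_norm_sq]
  · refine Summable.of_nonneg_of_le (fun _ => by positivity) (fun i => ?_)
      (hs.mul_left (‖ContinuousLinearMap.adjoint B‖ ^ 2))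
    rw [← mul_pow]
    exact pow_le_pow_left₀ (norm_nonneg _) ((ContinuousLinearMap.adjoint B).le_opNorm (B (e i))) 2

end HilbertSpace

/-! ### Markov kernels as contractions between `L²` spaces -/

section MarkovOperators

variable {E F : Type*} [MeasurableSpace E] [MeasurableSpace F]

theorem lintegral_enorm_sq_eq {μ : Measure E} {g : E → ℝ} :
    ∫⁻ x, ‖g x‖ₑ ^ 2 ∂μ = eLpNorm g 2 μ ^ 2 := by
  rw [eLpNorm_eq_lintegral_rpow_enorm_toReal (by norm_num) (by norm_num), ← ENNReal.rpow_natCast,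
    ← ENNReal.rpow_mul]
  norm_num

/-- Cauchy–Schwarz for a sub-probability measure. -/
theorem enorm_integral_sq_le {μ : Measure E} (hμ : μ Set.univ ≤ 1) {g : E → ℝ}
    (hg : AEStronglyMeasurable g μ) : ‖∫ x, g x ∂μ‖ₑ ^ 2 ≤ ∫⁻ x, ‖g x‖ₑ ^ 2 ∂μ := by
  rw [lintegral_enorm_sq_eq]
  refine pow_le_pow_left' ?_ 2
  calc ‖∫ x, g x ∂μ‖ₑ ≤ ∫⁻ x, ‖g x‖ₑ ∂μ := enorm_integral_le_lintegral_enorm _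
    _ = eLpNorm g 1 μ := eLpNorm_one_eq_lintegral_enorm.symm
    _ ≤ eLpNorm g 2 μ * μ Set.univ ^ (1 / (1 : ℝ≥0∞).toReal - 1 / (2 : ℝ≥0∞).toReal) :=
        eLpNorm_le_eLpNorm_mul_rpow_measure_univ (by norm_num) hg
    _ ≤ eLpNorm g 2 μ * 1 := by
        gcongr
        exact ENNReal.rpow_le_one hμ (by norm_num)
    _ = eLpNorm g 2 μ := mul_one _

theorem Lp.enorm_sq_eq {μ : Measure E} (g : Lp ℝ 2 μ) : ‖g‖ₑ ^ 2 = ∫⁻ x, ‖g x‖ₑ ^ 2 ∂μ := by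
  rw [lintegral_enorm_sq_eq, Lp.enorm_def]

variable {κ : Kernel E F} {π : Measure E} {ρ : Measure F}

theorem lintegral_eq_of_comp (h : κ ∘ₘ π = ρ) {f : F → ℝ≥0∞} (hf : Measurable f) :
    ∫⁻ y, f y ∂ρ = ∫⁻ x, ∫⁻ y, f y ∂κ x ∂π := by
  rw [← h, Measure.lintegral_bind κ.aemeasurable hf.aemeasurable]

/-- The `κ x`-integrals of `|g|²` average to `∫ |g|² dρ < ∞`, so almost all of them are finite. -/
theorem ae_memLp_of_comp (h : κ ∘ₘ π = ρ) {g : F → ℝ} (hg : Measurable g) (hg2 : MemLp g 2 ρ) :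
    ∀ᵐ x ∂π, MemLp g 2 (κ x) := by
  have h1 : ∫⁻ x, ∫⁻ y, ‖g y‖ₑ ^ 2 ∂κ x ∂π < ∞ := by
    have hm : Measurable fun y => ‖g y‖ₑ ^ 2 := hg.enorm.pow_const 2
    rw [← lintegral_eq_of_comp h hm, lintegral_enorm_sq_eq]
    exact ENNReal.pow_lt_top hg2.2
  filter_upwards [ae_lt_top ((hg.enorm.pow_const 2).lintegral_kernel) h1.ne] with x hx
  refine ⟨hg.aestronglyMeasurable, ?_⟩
  rw [lintegral_enorm_sq_eq] at hx
  by_contra hc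
  rw [not_lt_top_iff.mp hc] at hx
  simp at hx

/-- A sub-Markov kernel `κ` with `κ ∘ₘ π = ρ` acts as a contraction from `L²(ρ)` to `L²(π)`. -/
theorem exists_markovOperator [IsFiniteKernel κ] (hκ : ∀ x, κ x Set.univ ≤ 1) (h : κ ∘ₘ π = ρ) :
    ∃ B : Lp ℝ 2 ρ →L[ℝ] Lp ℝ 2 π, ∀ g : Lp ℝ 2 ρ,
      ∀ᵐ x ∂π, Integrable g (κ x) ∧ B g x = ∫ y, g y ∂κ x := by
  have hmeas : ∀ g : Lp ℝ 2 ρ, StronglyMeasurable g := fun g => Lp.stronglyMeasurable g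
  have hint : ∀ g : Lp ℝ 2 ρ, ∀ᵐ x ∂π, Integrable g (κ x) := fun g => by
    filter_upwards [ae_memLp_of_comp h (hmeas g).measurable (Lp.memLp g)] with x hx
    exact hx.integrable (by norm_num)
  have hle : ∀ g : Lp ℝ 2 ρ, eLpNorm (fun x => ∫ y, g y ∂κ x) 2 π ≤ eLpNorm g 2 ρ := fun g => by
    have : eLpNorm (fun x => ∫ y, g y ∂κ x) 2 π ^ 2 ≤ eLpNorm g 2 ρ ^ 2 := by
      rw [← lintegral_enorm_sq_eq, ← lintegral_enorm_sq_eq,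
        lintegral_eq_of_comp h ((hmeas g).measurable.enorm.pow_const 2)]
      exact lintegral_mono fun x => enorm_integral_sq_le (hκ x) (hmeas g).aestronglyMeasurable
    exact (ENNReal.pow_le_pow_left_iff two_ne_zero).mp this
  have hmem : ∀ g : Lp ℝ 2 ρ, MemLp (fun x => ∫ y, g y ∂κ x) 2 π := fun g =>
    ⟨((hmeas g).integral_kernel).aestronglyMeasurable, (hle g).trans_lt (Lp.eLpNorm_lt_top g)⟩
  -- A `ρ`-null set is `κ x`-null for almost every `x`; this makes the operator compatible with the
  -- a.e. identities for sums and scalar multiples.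
  have hae : ∀ {f g : F → ℝ}, f =ᵐ[ρ] g → ∀ᵐ x ∂π, f =ᵐ[κ x] g := fun hfg => by
    rw [← h] at hfg
    exact Measure.ae_ae_of_ae_comp hfg
  let L : Lp ℝ 2 ρ →ₗ[ℝ] Lp ℝ 2 π :=
    { toFun := fun g => (hmem g).toLp _
      map_add' := fun f g => by
        rw [← MemLp.toLp_add, MemLp.toLp_eq_toLp_iff]
        filter_upwards [hae (Lp.coeFn_add f g), hint f, hint g] with x hx hf hg
        rw [integral_congr_ae hx]
        exact integral_add hf hg
      map_smul' := fun c f => by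
        rw [← MemLp.toLp_const_smul, MemLp.toLp_eq_toLp_iff]
        filter_upwards [hae (Lp.coeFn_smul c f)] with x hx
        rw [integral_congr_ae hx]
        exact integral_smul c _ }
  refine ⟨L.mkContinuous 1 fun g => ?_, fun g => ?_⟩
  · rw [one_mul]
    change ‖(hmem g).toLp _‖ ≤ ‖g‖
    rw [Lp.norm_toLp, Lp.norm_def]
    exact ENNReal.toReal_mono (Lp.eLpNorm_ne_top g) (hle g)
  · filter_upwards [hint g, (hmem g).coeFn_toLp] with x hx hx'
    exact ⟨hx, hx'⟩

/-- The operators of two kernels that disintegrate the same joint measure are adjoint. -/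
theorem eq_adjoint_of_compProd_eq [IsFiniteKernel κ] {η : Kernel F E} [IsFiniteKernel η]
    [IsFiniteMeasure π] [IsFiniteMeasure ρ]
    (hκ : ∀ x, κ x Set.univ ≤ 1)
    (hρ : κ ∘ₘ π = ρ) (h : (π ⊗ₘ κ).map Prod.swap = ρ ⊗ₘ η)
    {B : Lp ℝ 2 π →L[ℝ] Lp ℝ 2 ρ} {B' : Lp ℝ 2 ρ →L[ℝ] Lp ℝ 2 π}
    (hB : ∀ g, ∀ᵐ y ∂ρ, B g y = ∫ x, g x ∂η y) (hB' : ∀ g, ∀ᵐ x ∂π, B' g x = ∫ y, g y ∂κ x) :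
    B' = ContinuousLinearMap.adjoint B := by
  rw [ContinuousLinearMap.eq_adjoint_iff]
  intro g f
  have hfst : ∀ f : Lp ℝ 2 π, MemLp (fun z : E × F => f z.1) 2 (π ⊗ₘ κ) := fun f => by
    have hm := (Lp.stronglyMeasurable f)
    refine ⟨(hm.comp_measurable measurable_fst).aestronglyMeasurable, ?_⟩
    have h1 : eLpNorm (fun z : E × F => f z.1) 2 (π ⊗ₘ κ) ^ 2 ≤ eLpNorm f 2 π ^ 2 := by
      rw [← lintegral_enorm_sq_eq, ← lintegral_enorm_sq_eq,
        Measure.lintegral_compProd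
          (f := fun z : E × F => ‖f z.1‖ₑ ^ 2) ((hm.measurable.comp measurable_fst).enorm.pow_const 2)]
      refine lintegral_mono fun x => ?_
      simp only [lintegral_const]
      exact mul_le_of_le_one_right' (hκ x)
    exact ((ENNReal.pow_le_pow_left_iff two_ne_zero).mp h1).trans_lt
      (Lp.eLpNorm_lt_top f)
  have hsnd : MemLp (fun z : E × F => g z.2) 2 (π ⊗ₘ κ) := by
    have hm := (Lp.stronglyMeasurable g)
    have h1 : MemLp g 2 ((π ⊗ₘ κ).map Prod.snd) := by
      have : (π ⊗ₘ κ).map Prod.snd = ρ := by rw [← hρ, ← Measure.snd_compProd]; rfl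
      rw [this]
      exact Lp.memLp g
    exact (memLp_map_measure_iff h1.1 measurable_snd.aemeasurable).mp h1
  have hI : Integrable (fun z : E × F => g z.2 * f z.1) (π ⊗ₘ κ) := hsnd.integrable_mul (hfst f)
  -- Both inner products are the integral of `g(y) f(x)` against the same joint measure,
  -- disintegrated in the two possible orders.
  have e1 : ⟪B' g, f⟫_ℝ = ∫ z, g z.2 * f z.1 ∂(π ⊗ₘ κ) := by
    rw [Measure.integral_compProd hI, L2.inner_def]
    refine integral_congr_ae ?_
    filter_upwards [hB' g] with x hx
    simp only [hx, integral_mul_const, RCLike.inner_apply, conj_trivial]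
    ring
  have hI' : Integrable (fun z : F × E => g z.1 * f z.2) (ρ ⊗ₘ η) := by
    rw [← h]
    refine (integrable_map_measure ?_ measurable_swap.aemeasurable).mpr hI
    exact (((Lp.stronglyMeasurable g).comp_measurable measurable_fst).mul
      ((Lp.stronglyMeasurable f).comp_measurable measurable_snd)).aestronglyMeasurable
  have e2 : ⟪g, B f⟫_ℝ = ∫ z, g z.1 * f z.2 ∂(ρ ⊗ₘ η) := by
    rw [Measure.integral_compProd hI', L2.inner_def]
    refine integral_congr_ae ?_
    filter_upwards [hB f] with x hx
    simp only [hx, integral_const_mul, RCLike.inner_apply, conj_trivial]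
    ring
  rw [e1, e2, ← h, integral_map measurable_swap.aemeasurable]
  · rfl
  · rw [h]; exact hI'.1

end MarkovOperators

/-! ### Operators given by transition densities -/

section DensityKernels

variable {E F : Type*} [MeasurableSpace E] [MeasurableSpace F]

/-- The mass bound holds only almost everywhere. Replacing the density by zero on the measurable
exceptional set gives a genuine finite kernel without changing its action on `L²`. -/
theorem exists_kernel_of_density {μ : Measure E} (ν : Measure F) [SFinite ν] {k : E → F → ℝ≥0∞}
    (hk : Measurable (Function.uncurry k)) (h1 : ∀ᵐ x ∂μ, ∫⁻ y, k x y ∂ν ≤ 1) :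
    ∃ κ : Kernel E F, (∀ x, κ x Set.univ ≤ 1) ∧ IsFiniteKernel κ ∧
      ∀ᵐ x ∂μ, κ x = ν.withDensity (k x) := by
  classical
  have hS : MeasurableSet {x | ∫⁻ y, k x y ∂ν ≤ 1} :=
    measurableSet_le hk.lintegral_prod_right' measurable_const
  let κ : Kernel E F :=
    Kernel.piecewise hS (Kernel.withDensity (Kernel.const E ν) k) 0
  have hκ : ∀ x, ∫⁻ y, k x y ∂ν ≤ 1 → κ x = ν.withDensity (k x) := fun x hx => by
    rw [Kernel.piecewise_apply, if_pos (by exact hx), Kernel.withDensity_apply _ hk,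
      Kernel.const_apply]
  have hle : ∀ x, κ x Set.univ ≤ 1 := fun x => by
    by_cases hx : ∫⁻ y, k x y ∂ν ≤ 1
    · rw [hκ x hx]
      simpa using hx
    · rw [Kernel.piecewise_apply, if_neg (by exact hx)]
      simp
  exact ⟨κ, hle, ⟨1, ENNReal.one_lt_top, hle⟩, h1.mono hκ⟩

theorem lintegral_withDensity_mul {μ : Measure E} {f g : E → ℝ≥0∞} (hf : Measurable f)
    (hg : Measurable g) : ∫⁻ x, g x ∂μ.withDensity f = ∫⁻ x, f x * g x ∂μ :=
  lintegral_withDensity_eq_lintegral_mul _ hf hg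

/-- The Markov operator of a transition density `k` that leaves `π` invariant. -/
theorem exists_markovOperator_of_density {μ π : Measure E} [SFinite μ]
    {k : E → E → ℝ≥0∞} (hk : Measurable (Function.uncurry k))
    (h1 : ∀ᵐ x ∂π, ∫⁻ y, k x y ∂μ ≤ 1)
    (hinv : ∀ f : E → ℝ≥0∞, Measurable f →
      ∫⁻ x, ∫⁻ y, k x y * f y ∂μ ∂π = ∫⁻ y, f y ∂π) :
    ∃ K : Lp ℝ 2 π →L[ℝ] Lp ℝ 2 π, ∀ g : Lp ℝ 2 π,
      ∀ᵐ x ∂π, Integrable g (μ.withDensity (k x)) ∧ K g x = ∫ y, g y ∂μ.withDensity (k x) := by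
  obtain ⟨κ, hκ, hfin, hκk⟩ := exists_kernel_of_density μ hk h1
  have hkm : ∀ x, Measurable (k x) := fun x => hk.comp measurable_prodMk_left
  have h : κ ∘ₘ π = π := by
    refine Measure.ext_of_lintegral _ fun f hf => ?_
    rw [Measure.lintegral_bind κ.aemeasurable hf.aemeasurable, ← hinv f hf]
    refine lintegral_congr_ae ?_
    filter_upwards [hκk] with x hx
    rw [hx, lintegral_withDensity_mul (hkm x) hf]
  obtain ⟨K, hK⟩ := exists_markovOperator hκ h
  refine ⟨K, fun g => ?_⟩
  filter_upwards [hK g, hκk] with x hx hx'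
  rwa [← hx']

/-- If a Markov operator has transition probabilities bounded below on infinitely many disjoint
sets, then it is not Hilbert–Schmidt. -/
theorem not_isHilbertSchmidt_of_minorization {μ π : Measure E} [IsFiniteMeasure π]
    {k : E → E → ℝ≥0∞} {K : Lp ℝ 2 π →L[ℝ] Lp ℝ 2 π}
    (hK : ∀ g : Lp ℝ 2 π, ∀ᵐ x ∂π, K g x = ∫ y, g y ∂μ.withDensity (k x))
    (hac : ∀ᵐ x ∂π, μ.withDensity (k x) ≪ π)
    (hfin : ∀ᵐ x ∂π, ∫⁻ y, k x y ∂μ ≤ 1)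
    {S : ℕ → Set E} (hS : ∀ j, MeasurableSet (S j)) (hdisj : Pairwise (Function.onFun Disjoint S))
    (hpos : ∀ j, π (S j) ≠ 0) {δ : ℝ} (hδ : 0 < δ)
    (hk : ∀ j, ∀ x ∈ S j, ENNReal.ofReal δ ≤ ∫⁻ y in S j, k x y ∂μ) :
    ¬ IsHilbertSchmidt K := by
  intro hHS
  let c : ℕ → ℝ := fun j => (Real.sqrt (π.real (S j)))⁻¹
  have hπ : ∀ j, 0 < π.real (S j) := fun j =>
    ENNReal.toReal_pos (hpos j) (measure_ne_top _ _)
  let f : ℕ → Lp ℝ 2 π := fun j => indicatorConstLp 2 (hS j) (measure_ne_top π _) (c j)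
  have hf : Orthonormal ℝ f := by
    constructor
    · intro j
      simp only [f]
      rw [norm_indicatorConstLp (by norm_num) (by norm_num)]
      have hc : ‖c j‖ = (Real.sqrt (π.real (S j)))⁻¹ := Real.norm_of_nonneg (by positivity)
      rw [hc, Real.sqrt_eq_rpow]
      norm_num
      exact inv_mul_cancel₀ (Real.rpow_pos_of_pos (hπ j) _).ne'
    · intro i j hij
      simp only [f]
      rw [MeasureTheory.L2.inner_indicatorConstLp_indicatorConstLp]
      have : S i ∩ S j = ∅ := Set.disjoint_iff_inter_eq_empty.mp (hdisj hij)
      simp [this]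
  have hlow : ∀ j, ENNReal.ofReal δ ^ 2 ≤ ‖K (f j)‖ₑ ^ 2 := by
    intro j
    rw [Lp.enorm_sq_eq]
    have h1 : ∀ᵐ x ∂π, x ∈ S j → ENNReal.ofReal δ ^ 2 * ENNReal.ofReal (c j) ^ 2
        ≤ ‖K (f j) x‖ₑ ^ 2 := by
      filter_upwards [hK (f j), hac, hfin] with x hx hac hfin hxS
      rw [hx, ← mul_pow]
      refine pow_le_pow_left' ?_ 2
      -- `f j` equals an indicator only `π`-a.e.; `hac` transfers this to the transition law of `x`.
      have e1 : ∫ y, f j y ∂μ.withDensity (k x)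
          = (μ.withDensity (k x)).real (S j) * c j := by
        rw [integral_congr_ae (hac.ae_le indicatorConstLp_coeFn), integral_indicator (hS j)]
        simp
      have hne : μ.withDensity (k x) (S j) ≠ ∞ := by
        refine ne_top_of_le_ne_top ENNReal.one_ne_top (le_trans (measure_mono (Set.subset_univ _))
          ?_)
        simpa using hfin
      rw [e1, Real.enorm_eq_ofReal (by positivity), ENNReal.ofReal_mul (by positivity),
        measureReal_def, ENNReal.ofReal_toReal hne, withDensity_apply _ (hS j)]
      gcongr
      exact hk j x hxS
    calc ENNReal.ofReal δ ^ 2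
        = ∫⁻ x in S j, ENNReal.ofReal δ ^ 2 * ENNReal.ofReal (c j) ^ 2 ∂π := by
          have e2 : ENNReal.ofReal (c j) ^ 2 * π (S j) = 1 := by
            rw [← ENNReal.ofReal_toReal (measure_ne_top π (S j)),
              ← ENNReal.ofReal_pow (by positivity), ← ENNReal.ofReal_mul (by positivity)]
            simp only [c]
            rw [inv_pow, Real.sq_sqrt (hπ j).le, ← measureReal_def,
              inv_mul_cancel₀ (hπ j).ne', ENNReal.ofReal_one]
          rw [setLIntegral_const, mul_assoc, e2, mul_one]
      _ ≤ ∫⁻ x in S j, ‖K (f j) x‖ₑ ^ 2 ∂π := by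
          refine lintegral_mono_ae ?_
          exact (ae_restrict_iff' (hS j)).mpr h1
      _ ≤ ∫⁻ x, ‖K (f j) x‖ₑ ^ 2 ∂π := setLIntegral_le_lintegral _ _
  have := ge_of_tendsto' (hHS.tendsto_norm_apply hf) hlow
  have hδ' : ENNReal.ofReal δ ≠ 0 := by simpa using hδ
  simp [hδ'] at this

end DensityKernels

/-! ### Data augmentation chains and the trace criterion -/

section DataAugmentation

variable {E F : Type*} [MeasurableSpace E] [MeasurableSpace F]

theorem lintegral_const_mul_mul {μ : Measure E} (c : ℝ≥0∞) {f g : E → ℝ≥0∞} (hf : Measurable f)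
    (hg : Measurable g) : c * ∫⁻ x, f x * g x ∂μ = ∫⁻ x, c * f x * g x ∂μ := by
  rw [← lintegral_const_mul c (f := fun x => f x * g x) (hf.mul hg)]
  simp_rw [mul_assoc]

/-- Bessel's inequality for the functional `g ↦ ∫ g r dπ`, without assuming that `r` is square
integrable. -/
theorem Orthonormal.sum_enorm_integral_withDensity_sq_le {π : Measure E} {ι : Type*}
    {e : ι → Lp ℝ 2 π} (he : Orthonormal ℝ e) (s : Finset ι) {r : E → ℝ≥0∞} (hr : Measurable r) :
    ∑ i ∈ s, ‖∫ x, e i x ∂π.withDensity r‖ₑ ^ 2 ≤ ∫⁻ x, r x ^ 2 ∂π := by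
  -- If `r` is not square integrable the bound is vacuous. Otherwise `r` is an element of `L²` and
  -- the functional is an inner product with it.
  by_cases hfin : ∫⁻ x, r x ^ 2 ∂π = ∞
  · rw [hfin]; exact le_top
  have hrfin : ∀ᵐ x ∂π, r x < ∞ := by
    filter_upwards [ae_lt_top (hr.pow_const 2) hfin] with x hx
    by_contra hc
    rw [not_lt_top_iff.mp hc] at hx
    simp at hx
  have hR : ∫⁻ x, ‖(r x).toReal‖ₑ ^ 2 ∂π = ∫⁻ x, r x ^ 2 ∂π := by
    refine lintegral_congr_ae ?_
    filter_upwards [hrfin] with x hx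
    rw [Real.enorm_eq_ofReal ENNReal.toReal_nonneg, ENNReal.ofReal_toReal hx.ne]
  have hmem : MemLp (fun x => (r x).toReal) 2 π := by
    refine ⟨hr.ennreal_toReal.aestronglyMeasurable, ?_⟩
    by_contra hc
    rw [lintegral_enorm_sq_eq, not_lt_top_iff.mp hc] at hR
    exact hfin (by rw [← hR]; simp)
  have h1 : ∀ i, ∫ x, e i x ∂π.withDensity r = ⟪e i, hmem.toLp _⟫_ℝ := fun i => by
    rw [integral_withDensity_eq_integral_toReal_smul hr hrfin, L2.inner_def]
    refine integral_congr_ae ?_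
    filter_upwards [hmem.coeFn_toLp] with x hx
    rw [hx]
    simp
  simp_rw [h1]
  calc ∑ i ∈ s, ‖⟪e i, hmem.toLp _⟫_ℝ‖ₑ ^ 2
      ≤ ∑' i, ‖⟪e i, hmem.toLp _⟫_ℝ‖ₑ ^ 2 := ENNReal.sum_le_tsum _
    _ ≤ ‖hmem.toLp _‖ₑ ^ 2 := he.tsum_enorm_inner_sq_le _
    _ = ∫⁻ x, r x ^ 2 ∂π := by
        rw [← hR, lintegral_enorm_sq_eq, Lp.enorm_def, eLpNorm_congr_ae hmem.coeFn_toLp]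

/-- A data augmentation chain, with joint density `G(x) a(x, τ) = T(τ) b(τ, x)` and transition
density `k(x, y) = ∫ a(x, τ) b(τ, y) dτ`, has a trace class Markov operator as soon as
`∫ k(x, x) dx < ∞`. -/
theorem exists_traceClass_markovOperator {μ : Measure E} {ν : Measure F} [SFinite μ] [SFinite ν]
    {G : E → ℝ≥0∞} {T : F → ℝ≥0∞} {a : E → F → ℝ≥0∞} {b : F → E → ℝ≥0∞}
    (hG : Measurable G) (hT : Measurable T) (ha : Measurable (Function.uncurry a))
    (hb : Measurable (Function.uncurry b)) (hGfin : ∫⁻ x, G x ∂μ ≠ ∞)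
    (hGpos : ∀ᵐ x ∂μ, G x ≠ 0 ∧ G x ≠ ∞)
    (hjoint : ∀ᵐ x ∂μ, ∀ᵐ τ ∂ν, G x * a x τ = T τ * b τ x)
    (ha1 : ∀ᵐ x ∂μ, ∫⁻ τ, a x τ ∂ν = 1) (hb1 : ∀ᵐ τ ∂ν, ∫⁻ x, b τ x ∂μ = 1)
    (htr : ∫⁻ τ, ∫⁻ x, a x τ * b τ x ∂μ ∂ν ≠ ∞) :
    ∃ K : Lp ℝ 2 (μ.withDensity G) →L[ℝ] Lp ℝ 2 (μ.withDensity G),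
      (∀ g : Lp ℝ 2 (μ.withDensity G), ∀ᵐ x ∂μ.withDensity G,
        Integrable g (μ.withDensity fun y => ∫⁻ τ, a x τ * b τ y ∂ν) ∧
        K g x = ∫ y, g y ∂μ.withDensity fun y => ∫⁻ τ, a x τ * b τ y ∂ν) ∧
      IsTraceClass K ∧ IsHilbertSchmidt K := by
  have ham : ∀ x, Measurable (a x) := fun x => ha.comp measurable_prodMk_left
  have hbm : ∀ τ, Measurable (b τ) := fun τ => hb.comp measurable_prodMk_left
  obtain ⟨κ, hκ1, hκf, hκ⟩ := exists_kernel_of_density ν ha (ha1.mono fun x hx => hx.le)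
  obtain ⟨η, hη1, hηf, hη⟩ := exists_kernel_of_density μ hb (hb1.mono fun x hx => hx.le)
  set π := μ.withDensity G with hπ
  set ρ := ν.withDensity T with hρ
  have hπac : π ≪ μ := withDensity_absolutelyContinuous _ _
  have hρac : ρ ≪ ν := withDensity_absolutelyContinuous _ _
  have : IsFiniteMeasure π := isFiniteMeasure_withDensity hGfin
  have hjoint' : ∀ᵐ τ ∂ν, ∀ᵐ x ∂μ, G x * a x τ = T τ * b τ x := by
    refine Measure.ae_ae_comm ?_ |>.mp hjoint
    exact measurableSet_eq_fun ((hG.comp measurable_fst).mul ha)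
      ((hT.comp measurable_snd).mul (hb.comp measurable_swap))
  -- Detailed balance: `G a = T b` says that `κ` from `π` and `η` from `ρ` disintegrate one joint
  -- measure. The marginal identities and the adjointness of the two operators are instances.
  have hswap : ∀ f : F × E → ℝ≥0∞, Measurable f →
      ∫⁻ x, ∫⁻ τ, f (τ, x) ∂κ x ∂π = ∫⁻ τ, ∫⁻ x, f (τ, x) ∂η τ ∂ρ := by
    intro f hf
    have hfm : ∀ x, Measurable fun τ => f (τ, x) := fun x => hf.comp measurable_prodMk_right
    have hfm' : ∀ τ, Measurable fun x => f (τ, x) := fun τ => hf.comp measurable_prodMk_left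
    calc ∫⁻ x, ∫⁻ τ, f (τ, x) ∂κ x ∂π
        = ∫⁻ x, ∫⁻ τ, G x * a x τ * f (τ, x) ∂ν ∂μ := by
          rw [hπ, lintegral_withDensity_mul (g := fun x => ∫⁻ τ, f (τ, x) ∂κ x) hG
            (Measurable.lintegral_kernel_prod_right' (hf.comp measurable_swap))]
          refine lintegral_congr_ae ?_
          filter_upwards [hκ] with x hx
          rw [hx, lintegral_withDensity_mul (ham x) (hfm x),
            lintegral_const_mul_mul _ (ham x) (hfm x)]
      _ = ∫⁻ τ, ∫⁻ x, G x * a x τ * f (τ, x) ∂μ ∂ν := by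
          refine lintegral_lintegral_swap (Measurable.aemeasurable ?_)
          exact ((hG.comp measurable_fst).mul ha).mul (hf.comp measurable_swap)
      _ = ∫⁻ τ, ∫⁻ x, T τ * b τ x * f (τ, x) ∂μ ∂ν := by
          refine lintegral_congr_ae ?_
          filter_upwards [hjoint'] with τ hτ
          refine lintegral_congr_ae ?_
          filter_upwards [hτ] with x hx
          rw [hx]
      _ = ∫⁻ τ, ∫⁻ x, f (τ, x) ∂η τ ∂ρ := by
          rw [hρ, lintegral_withDensity_mul hT (Measurable.lintegral_kernel_prod_right' hf)]
          refine lintegral_congr_ae ?_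
          filter_upwards [hη] with τ hτ
          rw [hτ, lintegral_withDensity_mul (hbm τ) (hfm' τ),
            lintegral_const_mul_mul _ (hbm τ) (hfm' τ)]
  have hηuniv : ∀ᵐ τ ∂ν, η τ Set.univ = 1 := by
    filter_upwards [hη, hb1] with τ h1 h2
    rw [h1]; simpa using h2
  have hκuniv : ∀ᵐ x ∂μ, κ x Set.univ = 1 := by
    filter_upwards [hκ, ha1] with τ h1 h2
    rw [h1]; simpa using h2
  have hκπ : κ ∘ₘ π = ρ := by
    refine Measure.ext_of_lintegral _ fun f hf => ?_
    rw [Measure.lintegral_bind κ.aemeasurable hf.aemeasurable,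
      hswap (fun z => f z.1) (hf.comp measurable_fst)]
    refine lintegral_congr_ae ?_
    filter_upwards [hρac.ae_le hηuniv] with τ hτ
    simp [hτ]
  have hηρ : η ∘ₘ ρ = π := by
    refine Measure.ext_of_lintegral _ fun f hf => ?_
    rw [Measure.lintegral_bind η.aemeasurable hf.aemeasurable,
      ← hswap (fun z => f z.2) (hf.comp measurable_snd)]
    refine lintegral_congr_ae ?_
    filter_upwards [hπac.ae_le hκuniv] with τ hτ
    simp [hτ]
  have : IsFiniteMeasure ρ := by
    rw [← hκπ]
    infer_instance
  obtain ⟨B, hB⟩ := exists_markovOperator hη1 hηρ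
  obtain ⟨B', hB'⟩ := exists_markovOperator hκ1 hκπ
  have hadj : B' = ContinuousLinearMap.adjoint B := by
    refine eq_adjoint_of_compProd_eq hκ1 hκπ (η := η) ?_ (fun g => (hB g).mono fun _ h => h.2)
      (fun g => (hB' g).mono fun _ h => h.2)
    refine Measure.ext_of_lintegral _ fun f hf => ?_
    rw [lintegral_map hf measurable_swap, Measure.lintegral_compProd (f := fun z => f z.swap) (hf.comp measurable_swap),
      Measure.lintegral_compProd hf]
    exact hswap f hf
  have hcomp : ∀ᵐ x ∂μ, (η ∘ₖ κ) x = μ.withDensity fun y => ∫⁻ τ, a x τ * b τ y ∂ν := by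
    filter_upwards [hκ] with x hx
    refine Measure.ext_of_lintegral _ fun f hf => ?_
    have hm : Measurable fun z : E × F => a x z.2 * b z.2 z.1 :=
      ((ham x).comp measurable_snd).mul (hb.comp measurable_swap)
    rw [Kernel.lintegral_comp _ _ _ hf, hx,
      lintegral_withDensity_mul (ham x) hf.lintegral_kernel,
      lintegral_withDensity_mul hm.lintegral_prod_right' hf]
    calc ∫⁻ τ, a x τ * ∫⁻ y, f y ∂η τ ∂ν
        = ∫⁻ τ, ∫⁻ y, a x τ * b τ y * f y ∂μ ∂ν := by
          refine lintegral_congr_ae ?_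
          filter_upwards [hη] with τ hτ
          rw [hτ, lintegral_withDensity_mul (hbm τ) hf,
            lintegral_const_mul_mul _ (hbm τ) hf]
      _ = ∫⁻ y, ∫⁻ τ, a x τ * b τ y * f y ∂ν ∂μ := by
          refine lintegral_lintegral_swap (Measurable.aemeasurable ?_)
          exact (hm.comp measurable_swap).mul (hf.comp measurable_snd)
      _ = ∫⁻ y, (∫⁻ τ, a x τ * b τ y ∂ν) * f y ∂μ := by
          refine lintegral_congr fun y => ?_
          rw [lintegral_mul_const (f := fun τ => a x τ * b τ y) _ (hm.comp measurable_prodMk_left)]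
  have hcompπ : (η ∘ₖ κ) ∘ₘ π = π := by
    rw [← Measure.comp_assoc, hκπ, hηρ]
  refine ⟨ContinuousLinearMap.adjoint B ∘L B, fun g => ?_, ?_⟩
  · have hgm := Lp.stronglyMeasurable g
    have hBg : ∀ᵐ x ∂π, ∀ᵐ τ ∂κ x, B g τ = ∫ y, g y ∂η τ := by
      refine Measure.ae_ae_of_ae_comp ?_
      rw [hκπ]
      exact (hB g).mono fun _ h => h.2
    filter_upwards [hπac.ae_le hcomp, ae_memLp_of_comp hcompπ hgm.measurable (Lp.memLp g),
      hB' (B g), hBg] with x hx hmem hBx hBgx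
    have hint : Integrable g ((η ∘ₖ κ) x) := hmem.integrable (by norm_num)
    rw [← hx]
    refine ⟨hint, ?_⟩
    rw [Kernel.integral_comp hint, ← hadj, ContinuousLinearMap.comp_apply, hBx.2,
      integral_congr_ae hBgx]
  · refine isTraceClass_adjoint_comp_self B (∫⁻ τ, ∫⁻ x, a x τ * b τ x ∂μ ∂ν).toReal
      fun w e s => ?_
    rw [← ENNReal.ofReal_le_iff_le_toReal htr, ENNReal.ofReal_sum_of_nonneg
      (fun _ _ => by positivity)]
    have hrm : ∀ τ, Measurable fun x => b τ x / G x := fun τ => (hbm τ).div hG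
    have hdens : ∀ᵐ τ ∂ν, η τ = π.withDensity fun x => b τ x / G x := by
      filter_upwards [hη] with τ hτ
      rw [hτ, hπ, ← withDensity_mul _ hG (hrm τ)]
      refine withDensity_congr_ae ?_
      filter_upwards [hGpos] with x hx
      rw [Pi.mul_apply, ENNReal.mul_div_cancel hx.1 hx.2]
    calc ∑ i ∈ s, ENNReal.ofReal (‖B (e i)‖ ^ 2)
        = ∑ i ∈ s, ∫⁻ τ, ‖B (e i) τ‖ₑ ^ 2 ∂ρ := by
          refine Finset.sum_congr rfl fun i _ => ?_
          rw [← Lp.enorm_sq_eq, ENNReal.ofReal_pow (norm_nonneg _), ofReal_norm]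
      _ = ∫⁻ τ, ∑ i ∈ s, ‖B (e i) τ‖ₑ ^ 2 ∂ρ := by
          refine (lintegral_finsetSum _ fun i _ => ?_).symm
          exact (Lp.stronglyMeasurable (B (e i))).measurable.enorm.pow_const 2
      _ ≤ ∫⁻ τ, ∫⁻ x, (b τ x / G x) ^ 2 ∂π ∂ρ := by
          refine lintegral_mono_ae ?_
          have hBs : ∀ᵐ τ ∂ρ, ∀ i ∈ s, B (e i) τ = ∫ x, e i x ∂η τ :=
            (Finset.eventually_all s).mpr fun i _ => (hB (e i)).mono fun _ h => h.2
          filter_upwards [hBs, hρac.ae_le hdens] with τ h1 h2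
          rw [Finset.sum_congr rfl fun i hi => by rw [h1 i hi, h2]]
          exact e.orthonormal.sum_enorm_integral_withDensity_sq_le s (hrm τ)
      _ = ∫⁻ τ, T τ * ∫⁻ x, G x * (b τ x / G x) ^ 2 ∂μ ∂ν := by
          have hm : Measurable fun z : F × E => (b z.1 z.2 / G z.2) ^ 2 :=
            (hb.div (hG.comp measurable_snd)).pow_const 2
          rw [hρ, lintegral_withDensity_mul hT hm.lintegral_prod_right']
          refine lintegral_congr fun τ => ?_
          rw [hπ, lintegral_withDensity_mul hG ((hrm τ).pow_const 2)]
      _ = ∫⁻ τ, ∫⁻ x, a x τ * b τ x ∂μ ∂ν := by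
          refine lintegral_congr_ae ?_
          filter_upwards [hjoint'] with τ hτ
          rw [lintegral_const_mul_mul _ hG ((hrm τ).pow_const 2)]
          refine lintegral_congr_ae ?_
          filter_upwards [hτ, hGpos] with x hx hGx
          -- Trading one factor `T b` for `G a` turns `T b²/G` into `a b`; since `G` is neither `0`
          -- nor `∞`, it may be cancelled.
          calc T τ * G x * (b τ x / G x) ^ 2
              = T τ * b τ x * (b τ x * (G x * (G x)⁻¹) * (G x)⁻¹) := by
                rw [div_eq_mul_inv]; ring
            _ = G x * a x τ * (b τ x * (G x)⁻¹) := by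
                rw [← hx, ENNReal.mul_inv_cancel hGx.1 hGx.2, mul_one]
            _ = G x * (G x)⁻¹ * (a x τ * b τ x) := by ring
            _ = a x τ * b τ x := by
                rw [ENNReal.mul_inv_cancel hGx.1 hGx.2, one_mul]

end DataAugmentation

/-! ### Explicit integrals: gamma, Gaussian, inverse Gaussian -/

section Integrals

open Set

/-- A Bochner integral of a nonintegrable function is `0` by default, so a nonzero value already
proves integrability. -/
theorem lintegral_ofReal_of_integral_pos {E : Type*} [MeasurableSpace E] {μ : Measure E} {f : E → ℝ}
    (hf : 0 ≤ᵐ[μ] f) (h : ∫ x, f x ∂μ ≠ 0) :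
    ∫⁻ x, ENNReal.ofReal (f x) ∂μ = ENNReal.ofReal (∫ x, f x ∂μ) :=
  (ofReal_integral_eq_lintegral_ofReal (Integrable.of_integral_ne_zero h) hf).symm

theorem lintegral_comp_rpow_Ioi (g : ℝ → ℝ≥0∞) {q : ℝ} (hq : q ≠ 0) :
    ∫⁻ x in Ioi 0, ENNReal.ofReal (|q| * x ^ (q - 1)) * g (x ^ q) = ∫⁻ y in Ioi 0, g y := by
  have himg : (fun x : ℝ => x ^ q) '' Ioi 0 = Ioi (0 : ℝ) := by
    ext y
    constructor
    · rintro ⟨x, hx, rfl⟩; exact Real.rpow_pos_of_pos hx q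
    · intro hy
      exact ⟨y ^ q⁻¹, Real.rpow_pos_of_pos hy _, by
        simp only; rw [← Real.rpow_mul (le_of_lt hy), inv_mul_cancel₀ hq, Real.rpow_one]⟩
  have hinj : InjOn (fun x : ℝ => x ^ q) (Ioi 0) := fun x hx y hy h => by
    have := congrArg (fun z : ℝ => z ^ q⁻¹) h
    simpa [← Real.rpow_mul (le_of_lt hx), ← Real.rpow_mul (le_of_lt hy), mul_inv_cancel₀ hq]
      using this
  have h := lintegral_image_eq_lintegral_abs_deriv_mul measurableSet_Ioi
    (fun x hx => (Real.hasDerivAt_rpow_const (p := q) (Or.inl (ne_of_gt hx))).hasDerivWithinAt)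
    hinj g
  rw [himg] at h
  rw [h]
  refine setLIntegral_congr_fun measurableSet_Ioi fun x hx => ?_
  rw [abs_mul, abs_of_pos (Real.rpow_pos_of_pos hx _)]

theorem lintegral_rpow_mul_exp_neg_mul_Ioi {a r : ℝ} (ha : 0 < a) (hr : 0 < r) :
    ∫⁻ t in Ioi 0, ENNReal.ofReal (t ^ (a - 1) * Real.exp (-(r * t)))
      = ENNReal.ofReal ((1 / r) ^ a * Real.Gamma a) := by
  rw [← Real.integral_rpow_mul_exp_neg_mul_Ioi ha hr]
  refine lintegral_ofReal_of_integral_pos ?_ ?_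
  · filter_upwards [ae_restrict_mem measurableSet_Ioi] with t ht
    have : (0 : ℝ) < t := ht
    simp only [Pi.zero_apply]
    positivity
  · rw [Real.integral_rpow_mul_exp_neg_mul_Ioi ha hr]
    have := Real.Gamma_pos_of_pos ha
    positivity

theorem lintegral_rpow_mul_exp_neg_div_Ioi {a r : ℝ} (ha : 0 < a) (hr : 0 < r) :
    ∫⁻ t in Ioi 0, ENNReal.ofReal (t ^ (-a - 1) * Real.exp (-r / t))
      = ENNReal.ofReal (Real.Gamma a / r ^ a) := by
  have h := lintegral_comp_rpow_Ioi
    (fun t => ENNReal.ofReal (t ^ (a - 1) * Real.exp (-(r * t)))) (q := -1) (by norm_num)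
  rw [lintegral_rpow_mul_exp_neg_mul_Ioi ha hr] at h
  rw [show Real.Gamma a / r ^ a = (1 / r) ^ a * Real.Gamma a by
    rw [Real.div_rpow zero_le_one hr.le, Real.one_rpow]; ring, ← h]
  refine setLIntegral_congr_fun measurableSet_Ioi fun t ht => ?_
  have ht : (0 : ℝ) < t := ht
  rw [← ENNReal.ofReal_mul (by positivity), ← Real.rpow_mul ht.le, ← mul_assoc, abs_neg, abs_one,
    one_mul, ← Real.rpow_add ht, Real.rpow_neg_one]
  ring_nf

/-- The substitution `y = t^(-1/2)` turns this into a gamma integral of shape `2a`. It settles the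
`σ²`-integral in the proof of properness. -/
theorem lintegral_rpow_mul_exp_neg_div_sqrt_lt_top {a c : ℝ} (ha : 0 < a) (hc : 0 < c) :
    ∫⁻ t in Ioi 0, ENNReal.ofReal (t ^ (-a - 1) * Real.exp (-c / √t)) < ∞ := by
  have h := lintegral_comp_rpow_Ioi
    (fun t => ENNReal.ofReal (t ^ (2 * a - 1) * Real.exp (-(c * t)))) (q := -1 / 2) (by norm_num)
  rw [lintegral_rpow_mul_exp_neg_mul_Ioi (by positivity) hc] at h
  have h2 : ∫⁻ t in Ioi 0, ENNReal.ofReal (t ^ (-a - 1) * Real.exp (-c / √t))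
      = 2 * ∫⁻ x in Ioi 0, ENNReal.ofReal (|(-1 / 2 : ℝ)| * x ^ ((-1 / 2 : ℝ) - 1)) *
          ENNReal.ofReal ((x ^ (-1 / 2 : ℝ)) ^ (2 * a - 1) *
            Real.exp (-(c * x ^ (-1 / 2 : ℝ)))) := by
    rw [← lintegral_const_mul' _ _ (by norm_num)]
    refine setLIntegral_congr_fun measurableSet_Ioi fun t ht => ?_
    have ht : (0 : ℝ) < t := ht
    have hhalf : |(-1 / 2 : ℝ)| = 1 / 2 := by rw [abs_of_nonpos] <;> norm_num
    rw [← ENNReal.ofReal_mul (by positivity), hhalf,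
      show (2 : ℝ≥0∞) = ENNReal.ofReal 2 by norm_num, ← ENNReal.ofReal_mul (by norm_num),
      ← Real.rpow_mul ht.le]
    have e1 : t ^ (-a - 1) = t ^ ((-1 / 2 : ℝ) - 1) * t ^ (-1 / 2 * (2 * a - 1)) := by
      rw [← Real.rpow_add ht]; ring_nf
    have e2 : -c / √t = -(c * t ^ (-1 / 2 : ℝ)) := by
      rw [neg_div, neg_div, Real.rpow_neg ht.le, ← Real.sqrt_eq_rpow, ← div_eq_mul_inv]
    rw [e1, e2]
    ring_nf
  rw [h2, h]
  exact ENNReal.mul_lt_top (by norm_num) ENNReal.ofReal_lt_top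

theorem lintegral_inverseGammaPDFReal {a b : ℝ} (ha : 0 < a) (hb : 0 < b) :
    ∫⁻ x in Ioi 0, ENNReal.ofReal (inverseGammaPDFReal a b x) = 1 := by
  have hΓ := Real.Gamma_pos_of_pos ha
  calc ∫⁻ x in Ioi 0, ENNReal.ofReal (inverseGammaPDFReal a b x)
      = ∫⁻ x in Ioi 0, ENNReal.ofReal (b ^ a / Real.Gamma a) *
          ENNReal.ofReal (x ^ (-a - 1) * Real.exp (-b / x)) := by
        refine setLIntegral_congr_fun measurableSet_Ioi fun x hx => ?_
        have hx : (0 : ℝ) < x := hx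
        simp only [inverseGammaPDFReal, if_pos hx]
        rw [← ENNReal.ofReal_mul (by positivity), mul_assoc]
    _ = 1 := by
        rw [lintegral_const_mul' _ _ ENNReal.ofReal_ne_top,
          lintegral_rpow_mul_exp_neg_div_Ioi ha hb, ← ENNReal.ofReal_mul (by positivity),
          div_mul_div_cancel₀ hΓ.ne', div_self (by positivity), ENNReal.ofReal_one]

theorem lintegral_exp_neg_sq_div {v : ℝ} (hv : 0 < v) :
    ∫⁻ x : ℝ, ENNReal.ofReal (Real.exp (-x ^ 2 / (2 * v))) = ENNReal.ofReal √(2 * Real.pi * v) := by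
  have h : ∫ x : ℝ, Real.exp (-x ^ 2 / (2 * v)) = √(2 * Real.pi * v) := by
    have := integral_gaussian (1 / (2 * v))
    rw [show Real.pi / (1 / (2 * v)) = 2 * Real.pi * v by field_simp] at this
    rw [← this]
    congr with x
    ring_nf
  rw [← h]
  refine lintegral_ofReal_of_integral_pos (Filter.Eventually.of_forall fun x => by positivity) ?_
  rw [h]
  positivity

theorem lintegral_exp_neg_mul_abs {c : ℝ} (hc : 0 < c) :
    ∫⁻ x : ℝ, ENNReal.ofReal (Real.exp (-(c * |x|))) = ENNReal.ofReal (2 / c) := by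
  have h : ∫ x : ℝ, Real.exp (-(c * |x|)) = 2 / c := by
    rw [integral_comp_abs (f := fun x => Real.exp (-(c * x)))]
    have := Real.integral_rpow_mul_exp_neg_mul_Ioi zero_lt_one hc
    simp only [sub_self, Real.rpow_zero, one_mul, Real.rpow_one, Real.Gamma_one, mul_one] at this
    rw [this]
    ring
  rw [← h]
  refine lintegral_ofReal_of_integral_pos (Filter.Eventually.of_forall fun x => by positivity) ?_
  rw [h]
  positivity

/-- The normalization of the reciprocal of an inverse Gaussian variable. -/
theorem lintegral_reciprocalInverseGaussian {a b : ℝ} (ha : 0 ≤ a) (hb : 0 < b) :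
    ∫⁻ t in Ioi 0, ENNReal.ofReal (b / √(2 * Real.pi) * (√t)⁻¹ *
      Real.exp (-(a - b * t) ^ 2 / (2 * t))) = 1 := by
  set I₁ := ∫⁻ t in Ioi 0, ENNReal.ofReal ((√t)⁻¹ * Real.exp (-(a - b * t) ^ 2 / (2 * t))) with hI₁
  suffices h : ENNReal.ofReal b * I₁ = ENNReal.ofReal √(2 * Real.pi) by
    have hpi : (0 : ℝ) < √(2 * Real.pi) := by positivity
    calc _ = ∫⁻ t in Ioi 0, ENNReal.ofReal (√(2 * Real.pi))⁻¹ * (ENNReal.ofReal b *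
          ENNReal.ofReal ((√t)⁻¹ * Real.exp (-(a - b * t) ^ 2 / (2 * t)))) := by
          refine lintegral_congr fun t => ?_
          rw [← ENNReal.ofReal_mul hb.le, ← ENNReal.ofReal_mul (by positivity)]
          congr 1
          ring
      _ = 1 := by
          rw [lintegral_const_mul' _ _ ENNReal.ofReal_ne_top,
            lintegral_const_mul' _ _ ENNReal.ofReal_ne_top, ← hI₁, h,
            ← ENNReal.ofReal_mul (by positivity), inv_mul_cancel₀ hpi.ne', ENNReal.ofReal_one]
  -- For `a = 0` the substitutions below degenerate, and the integral is a gamma integral of shape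
  -- `1/2`.
  rcases ha.eq_or_lt with rfl | ha
  · have h1 : I₁ = ENNReal.ofReal ((1 / (b ^ 2 / 2)) ^ (1 / 2 : ℝ) * Real.Gamma (1 / 2)) := by
      rw [← lintegral_rpow_mul_exp_neg_mul_Ioi (by norm_num) (by positivity)]
      refine setLIntegral_congr_fun measurableSet_Ioi fun t ht => ?_
      have ht : (0 : ℝ) < t := ht
      rw [show (1 / 2 - 1 : ℝ) = -(1 / 2) by norm_num, Real.rpow_neg ht.le, ← Real.sqrt_eq_rpow]
      congr 3
      field_simp
      ring
    rw [h1, ← ENNReal.ofReal_mul hb.le, ← Real.sqrt_eq_rpow, Real.Gamma_one_half_eq]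
    congr 1
    rw [show 1 / (b ^ 2 / 2) = 2 / b ^ 2 by field_simp, Real.sqrt_div (by norm_num),
      Real.sqrt_sq hb.le, Real.sqrt_mul (by norm_num)]
    field_simp
  set I₂ := ∫⁻ t in Ioi 0, ENNReal.ofReal (t⁻¹ * (√t)⁻¹ * Real.exp (-(a - b * t) ^ 2 / (2 * t)))
    with hI₂
  -- The map `u = b√t - a/√t` is an increasing bijection onto `ℝ`, and the exponent becomes `-u²/2`.
  -- Its derivative has two terms, which produce `I₁` and `I₂`.
  have hsum : ENNReal.ofReal (b / 2) * I₁ + ENNReal.ofReal (a / 2) * I₂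
      = ENNReal.ofReal √(2 * Real.pi) := by
    have hd : ∀ t ∈ Ioi (0 : ℝ), HasDerivWithinAt (fun t => b * √t - a * (√t)⁻¹)
        (b / 2 * (√t)⁻¹ + a / 2 * (t⁻¹ * (√t)⁻¹)) (Ioi 0) t := fun t ht => by
      have ht : (0 : ℝ) < t := ht
      have h1 := Real.hasDerivAt_sqrt ht.ne'
      have hs : √t ≠ 0 := (Real.sqrt_pos.mpr ht).ne'
      refine (((h1.const_mul b).sub ((h1.inv hs).const_mul a)).congr_deriv ?_).hasDerivWithinAt
      rw [Real.sq_sqrt ht.le]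
      field_simp
      ring
    have hmono : StrictMonoOn (fun t => b * √t - a * (√t)⁻¹) (Ioi 0) := fun x hx y hy hxy => by
      have hx : (0 : ℝ) < x := hx
      have h1 : √x < √y := Real.sqrt_lt_sqrt hx.le hxy
      have h2 : (√y)⁻¹ < (√x)⁻¹ := inv_strictAnti₀ (Real.sqrt_pos.mpr hx) h1
      have := mul_lt_mul_of_pos_left h1 hb
      have := mul_lt_mul_of_pos_left h2 ha
      simp only
      linarith
    have himg : (fun t => b * √t - a * (√t)⁻¹) '' Ioi 0 = univ := by
      refine eq_univ_of_forall fun u => ?_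
      -- The positive root of `b w² - u w - a = 0`, the equation for `w = √t`.
      set w := (u + √(u ^ 2 + 4 * a * b)) / (2 * b) with hw
      have h0 : |u| < √(u ^ 2 + 4 * a * b) := by
        rw [← Real.sqrt_sq_eq_abs]
        exact Real.sqrt_lt_sqrt (sq_nonneg u) (by nlinarith [mul_pos ha hb])
      have hwpos : 0 < w := by
        have := neg_abs_le u
        have : 0 < u + √(u ^ 2 + 4 * a * b) := by linarith
        positivity
      refine ⟨w ^ 2, by simpa using pow_pos hwpos 2, ?_⟩
      simp only
      rw [Real.sqrt_sq hwpos.le]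
      have hq : b * w ^ 2 - a = u * w := by
        have h3 := Real.sq_sqrt (show 0 ≤ u ^ 2 + 4 * a * b by positivity)
        generalize √(u ^ 2 + 4 * a * b) = r at h3 hw
        rw [hw]
        field_simp
        linear_combination h3
      field_simp
      linarith
    have h := lintegral_image_eq_lintegral_abs_deriv_mul measurableSet_Ioi hd hmono.injOn
      (fun u => ENNReal.ofReal (Real.exp (-u ^ 2 / (2 * 1))))
    rw [himg, setLIntegral_univ, lintegral_exp_neg_sq_div one_pos, mul_one] at h
    rw [h, hI₁, hI₂, ← lintegral_const_mul' _ _ ENNReal.ofReal_ne_top,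
      ← lintegral_const_mul' _ _ ENNReal.ofReal_ne_top, ← lintegral_add_left (by fun_prop)]
    refine setLIntegral_congr_fun measurableSet_Ioi fun t ht => ?_
    have ht : (0 : ℝ) < t := ht
    have hs : 0 < √t := Real.sqrt_pos.mpr ht
    rw [← ENNReal.ofReal_mul (by positivity), ← ENNReal.ofReal_mul (by positivity),
      ← ENNReal.ofReal_add (by positivity) (by positivity), ← ENNReal.ofReal_mul (by positivity),
      abs_of_pos (by positivity)]
    have e : -(a - b * t) ^ 2 / (2 * t) = -(b * √t - a * (√t)⁻¹) ^ 2 / (2 * 1) := by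
      have h3 := Real.sq_sqrt ht.le
      rw [show b * √t - a * (√t)⁻¹ = (b * t - a) / √t by
        field_simp; rw [h3], div_pow, h3]
      field_simp
      ring
    rw [e]
    congr 1
    ring
  -- The involution `t ↦ (a/b)²/t` preserves the exponent and exchanges the two integrals, so each
  -- accounts for half of the Gaussian integral.
  have hsymm : ENNReal.ofReal b * I₁ = ENNReal.ofReal a * I₂ := by
    set c := a / b with hc
    have hcpos : 0 < c := by positivity
    have hd : ∀ t ∈ Ioi (0 : ℝ), HasDerivWithinAt (fun t => c ^ 2 * t⁻¹)
        (c ^ 2 * -(t ^ 2)⁻¹) (Ioi 0) t := fun t ht =>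
      ((hasDerivAt_inv (ne_of_gt ht)).const_mul _).hasDerivWithinAt
    have himg : (fun t => c ^ 2 * t⁻¹) '' Ioi 0 = Ioi (0 : ℝ) := by
      ext y
      constructor
      · rintro ⟨x, hx, rfl⟩
        have hx : (0 : ℝ) < x := hx
        simp only [mem_Ioi]; positivity
      · intro hy
        have hy : (0 : ℝ) < y := hy
        exact ⟨c ^ 2 / y, by simp only [mem_Ioi]; positivity, by field_simp⟩
    have hinj : InjOn (fun t => c ^ 2 * t⁻¹) (Ioi (0 : ℝ)) := fun x _ y _ h => by
      simpa [hcpos.ne'] using h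
    have h := lintegral_image_eq_lintegral_abs_deriv_mul measurableSet_Ioi hd hinj
      (fun t => ENNReal.ofReal ((√t)⁻¹ * Real.exp (-(a - b * t) ^ 2 / (2 * t))))
    rw [himg, ← hI₁] at h
    have h2 : I₁ = ENNReal.ofReal c * I₂ := by
      rw [h, hI₂, ← lintegral_const_mul' _ _ ENNReal.ofReal_ne_top]
      refine setLIntegral_congr_fun measurableSet_Ioi fun t ht => ?_
      have ht : (0 : ℝ) < t := ht
      have hs : 0 < √t := Real.sqrt_pos.mpr ht
      rw [← ENNReal.ofReal_mul (by positivity), ← ENNReal.ofReal_mul (by positivity), mul_neg,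
        abs_neg, abs_of_pos (by positivity), Real.sqrt_mul (by positivity),
        Real.sqrt_sq hcpos.le, Real.sqrt_inv]
      have e : -(a - b * (c ^ 2 * t⁻¹)) ^ 2 / (2 * (c ^ 2 * t⁻¹))
          = -(a - b * t) ^ 2 / (2 * t) := by
        rw [hc]
        field_simp
        ring
      rw [e]
      congr 1
      have h3 := Real.sq_sqrt ht.le
      rw [← mul_assoc, ← mul_assoc]
      congr 1
      field_simp
      rw [h3]
    rw [h2, ← mul_assoc, ← ENNReal.ofReal_mul hb.le, hc, mul_div_cancel₀ _ hb.ne']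
  have h2 : ∀ x : ℝ, 0 ≤ x → ∀ I : ℝ≥0∞, ENNReal.ofReal (x / 2) * I
      = ENNReal.ofReal x * I / 2 := fun x hx I => by
    rw [ENNReal.ofReal_div_of_pos (by norm_num), ENNReal.div_eq_inv_mul, ENNReal.div_eq_inv_mul,
      mul_assoc]
    norm_num
  rw [h2 b hb.le, h2 a ha.le, ← hsymm, ENNReal.add_halves] at hsum
  exact hsum

/-- Tonelli's theorem for a product of functions of one coordinate each. -/
theorem lintegral_fin_prod_eq_prod {p : ℕ} (μ : Fin p → Measure ℝ) [∀ i, SigmaFinite (μ i)]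
    {f : Fin p → ℝ → ℝ≥0∞} (hf : ∀ i, Measurable (f i)) :
    ∫⁻ x, ∏ i, f i (x i) ∂Measure.pi μ = ∏ i, ∫⁻ x, f i x ∂μ i := by
  induction p with
  | zero => simp
  | succ p ih =>
    have hm : Measurable fun x : Fin (p + 1) → ℝ => ∏ i, f i (x i) :=
      Finset.measurable_fun_prod _ fun i _ => (hf i).comp (measurable_pi_apply i)
    have hm' : Measurable fun x : Fin p → ℝ => ∏ i : Fin p, f i.succ (x i) :=
      Finset.measurable_fun_prod _ fun i _ => (hf i.succ).comp (measurable_pi_apply i)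
    rw [← ((measurePreserving_piFinSuccAbove μ 0).symm).lintegral_comp hm]
    simp_rw [MeasurableEquiv.piFinSuccAbove_symm_apply, Fin.insertNthEquiv,
      Fin.prod_univ_succ, Fin.insertNth_zero, Equiv.coe_fn_mk, Fin.cons_succ,
      Fin.zero_succAbove, cast_eq, Fin.cons_zero]
    rw [← ih (fun i => μ i.succ) fun i => hf i.succ]
    exact lintegral_prod_mul (hf 0).aemeasurable hm'.aemeasurable

theorem posDef_exists_transpose_mul_self {p : ℕ} {S : Matrix (Fin p) (Fin p) ℝ} (hS : S.PosDef) :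
    ∃ B : Matrix (Fin p) (Fin p) ℝ, S = Bᵀ * B := by
  open scoped MatrixOrder in
  obtain ⟨B, hB⟩ := CStarAlgebra.nonneg_iff_eq_star_mul_self.mp hS.posSemidef.nonneg
  exact ⟨B, by rw [hB, star_eq_conjTranspose, conjTranspose_eq_transpose_of_trivial]⟩

/-- Writing `S⁻¹ = BᵀB` and substituting `y = B(x - m)` reduces to a product of standard Gaussians;
the Jacobian `|det B⁻¹| = √det S` cancels the normalization. -/
theorem lintegral_multivariateNormalPDFReal {p : ℕ} (m : Fin p → ℝ)
    {S : Matrix (Fin p) (Fin p) ℝ} (hS : S.PosDef) :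
    ∫⁻ x, ENNReal.ofReal (multivariateNormalPDFReal m S x) = 1 := by
  obtain ⟨B, hB⟩ := posDef_exists_transpose_mul_self hS.inv
  have hdetS : 0 < S.det := hS.det_pos
  have hdet : B.det ^ 2 = S.det⁻¹ := by
    rw [← Ring.inverse_eq_inv', ← det_nonsing_inv, hB, det_mul, det_transpose, sq]
  have hdetB : B.det ≠ 0 := fun h => by
    rw [h] at hdet
    have : (0 : ℝ) < S.det⁻¹ := by positivity
    linarith [hdet ▸ this]
  have hq : ∀ z : Fin p → ℝ, z ⬝ᵥ (S⁻¹ *ᵥ z) = ∑ i, (toLin' B z) i ^ 2 := fun z => by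
    rw [hB, ← mulVec_mulVec, dotProduct_mulVec, vecMul_transpose, toLin'_apply, dotProduct]
    simp_rw [sq]
  set c := (√((2 * Real.pi) ^ p * S.det))⁻¹ with hc
  have hc0 : 0 ≤ c := by positivity
  set g : (Fin p → ℝ) → ℝ≥0∞ := fun y => ∏ i, ENNReal.ofReal (Real.exp (-(y i) ^ 2 / (2 * 1)))
    with hg
  have hgm : Measurable g := Finset.measurable_fun_prod _ fun i _ => by fun_prop
  have hBm : Measurable (toLin' B) := (LinearMap.continuous_on_pi _).measurable
  calc ∫⁻ x, ENNReal.ofReal (multivariateNormalPDFReal m S x)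
      = ∫⁻ x, ENNReal.ofReal c * g (toLin' B (x - m)) := by
        refine lintegral_congr fun x => ?_
        rw [multivariateNormalPDFReal, hq, ENNReal.ofReal_mul hc0, hg]
        simp only
        rw [← ENNReal.ofReal_prod_of_nonneg fun i _ => by positivity, ← Real.exp_sum,
          ← Finset.sum_div, Finset.sum_neg_distrib, mul_one]
    _ = ENNReal.ofReal c * ∫⁻ x, g (toLin' B x) := by
        rw [lintegral_const_mul' _ _ ENNReal.ofReal_ne_top,
          lintegral_sub_right_eq_self (fun x => g (toLin' B x)) m]
    _ = ENNReal.ofReal c * (ENNReal.ofReal |B.det⁻¹| * ∫⁻ y, g y) := by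
        rw [← lintegral_map hgm hBm, Real.map_matrix_volume_pi_eq_smul_volume_pi hdetB,
          lintegral_smul_measure, smul_eq_mul]
    _ = 1 := by
        rw [hg, volume_pi, lintegral_fin_prod_eq_prod (f := fun _ t =>
          ENNReal.ofReal (Real.exp (-t ^ 2 / (2 * 1)))) _ fun i => by fun_prop]
        simp_rw [lintegral_exp_neg_sq_div one_pos]
        rw [Finset.prod_const, Finset.card_univ, Fintype.card_fin, ← ENNReal.ofReal_pow
          (by positivity), ← ENNReal.ofReal_mul (by positivity), ← ENNReal.ofReal_mul hc0,
          ← ENNReal.ofReal_one]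
        congr 1
        have h1 : |B.det⁻¹| = √S.det := by
          rw [← Real.sqrt_sq_eq_abs, inv_pow, hdet, inv_inv]
        have h4 : √((2 * Real.pi) ^ p) = √(2 * Real.pi) ^ p := by
          rw [← Real.sqrt_sq (show 0 ≤ √(2 * Real.pi) ^ p by positivity), ← pow_mul, mul_comm p 2,
            pow_mul, Real.sq_sqrt (by positivity)]
        rw [h1, mul_one, hc, Real.sqrt_mul (by positivity), mul_inv, h4]
        have h2 : 0 < √S.det := Real.sqrt_pos.mpr hdetS
        field_simp

end Integrals

/-! ### Measurability of matrix expressions -/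

section MeasurableMatrix

variable {E : Type*} [MeasurableSpace E] {p : ℕ}

theorem measurable_matrix_det {M : E → Matrix (Fin p) (Fin p) ℝ}
    (hM : ∀ i j, Measurable fun x => M x i j) : Measurable fun x => (M x).det := by
  simp_rw [det_apply]
  exact Finset.measurable_fun_sum _ fun σ _ =>
    (Finset.measurable_fun_prod _ fun i _ => hM _ _).const_smul _

/-- By Cramer's rule the inverse is `det⁻¹` times the adjugate. With `0⁻¹ = 0` this formula also
covers singular matrices, so no invertibility is needed. -/
theorem measurable_matrix_inv {M : E → Matrix (Fin p) (Fin p) ℝ}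
    (hM : ∀ i j, Measurable fun x => M x i j) (i j : Fin p) :
    Measurable fun x => (M x)⁻¹ i j := by
  simp_rw [inv_def, Matrix.smul_apply, Ring.inverse_eq_inv', adjugate_apply, smul_eq_mul]
  refine (measurable_matrix_det hM).inv.mul (measurable_matrix_det fun k l => ?_)
  simp_rw [updateRow_apply]
  split_ifs
  · exact measurable_const
  · exact hM k l

theorem measurable_mulVec {q : ℕ} {M : E → Matrix (Fin q) (Fin p) ℝ} {v : E → Fin p → ℝ}
    (hM : ∀ i j, Measurable fun x => M x i j) (hv : ∀ j, Measurable fun x => v x j) (i : Fin q) :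
    Measurable fun x => (M x *ᵥ v x) i := by
  simp_rw [mulVec, dotProduct]
  exact Finset.measurable_fun_sum _ fun j _ => (hM i j).mul (hv j)

theorem measurable_dotProduct {v w : E → Fin p → ℝ}
    (hv : ∀ j, Measurable fun x => v x j) (hw : ∀ j, Measurable fun x => w x j) :
    Measurable fun x => v x ⬝ᵥ w x := by
  simp_rw [dotProduct]
  exact Finset.measurable_fun_sum _ fun j _ => (hv j).mul (hw j)

theorem measurable_multivariateNormalPDFReal {m x : E → Fin p → ℝ}
    {S : E → Matrix (Fin p) (Fin p) ℝ} (hm : ∀ j, Measurable fun e => m e j)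
    (hS : ∀ i j, Measurable fun e => S e i j) (hx : ∀ j, Measurable fun e => x e j) :
    Measurable fun e => multivariateNormalPDFReal (m e) (S e) (x e) := by
  have hd : ∀ j, Measurable fun e => (x e - m e) j := fun j => (hx j).sub (hm j)
  exact ((measurable_matrix_det hS).const_mul _).sqrt.inv.mul
    ((measurable_dotProduct hd (measurable_mulVec (measurable_matrix_inv hS) hd)).neg.div_const
      2).exp

theorem measurable_inverseGammaPDFReal {b x : E → ℝ} (a : ℝ) (hb : Measurable b)
    (hx : Measurable x) : Measurable fun e => inverseGammaPDFReal a (b e) (x e) := by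
  unfold inverseGammaPDFReal
  refine Measurable.ite (measurableSet_lt measurable_const hx) ?_ measurable_const
  exact (((hb.pow_const a).div_const _).mul (hx.pow_const _)).mul (hb.neg.div hx).exp

end MeasurableMatrix

/-! ### Measurability of the conditional densities of the lasso model -/

namespace BayesLasso

variable {n p : ℕ}

theorem measurableSet_paramSet : MeasurableSet (paramSet p) :=
  MeasurableSet.univ.prod measurableSet_Ioi

theorem measurableSet_orthant : MeasurableSet (orthant p) :=
  MeasurableSet.univ_pi fun _ => measurableSet_Ioi

theorem measurable_A_apply (X : Matrix (Fin n) (Fin p) ℝ) (i j : Fin p) :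
    Measurable fun τ : Fin p → ℝ => A X τ i j := by
  simp_rw [A, Dinv, Matrix.add_apply, diagonal_apply]
  refine measurable_const.add ?_
  split_ifs
  · exact (measurable_pi_apply i).inv
  · exact measurable_const

theorem measurable_tauPDF (lam : ℝ) :
    Measurable fun z : (Fin p → ℝ) × ℝ × (Fin p → ℝ) => tauPDF lam z.1 z.2.1 z.2.2 := by
  unfold tauPDF
  exact Finset.measurable_fun_prod _ fun j _ => by fun_prop

theorem measurable_betaPDF (X : Matrix (Fin n) (Fin p) ℝ) (Y : Fin n → ℝ) :
    Measurable fun z : ℝ × (Fin p → ℝ) × (Fin p → ℝ) => betaPDF X Y z.1 z.2.1 z.2.2 := by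
  have hA : ∀ i j, Measurable fun z : ℝ × (Fin p → ℝ) × (Fin p → ℝ) => (A X z.2.1)⁻¹ i j :=
    measurable_matrix_inv fun i j => (measurable_A_apply X i j).comp
      (measurable_fst.comp measurable_snd)
  exact measurable_multivariateNormalPDFReal (measurable_mulVec hA fun j => measurable_const)
    (fun i j => measurable_fst.mul (hA i j)) fun j => by fun_prop

theorem measurable_sigmaPDF (X : Matrix (Fin n) (Fin p) ℝ) (Y : Fin n → ℝ) :
    Measurable fun z : (Fin p → ℝ) × (Fin p → ℝ) × ℝ => sigmaPDF X Y z.1 z.2.1 z.2.2 := by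
  have hβ : ∀ j, Measurable fun z : (Fin p → ℝ) × (Fin p → ℝ) × ℝ => z.1 j :=
    fun j => by fun_prop
  have h1 : ∀ i, Measurable fun z : (Fin p → ℝ) × (Fin p → ℝ) × ℝ =>
      (centered Y - X *ᵥ z.1) i := fun i =>
    measurable_const.sub (measurable_mulVec (M := fun _ => X) (fun i j => measurable_const) hβ i)
  have h2 : ∀ i, Measurable fun z : (Fin p → ℝ) × (Fin p → ℝ) × ℝ =>
      (Dinv z.2.1 *ᵥ z.1) i := fun i => by
    simp_rw [Dinv, mulVec_diagonal]
    fun_prop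
  exact measurable_inverseGammaPDFReal _ (((measurable_dotProduct h1 h1).div_const 2).add
    ((measurable_dotProduct hβ h2).div_const 2)) (by fun_prop)

/-! ### The quadratic form in the exponent of the joint density -/

/-- `‖Ỹ - X β‖² + βᵀ D_τ⁻¹ β`. -/
noncomputable def energy (X : Matrix (Fin n) (Fin p) ℝ) (Y : Fin n → ℝ) (β τ : Fin p → ℝ) : ℝ :=
  (centered Y - X *ᵥ β) ⬝ᵥ (centered Y - X *ᵥ β) + β ⬝ᵥ (Dinv τ *ᵥ β)

/-- The minimum over `β` of the energy. -/
noncomputable def minEnergy (X : Matrix (Fin n) (Fin p) ℝ) (Y : Fin n → ℝ) (τ : Fin p → ℝ) : ℝ :=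
  centered Y ⬝ᵥ ((1 - X * (A X τ)⁻¹ * Xᵀ) *ᵥ centered Y)

theorem measurable_minEnergy (X : Matrix (Fin n) (Fin p) ℝ) (Y : Fin n → ℝ) :
    Measurable (minEnergy X Y) := by
  refine measurable_dotProduct (fun _ => measurable_const) (measurable_mulVec (fun i j => ?_)
    fun _ => measurable_const)
  simp_rw [Matrix.sub_apply, mul_apply]
  exact measurable_const.sub (Finset.measurable_fun_sum _ fun k _ => Measurable.mul
    (Finset.measurable_fun_sum _ fun l _ => measurable_const.mul
      (measurable_matrix_inv (measurable_A_apply X) _ _)) measurable_const)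

theorem measurable_sigmaBlockedPDF (X : Matrix (Fin n) (Fin p) ℝ) (Y : Fin n → ℝ) :
    Measurable fun z : (Fin p → ℝ) × ℝ => sigmaBlockedPDF X Y z.1 z.2 :=
  measurable_inverseGammaPDFReal _
    (((measurable_minEnergy X Y).comp measurable_fst).div_const 2) measurable_snd

/-- The minimizer of the energy. -/
noncomputable def ridge (X : Matrix (Fin n) (Fin p) ℝ) (Y : Fin n → ℝ) (τ : Fin p → ℝ) :
    Fin p → ℝ :=
  (A X τ)⁻¹ *ᵥ (Xᵀ *ᵥ centered Y)

theorem mem_orthant {τ : Fin p → ℝ} : τ ∈ orthant p ↔ ∀ j, 0 < τ j := by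
  simp [orthant]

theorem dotProduct_Dinv_mulVec (β τ : Fin p → ℝ) : β ⬝ᵥ (Dinv τ *ᵥ β) = ∑ j, β j ^ 2 / τ j := by
  simp_rw [Dinv, dotProduct, mulVec_diagonal]
  exact Finset.sum_congr rfl fun j _ => by ring

theorem posDef_A (X : Matrix (Fin n) (Fin p) ℝ) {τ : Fin p → ℝ} (hτ : τ ∈ orthant p) :
    (A X τ).PosDef := by
  have h1 : (Dinv τ).PosDef := PosDef.diagonal fun j => inv_pos.mpr (mem_orthant.mp hτ j)
  have h2 : (Xᵀ * X).PosSemidef := by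
    have := posSemidef_conjTranspose_mul_self X
    rwa [conjTranspose_eq_transpose_of_trivial] at this
  exact PosDef.posSemidef_add h2 h1

theorem isSymm_A (X : Matrix (Fin n) (Fin p) ℝ) (τ : Fin p → ℝ) : (A X τ)ᵀ = A X τ := by
  simp [A, Dinv, transpose_mul]

/-- Completing the square in `β`: the ridge estimator solves `A_τ β = Xᵀ Ỹ`. This separates the
Gaussian law of `β` from the inverse gamma law of `σ²` given `τ` alone. -/
theorem energy_eq (X : Matrix (Fin n) (Fin p) ℝ) (Y : Fin n → ℝ) {τ : Fin p → ℝ}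
    (hτ : τ ∈ orthant p) (β : Fin p → ℝ) :
    energy X Y β τ = minEnergy X Y τ + (β - ridge X Y τ) ⬝ᵥ (A X τ *ᵥ (β - ridge X Y τ)) := by
  have hdet : IsUnit (A X τ).det := (posDef_A X hτ).det_pos.ne'.isUnit
  have hAm : A X τ *ᵥ ridge X Y τ = Xᵀ *ᵥ centered Y := by
    rw [ridge, mulVec_mulVec, mul_nonsing_inv _ hdet, one_mulVec]
  have hsymm : ∀ v w : Fin p → ℝ, v ⬝ᵥ (A X τ *ᵥ w) = (A X τ *ᵥ v) ⬝ᵥ w := fun v w => by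
    rw [dotProduct_mulVec, ← mulVec_transpose, isSymm_A]
  have hX : ∀ v : Fin p → ℝ, v ⬝ᵥ (Xᵀ *ᵥ centered Y) = (X *ᵥ v) ⬝ᵥ centered Y := fun v => by
    rw [dotProduct_mulVec, vecMul_transpose]
  have h1 : (β - ridge X Y τ) ⬝ᵥ (A X τ *ᵥ (β - ridge X Y τ))
      = β ⬝ᵥ (A X τ *ᵥ β) - 2 * ((X *ᵥ β) ⬝ᵥ centered Y)
        + (X *ᵥ ridge X Y τ) ⬝ᵥ centered Y := by
    rw [mulVec_sub, hAm, dotProduct_sub, sub_dotProduct, sub_dotProduct, hX, hX,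
      hsymm (ridge X Y τ), hAm, dotProduct_comm (Xᵀ *ᵥ centered Y), hX]
    ring
  have h2 : β ⬝ᵥ (A X τ *ᵥ β) = (X *ᵥ β) ⬝ᵥ (X *ᵥ β) + β ⬝ᵥ (Dinv τ *ᵥ β) := by
    rw [A, add_mulVec, dotProduct_add, ← mulVec_mulVec, dotProduct_mulVec, vecMul_transpose]
  have h3 : minEnergy X Y τ
      = centered Y ⬝ᵥ centered Y - (X *ᵥ ridge X Y τ) ⬝ᵥ centered Y := by
    rw [minEnergy, sub_mulVec, one_mulVec, dotProduct_sub, ridge, mulVec_mulVec, mulVec_mulVec,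
      dotProduct_comm (_ *ᵥ centered Y)]
  rw [h1, h2, h3, energy, sub_dotProduct, dotProduct_sub, dotProduct_sub,
    dotProduct_comm (centered Y) (X *ᵥ β)]
  ring

theorem centered_ne_zero {Y : Fin n → ℝ} (hY : ∃ i i', Y i ≠ Y i') : centered Y ≠ 0 := by
  obtain ⟨i, i', h⟩ := hY
  intro h0
  have h1 := congrFun h0 i
  have h2 := congrFun h0 i'
  simp only [centered, Pi.zero_apply] at h1 h2
  exact h (by linarith)

/-- At `β = 0` the energy is `‖Ỹ‖²`, nonzero because `Y` is not constant; elsewhere the penalty is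
positive. The inverse gamma scales must be strictly positive. -/
theorem energy_pos (X : Matrix (Fin n) (Fin p) ℝ) {Y : Fin n → ℝ} (hY : ∃ i i', Y i ≠ Y i')
    {τ : Fin p → ℝ} (hτ : τ ∈ orthant p) (β : Fin p → ℝ) : 0 < energy X Y β τ := by
  have h1 : 0 ≤ (centered Y - X *ᵥ β) ⬝ᵥ (centered Y - X *ᵥ β) :=
    Finset.sum_nonneg fun i _ => mul_self_nonneg _
  by_cases hβ : β = 0
  · rw [energy, hβ, mulVec_zero, sub_zero, zero_dotProduct, add_zero]
    have h0 : 0 ≤ centered Y ⬝ᵥ centered Y := Finset.sum_nonneg fun i _ => mul_self_nonneg _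
    exact h0.lt_of_ne fun h => centered_ne_zero hY (dotProduct_self_eq_zero.mp h.symm)
  · obtain ⟨j, hj⟩ := Function.ne_iff.mp hβ
    have hj : β j ≠ 0 := hj
    have h2 : 0 < ∑ j, β j ^ 2 / τ j :=
      Finset.sum_pos' (fun i _ => div_nonneg (sq_nonneg _) (mem_orthant.mp hτ i).le)
        ⟨j, Finset.mem_univ j, div_pos (by positivity) (mem_orthant.mp hτ j)⟩
    rw [energy, dotProduct_Dinv_mulVec]
    linarith

theorem minEnergy_pos (X : Matrix (Fin n) (Fin p) ℝ) {Y : Fin n → ℝ} (hY : ∃ i i', Y i ≠ Y i')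
    {τ : Fin p → ℝ} (hτ : τ ∈ orthant p) : 0 < minEnergy X Y τ := by
  have h := energy_pos X hY hτ (ridge X Y τ)
  rw [energy_eq X Y hτ, sub_self, mulVec_zero, dotProduct_zero, add_zero] at h
  exact h

theorem minEnergy_le_energy (X : Matrix (Fin n) (Fin p) ℝ) (Y : Fin n → ℝ)
    {τ : Fin p → ℝ} (hτ : τ ∈ orthant p) (β : Fin p → ℝ) :
    minEnergy X Y τ ≤ energy X Y β τ := by
  rw [energy_eq X Y hτ β]
  have h := (posDef_A X hτ).posSemidef.dotProduct_mulVec_nonneg (β - ridge X Y τ)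
  rw [star_trivial] at h
  linarith

/-! ### The joint density in closed form and its factorizations -/

/-- `‖Ỹ - X β‖²`. -/
noncomputable def residual (X : Matrix (Fin n) (Fin p) ℝ) (Y : Fin n → ℝ) (β : Fin p → ℝ) : ℝ :=
  (centered Y - X *ᵥ β) ⬝ᵥ (centered Y - X *ᵥ β)

theorem residual_nonneg (X : Matrix (Fin n) (Fin p) ℝ) (Y : Fin n → ℝ) (β : Fin p → ℝ) :
    0 ≤ residual X Y β := by
  rw [residual, dotProduct]
  exact Finset.sum_nonneg fun i _ => mul_self_nonneg _

/-- The factor of the joint density that depends on `τ` only. -/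
noncomputable def tauWeight (lam : ℝ) (τ : Fin p → ℝ) : ℝ :=
  ∏ j, (√(τ j))⁻¹ * Real.exp (-(lam ^ 2 / 2 * τ j))

/-- The joint density of `(β, σ², τ)`, up to a constant. -/
noncomputable def jointReal (lam : ℝ) (X : Matrix (Fin n) (Fin p) ℝ) (Y : Fin n → ℝ)
    (β : Fin p → ℝ) (s : ℝ) (τ : Fin p → ℝ) : ℝ :=
  s ^ (-(((n : ℝ) + p - 1) / 2) - 1) * Real.exp (-energy X Y β τ / (2 * s)) * tauWeight lam τ

/-- The marginal density of `(β, σ²)`, up to a constant. -/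
noncomputable def marginalReal (lam : ℝ) (X : Matrix (Fin n) (Fin p) ℝ) (Y : Fin n → ℝ)
    (β : Fin p → ℝ) (s : ℝ) : ℝ :=
  (√(2 * Real.pi) / lam) ^ p * s ^ (-(((n : ℝ) + p - 1) / 2) - 1) *
    Real.exp (-residual X Y β / (2 * s) - ∑ j, lam * |β j| / √s)

theorem tauWeight_pos (lam : ℝ) {τ : Fin p → ℝ} (hτ : τ ∈ orthant p) : 0 < tauWeight lam τ :=
  Finset.prod_pos fun j _ => mul_pos (inv_pos.mpr (Real.sqrt_pos.mpr (mem_orthant.mp hτ j)))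
    (Real.exp_pos _)

theorem marginalReal_pos {lam : ℝ} (hlam : 0 < lam) (X : Matrix (Fin n) (Fin p) ℝ)
    (Y : Fin n → ℝ) (β : Fin p → ℝ) {s : ℝ} (hs : 0 < s) : 0 < marginalReal lam X Y β s := by
  unfold marginalReal
  positivity

theorem prod_gaussianPDFReal {m : ℕ} (v : Fin m → ℝ) (y μ : Fin m → ℝ) (hv : ∀ i, 0 ≤ v i) :
    ∏ i, gaussianPDFReal (μ i) (v i).toNNReal (y i)
      = (∏ i, (√(2 * Real.pi * v i))⁻¹) * Real.exp (∑ i, -(y i - μ i) ^ 2 / (2 * v i)) := by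
  simp_rw [gaussianPDFReal, Real.coe_toNNReal _ (hv _)]
  rw [Finset.prod_mul_distrib, Real.exp_sum]

/-- The cross terms vanish because `Ỹ` and the columns of `X` sum to zero, so the intercept
decouples from `β`. -/
theorem sum_sub_sq_eq (hn : (n : ℝ) ≠ 0) (X : Matrix (Fin n) (Fin p) ℝ)
    (hX : ∀ j, ∑ i, X i j = 0) (Y : Fin n → ℝ) (β : Fin p → ℝ) (μ : ℝ) :
    ∑ i, (Y i - (μ + (X *ᵥ β) i)) ^ 2
      = n * (μ - (∑ k, Y k) / n) ^ 2 + residual X Y β := by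
  have h0 : ∑ i, (X *ᵥ β) i = 0 := by
    simp_rw [mulVec, dotProduct]
    rw [Finset.sum_comm]
    simp_rw [← Finset.sum_mul, hX]
    simp
  have h1 : ∑ i, centered Y i = 0 := by
    simp only [centered, Finset.sum_sub_distrib, Finset.sum_const, Finset.card_univ,
      Fintype.card_fin, nsmul_eq_mul]
    field_simp
    ring
  have h2 : ∀ i, (Y i - (μ + (X *ᵥ β) i)) ^ 2 = (μ - (∑ k, Y k) / n) ^ 2
      - 2 * (μ - (∑ k, Y k) / n) * (centered Y i - (X *ᵥ β) i)
      + (centered Y - X *ᵥ β) i * (centered Y - X *ᵥ β) i := fun i => by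
    simp only [centered, Pi.sub_apply]
    ring
  simp_rw [h2]
  rw [Finset.sum_add_distrib, Finset.sum_sub_distrib, ← Finset.mul_sum, Finset.sum_sub_distrib,
    h0, h1, residual, dotProduct]
  simp

/-- The Gaussian integral over `μ` contributes `√(2πs/n)`. This gains half a power of `s` and is why
`n - 1` replaces `n` in the exponent. -/
theorem exists_jointDensity_eq (hn : 2 ≤ n) {lam : ℝ} (hlam : 0 < lam)
    (X : Matrix (Fin n) (Fin p) ℝ) (hX : ∀ j, ∑ i, X i j = 0) (Y : Fin n → ℝ) :
    ∃ c : ℝ, 0 < c ∧ ∀ (β : Fin p → ℝ) (s : ℝ) (τ : Fin p → ℝ), 0 < s → τ ∈ orthant p →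
      jointDensity lam X Y β s τ = ENNReal.ofReal (c * jointReal lam X Y β s τ) := by
  have hn0 : (0 : ℝ) < n := by exact_mod_cast (by omega : 0 < n)
  refine ⟨(√(2 * Real.pi))⁻¹ ^ n * √(2 * Real.pi / n) * (√(2 * Real.pi))⁻¹ ^ p *
    (lam ^ 2 / 2) ^ p, by positivity, fun β s τ hs hτ => ?_⟩
  have hτ0 := mem_orthant.mp hτ
  have hsq : 0 < √s := Real.sqrt_pos.mpr hs
  set C : ℝ := (√(2 * Real.pi * s))⁻¹ ^ n * Real.exp (-residual X Y β / (2 * s)) *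
    ((∏ j, (√(2 * Real.pi * (s * τ j)))⁻¹) * Real.exp (∑ j, -(β j) ^ 2 / (2 * (s * τ j)))) *
    (∏ j, lam ^ 2 / 2 * Real.exp (-(lam ^ 2 / 2 * τ j))) * (1 / s) with hC
  have hC0 : 0 ≤ C := by
    have : ∀ j, 0 ≤ (√(2 * Real.pi * (s * τ j)))⁻¹ := fun j => by positivity
    have h2 := Finset.prod_nonneg fun j (_ : j ∈ Finset.univ) => this j
    have h3 : 0 ≤ ∏ j, lam ^ 2 / 2 * Real.exp (-(lam ^ 2 / 2 * τ j)) :=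
      Finset.prod_nonneg fun j _ => by positivity
    positivity
  have h1 : jointDensity lam X Y β s τ = ENNReal.ofReal (C * √(2 * Real.pi * (s / n))) := by
    rw [jointDensity, ENNReal.ofReal_mul hC0, ← lintegral_exp_neg_sq_div (div_pos hs hn0),
      ← lintegral_sub_right_eq_self
        (fun x : ℝ => ENNReal.ofReal (Real.exp (-x ^ 2 / (2 * (s / n))))) ((∑ k, Y k) / n),
      ← lintegral_const_mul' _ _ ENNReal.ofReal_ne_top]
    refine lintegral_congr fun μ => ?_
    rw [← ENNReal.ofReal_mul hC0]
    congr 1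
    have e1 := prod_gaussianPDFReal (fun _ : Fin n => s) Y (fun i => μ + (X *ᵥ β) i)
      fun _ => hs.le
    have e2 := prod_gaussianPDFReal (fun j => s * τ j) β (fun _ => 0)
      fun j => (mul_pos hs (hτ0 j)).le
    have e3 : ∀ j, exponentialPDFReal (lam ^ 2 / 2) (τ j)
        = lam ^ 2 / 2 * Real.exp (-(lam ^ 2 / 2 * τ j)) := fun j => by
      simp [exponentialPDFReal, gammaPDFReal, (hτ0 j).le]
    have e4 : Real.exp (∑ i, -(Y i - (μ + (X *ᵥ β) i)) ^ 2 / (2 * s))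
        = Real.exp (-residual X Y β / (2 * s)) *
          Real.exp (-(μ - (∑ k, Y k) / n) ^ 2 / (2 * (s / n))) := by
      rw [← Finset.sum_div, Finset.sum_neg_distrib, sum_sub_sq_eq hn0.ne' X hX, ← Real.exp_add]
      congr 1
      field_simp
      ring
    rw [e1, e2, e4]
    simp_rw [e3, hC, sub_zero]
    rw [Finset.prod_const, Finset.card_univ, Fintype.card_fin]
    ring
  rw [h1]
  congr 1
  have f1 : Real.exp (-energy X Y β τ / (2 * s)) = Real.exp (-residual X Y β / (2 * s)) *
      Real.exp (∑ j, -(β j) ^ 2 / (2 * (s * τ j))) := by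
    rw [← Real.exp_add, energy, dotProduct_Dinv_mulVec, neg_add, add_div, residual,
      ← Finset.sum_neg_distrib, Finset.sum_div]
    congr 2
    refine Finset.sum_congr rfl fun j _ => ?_
    have := hτ0 j
    field_simp
  have f2 : ∏ j, (√(2 * Real.pi * (s * τ j)))⁻¹
      = (√(2 * Real.pi))⁻¹ ^ p * (√s)⁻¹ ^ p * ∏ j, (√(τ j))⁻¹ := by
    simp_rw [Real.sqrt_mul (show 0 ≤ 2 * Real.pi by positivity), Real.sqrt_mul hs.le, mul_inv]
    rw [Finset.prod_mul_distrib, Finset.prod_mul_distrib]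
    simp [mul_assoc]
  have f3 : s ^ (-(((n : ℝ) + p - 1) / 2) - 1) = (√s)⁻¹ ^ n * √s * (√s)⁻¹ ^ p * (1 / s) := by
    have g1 : (√s)⁻¹ = s ^ (-(1 / 2) : ℝ) := by
      rw [Real.rpow_neg hs.le, Real.sqrt_eq_rpow]
    have g2 : √s = s ^ (1 / 2 : ℝ) := Real.sqrt_eq_rpow s
    rw [g1, g2, ← Real.rpow_mul_natCast hs.le, ← Real.rpow_mul_natCast hs.le, one_div s,
      ← Real.rpow_neg_one, ← Real.rpow_add hs, ← Real.rpow_add hs, ← Real.rpow_add hs]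
    congr 1
    ring
  rw [jointReal, tauWeight, f1, f3, hC, f2, Finset.prod_mul_distrib, Finset.prod_mul_distrib,
    Real.sqrt_mul (show 0 ≤ 2 * Real.pi by positivity) s,
    show 2 * Real.pi * (s / n) = 2 * Real.pi / n * s by ring,
    Real.sqrt_mul (show 0 ≤ 2 * Real.pi / n by positivity) s, mul_inv, mul_pow]
  simp only [Finset.prod_const, Finset.card_univ, Fintype.card_fin]
  ring

theorem tauPDF_eq (lam : ℝ) (β : Fin p → ℝ) (s : ℝ) (τ : Fin p → ℝ) :
    tauPDF lam β s τ = (lam / √(2 * Real.pi)) ^ p *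
      (∏ j, (√(τ j))⁻¹) * Real.exp (∑ j, -(|β j| - lam * √s * τ j) ^ 2 / (2 * s * τ j)) := by
  rw [tauPDF, Finset.prod_mul_distrib, Finset.prod_mul_distrib, ← Real.exp_sum,
    Finset.prod_const, Finset.card_univ, Fintype.card_fin]

/-- Per coordinate, `β²/(2sτ) + λ²τ/2 = (|β| - λ√s τ)²/(2sτ) + λ|β|/√s`. The square belongs to the
law of `τ`, and the remainder is the lasso penalty. -/
theorem jointReal_eq_marginalReal_mul_tauPDF {lam : ℝ} (hlam : 0 < lam)
    (X : Matrix (Fin n) (Fin p) ℝ) (Y : Fin n → ℝ) (β : Fin p → ℝ) {s : ℝ} (hs : 0 < s)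
    {τ : Fin p → ℝ} (hτ : τ ∈ orthant p) :
    jointReal lam X Y β s τ = marginalReal lam X Y β s * tauPDF lam β s τ := by
  have hτ0 := mem_orthant.mp hτ
  have hsq : 0 < √s := Real.sqrt_pos.mpr hs
  have h1 := tauPDF_eq lam β s τ
  have h2 : Real.exp (-energy X Y β τ / (2 * s)) * ∏ j, Real.exp (-(lam ^ 2 / 2 * τ j))
      = Real.exp (-residual X Y β / (2 * s) - ∑ j, lam * |β j| / √s) *
        Real.exp (∑ j, -(|β j| - lam * √s * τ j) ^ 2 / (2 * s * τ j)) := by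
    rw [← Real.exp_sum, ← Real.exp_add, ← Real.exp_add, energy, dotProduct_Dinv_mulVec, neg_add,
      add_div, ← residual, sub_add, ← Finset.sum_sub_distrib, ← Finset.sum_neg_distrib,
      Finset.sum_div, add_assoc, ← Finset.sum_add_distrib, sub_eq_add_neg,
      ← Finset.sum_neg_distrib]
    congr 2
    refine Finset.sum_congr rfl fun j _ => ?_
    have ht := hτ0 j
    have h3 := Real.sq_sqrt hs.le
    have h4 : (|β j| - lam * √s * τ j) ^ 2
        = β j ^ 2 - 2 * |β j| * lam * √s * τ j + lam ^ 2 * s * τ j ^ 2 := by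
      rw [← sq_abs (β j), ← h3]
      ring_nf
      rw [Real.sqrt_sq hsq.le]
    rw [h4, show lam * |β j| / √s = lam * |β j| * √s / s by
      rw [div_eq_div_iff hsq.ne' hs.ne', mul_assoc _ √s √s, Real.mul_self_sqrt hs.le]]
    field_simp
    ring
  rw [jointReal, tauWeight, Finset.prod_mul_distrib, h1, marginalReal]
  calc _ = s ^ (-(((n : ℝ) + p - 1) / 2) - 1) * (∏ j, (√(τ j))⁻¹) *
        (Real.exp (-energy X Y β τ / (2 * s)) * ∏ j, Real.exp (-(lam ^ 2 / 2 * τ j))) := by ring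
    _ = ((√(2 * Real.pi) / lam) ^ p * (lam / √(2 * Real.pi)) ^ p) *
        (s ^ (-(((n : ℝ) + p - 1) / 2) - 1) * (∏ j, (√(τ j))⁻¹) *
        (Real.exp (-residual X Y β / (2 * s) - ∑ j, lam * |β j| / √s) *
        Real.exp (∑ j, -(|β j| - lam * √s * τ j) ^ 2 / (2 * s * τ j)))) := by
        rw [h2, ← mul_pow, div_mul_div_cancel₀ hlam.ne', div_self (by positivity), one_pow,
          one_mul]
    _ = _ := by ring

theorem posDef_smul_inv_A (X : Matrix (Fin n) (Fin p) ℝ) {s : ℝ} (hs : 0 < s) {τ : Fin p → ℝ}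
    (hτ : τ ∈ orthant p) : (s • (A X τ)⁻¹).PosDef :=
  (posDef_A X hτ).inv.smul hs

/-- The normalizing constant of `betaPDF`. -/
noncomputable def betaConst (X : Matrix (Fin n) (Fin p) ℝ) (s : ℝ) (τ : Fin p → ℝ) : ℝ :=
  √((2 * Real.pi) ^ p * (s • (A X τ)⁻¹).det)

/-- The factor `s^(p/2)` isolated here changes the inverse gamma shape from `(n+p-1)/2` to `(n-1)/2`
when `β` is integrated out. -/
theorem betaConst_eq (X : Matrix (Fin n) (Fin p) ℝ) {s : ℝ} (hs : 0 < s) (τ : Fin p → ℝ) :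
    betaConst X s τ = s ^ ((p : ℝ) / 2) * √((2 * Real.pi) ^ p * (A X τ)⁻¹.det) := by
  rw [betaConst, det_smul, Fintype.card_fin, mul_left_comm, Real.sqrt_mul (by positivity),
    Real.sqrt_eq_rpow (s ^ p), ← Real.rpow_natCast, ← Real.rpow_mul hs.le]
  congr 2
  ring

theorem betaConst_pos (X : Matrix (Fin n) (Fin p) ℝ) {s : ℝ} (hs : 0 < s) {τ : Fin p → ℝ}
    (hτ : τ ∈ orthant p) : 0 < betaConst X s τ := by
  have := (posDef_smul_inv_A X hs hτ).det_pos
  unfold betaConst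
  positivity

theorem betaPDF_eq (X : Matrix (Fin n) (Fin p) ℝ) (Y : Fin n → ℝ) {s : ℝ} (hs : 0 < s)
    {τ : Fin p → ℝ} (hτ : τ ∈ orthant p) (β : Fin p → ℝ) :
    betaPDF X Y s τ β = (betaConst X s τ)⁻¹ *
      Real.exp (-(energy X Y β τ - minEnergy X Y τ) / (2 * s)) := by
  have hA := posDef_A X hτ
  have hinv : (s • (A X τ)⁻¹)⁻¹ = s⁻¹ • A X τ := by
    refine inv_eq_left_inv ?_
    rw [smul_mul, Matrix.mul_smul, smul_smul, inv_mul_cancel₀ hs.ne', one_smul,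
      mul_nonsing_inv _ hA.det_pos.ne'.isUnit]
  rw [betaPDF, multivariateNormalPDFReal, hinv, ← ridge, energy_eq X Y hτ, betaConst, smul_mulVec,
    dotProduct_smul, smul_eq_mul]
  congr 2
  field_simp
  ring

theorem betaPDF_nonneg (X : Matrix (Fin n) (Fin p) ℝ) (Y : Fin n → ℝ) (s : ℝ)
    (τ β : Fin p → ℝ) : 0 ≤ betaPDF X Y s τ β := by
  unfold betaPDF multivariateNormalPDFReal
  positivity

theorem tauPDF_nonneg {lam : ℝ} (hlam : 0 < lam) (β : Fin p → ℝ) (s : ℝ) (τ : Fin p → ℝ) :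
    0 ≤ tauPDF lam β s τ :=
  Finset.prod_nonneg fun j _ => by positivity

theorem inverseGammaPDFReal_nonneg {a b : ℝ} (ha : 0 < a) (hb : 0 < b) (x : ℝ) :
    0 ≤ inverseGammaPDFReal a b x := by
  have := Real.Gamma_pos_of_pos ha
  unfold inverseGammaPDFReal
  split_ifs with h <;> positivity

/-- The marginal density of `(σ², τ)`, up to a constant. -/
noncomputable def sigmaTauReal (lam : ℝ) (X : Matrix (Fin n) (Fin p) ℝ) (Y : Fin n → ℝ) (s : ℝ)
    (τ : Fin p → ℝ) : ℝ :=
  s ^ (-(((n : ℝ) + p - 1) / 2) - 1) * Real.exp (-minEnergy X Y τ / (2 * s)) * tauWeight lam τ *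
    betaConst X s τ

theorem sigmaTauReal_nonneg (lam : ℝ) (X : Matrix (Fin n) (Fin p) ℝ) (Y : Fin n → ℝ) {s : ℝ}
    (hs : 0 < s) {τ : Fin p → ℝ} (hτ : τ ∈ orthant p) : 0 ≤ sigmaTauReal lam X Y s τ := by
  have := tauWeight_pos lam hτ
  have := betaConst_pos X hs hτ
  unfold sigmaTauReal
  positivity

theorem jointReal_eq_sigmaTauReal_mul_betaPDF (lam : ℝ)
    (X : Matrix (Fin n) (Fin p) ℝ) (Y : Fin n → ℝ) (β : Fin p → ℝ) {s : ℝ} (hs : 0 < s)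
    {τ : Fin p → ℝ} (hτ : τ ∈ orthant p) :
    jointReal lam X Y β s τ = sigmaTauReal lam X Y s τ * betaPDF X Y s τ β := by
  have hc := (betaConst_pos X hs hτ).ne'
  have h : Real.exp (-energy X Y β τ / (2 * s)) = Real.exp (-minEnergy X Y τ / (2 * s)) *
      Real.exp (-(energy X Y β τ - minEnergy X Y τ) / (2 * s)) := by
    rw [← Real.exp_add]
    congr 1
    ring
  rw [betaPDF_eq X Y hs hτ, jointReal, sigmaTauReal, h]
  field_simp

/-- The marginal density of `(β, τ)`, up to a constant. -/
noncomputable def betaTauReal (lam : ℝ) (X : Matrix (Fin n) (Fin p) ℝ) (Y : Fin n → ℝ)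
    (β τ : Fin p → ℝ) : ℝ :=
  tauWeight lam τ * (Real.Gamma (((n : ℝ) + p - 1) / 2) /
    (energy X Y β τ / 2) ^ (((n : ℝ) + p - 1) / 2))

theorem sigmaPDF_eq (X : Matrix (Fin n) (Fin p) ℝ) (Y : Fin n → ℝ) (β τ : Fin p → ℝ) (s : ℝ) :
    sigmaPDF X Y β τ s
      = inverseGammaPDFReal (((n : ℝ) + p - 1) / 2) (energy X Y β τ / 2) s := by
  rw [sigmaPDF, energy, add_div]

theorem sigmaBlockedPDF_eq (X : Matrix (Fin n) (Fin p) ℝ) (Y : Fin n → ℝ) (τ : Fin p → ℝ)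
    (s : ℝ) : sigmaBlockedPDF X Y τ s
      = inverseGammaPDFReal (((n : ℝ) - 1) / 2) (minEnergy X Y τ / 2) s := rfl

theorem jointReal_eq_betaTauReal_mul_sigmaPDF (hn : 2 ≤ n) (lam : ℝ)
    (X : Matrix (Fin n) (Fin p) ℝ) {Y : Fin n → ℝ} (hY : ∃ i i', Y i ≠ Y i') (β : Fin p → ℝ)
    {s : ℝ} (hs : 0 < s) {τ : Fin p → ℝ} (hτ : τ ∈ orthant p) :
    jointReal lam X Y β s τ = betaTauReal lam X Y β τ * sigmaPDF X Y β τ s := by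
  have hn' : (2 : ℝ) ≤ n := by exact_mod_cast hn
  have hp' : (0 : ℝ) ≤ p := p.cast_nonneg
  have hΓ := (Real.Gamma_pos_of_pos (show 0 < ((n : ℝ) + p - 1) / 2 by linarith)).ne'
  have hE := energy_pos X hY hτ β
  have hEp : (energy X Y β τ / 2) ^ (((n : ℝ) + p - 1) / 2) ≠ 0 := by positivity
  rw [sigmaPDF_eq, inverseGammaPDFReal, if_pos hs, betaTauReal, jointReal,
    show -energy X Y β τ / (2 * s) = -(energy X Y β τ / 2) / s by field_simp]
  field_simp

theorem betaTauReal_nonneg (hn : 2 ≤ n) (lam : ℝ) (X : Matrix (Fin n) (Fin p) ℝ)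
    {Y : Fin n → ℝ} (hY : ∃ i i', Y i ≠ Y i') (β : Fin p → ℝ) {τ : Fin p → ℝ}
    (hτ : τ ∈ orthant p) : 0 ≤ betaTauReal lam X Y β τ := by
  have hn' : (2 : ℝ) ≤ n := by exact_mod_cast hn
  have hp' : (0 : ℝ) ≤ p := p.cast_nonneg
  have hΓ := (Real.Gamma_pos_of_pos (show 0 < ((n : ℝ) + p - 1) / 2 by linarith))
  have hE := energy_pos X hY hτ β
  have := tauWeight_pos lam hτ
  unfold betaTauReal
  positivity

/-- The marginal density of `τ`, up to a constant. -/
noncomputable def tauReal (lam : ℝ) (X : Matrix (Fin n) (Fin p) ℝ) (Y : Fin n → ℝ)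
    (τ : Fin p → ℝ) : ℝ :=
  tauWeight lam τ * √((2 * Real.pi) ^ p * (A X τ)⁻¹.det) * (Real.Gamma (((n : ℝ) - 1) / 2) /
    (minEnergy X Y τ / 2) ^ (((n : ℝ) - 1) / 2))

theorem sigmaTauReal_eq_tauReal_mul_sigmaBlockedPDF (hn : 2 ≤ n) (lam : ℝ)
    (X : Matrix (Fin n) (Fin p) ℝ) {Y : Fin n → ℝ} (hY : ∃ i i', Y i ≠ Y i')
    {s : ℝ} (hs : 0 < s) {τ : Fin p → ℝ} (hτ : τ ∈ orthant p) :
    sigmaTauReal lam X Y s τ = tauReal lam X Y τ * sigmaBlockedPDF X Y τ s := by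
  have hn' : (2 : ℝ) ≤ n := by exact_mod_cast hn
  have hΓ := (Real.Gamma_pos_of_pos (show 0 < ((n : ℝ) - 1) / 2 by linarith)).ne'
  have hE := minEnergy_pos X hY hτ
  have hEp : (minEnergy X Y τ / 2) ^ (((n : ℝ) - 1) / 2) ≠ 0 := by positivity
  have hpow : s ^ (-(((n : ℝ) + p - 1) / 2) - 1) * s ^ ((p : ℝ) / 2)
      = s ^ (-(((n : ℝ) - 1) / 2) - 1) := by
    rw [← Real.rpow_add hs]
    congr 1
    ring
  rw [sigmaBlockedPDF_eq, inverseGammaPDFReal, if_pos hs, tauReal, sigmaTauReal,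
    betaConst_eq X hs, show -minEnergy X Y τ / (2 * s) = -(minEnergy X Y τ / 2) / s by field_simp,
    ← hpow]
  field_simp

theorem tauReal_nonneg (hn : 2 ≤ n) (lam : ℝ) (X : Matrix (Fin n) (Fin p) ℝ)
    {Y : Fin n → ℝ} (hY : ∃ i i', Y i ≠ Y i') {τ : Fin p → ℝ}
    (hτ : τ ∈ orthant p) : 0 ≤ tauReal lam X Y τ := by
  have hn' : (2 : ℝ) ≤ n := by exact_mod_cast hn
  have hΓ := (Real.Gamma_pos_of_pos (show 0 < ((n : ℝ) - 1) / 2 by linarith))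
  have hE := minEnergy_pos X hY hτ
  have := tauWeight_pos lam hτ
  unfold tauReal
  positivity

/-! ### Normalization of the conditional densities -/

theorem volume_restrict_orthant :
    (volume : Measure (Fin p → ℝ)).restrict (orthant p)
      = Measure.pi fun _ => (volume : Measure ℝ).restrict (Set.Ioi 0) := by
  rw [volume_pi, orthant, Measure.restrict_pi_pi]

theorem volume_restrict_paramSet :
    (volume : Measure ((Fin p → ℝ) × ℝ)).restrict (paramSet p)
      = (volume : Measure (Fin p → ℝ)).prod ((volume : Measure ℝ).restrict (Set.Ioi 0)) := by
  rw [paramSet, Measure.volume_eq_prod, ← Measure.prod_restrict, Measure.restrict_univ]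

/-- Dividing numerator and denominator of the exponent by `s` leaves, in each coordinate, a
reciprocal inverse Gaussian density with `a = |β_j|/√s` and `b = λ`. -/
theorem lintegral_tauPDF {lam : ℝ} (hlam : 0 < lam) (β : Fin p → ℝ) {s : ℝ} (hs : 0 < s) :
    ∫⁻ τ in orthant p, ENNReal.ofReal (tauPDF lam β s τ) = 1 := by
  have hsq : 0 < √s := Real.sqrt_pos.mpr hs
  have h1 : ∀ τ ∈ orthant p, ENNReal.ofReal (tauPDF lam β s τ)
      = ∏ j, ENNReal.ofReal (lam / √(2 * Real.pi) * (√(τ j))⁻¹ *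
        Real.exp (-(|β j| / √s - lam * τ j) ^ 2 / (2 * τ j))) := fun τ hτ => by
    rw [← ENNReal.ofReal_prod_of_nonneg fun j _ => by positivity, tauPDF]
    congr 1
    refine Finset.prod_congr rfl fun j _ => ?_
    have ht := mem_orthant.mp hτ j
    congr 2
    rw [show |β j| / √s - lam * τ j = (|β j| - lam * √s * τ j) / √s by field_simp, div_pow,
      Real.sq_sqrt hs.le]
    field_simp
  rw [setLIntegral_congr_fun measurableSet_orthant h1, volume_restrict_orthant,
    lintegral_fin_prod_eq_prod (f := fun j t => ENNReal.ofReal (lam / √(2 * Real.pi) * (√t)⁻¹ *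
        Real.exp (-(|β j| / √s - lam * t) ^ 2 / (2 * t)))) _ fun j => by fun_prop]
  exact Finset.prod_eq_one fun j _ => lintegral_reciprocalInverseGaussian (by positivity) hlam

theorem lintegral_betaPDF (X : Matrix (Fin n) (Fin p) ℝ) (Y : Fin n → ℝ) {s : ℝ} (hs : 0 < s)
    {τ : Fin p → ℝ} (hτ : τ ∈ orthant p) : ∫⁻ β, ENNReal.ofReal (betaPDF X Y s τ β) = 1 :=
  lintegral_multivariateNormalPDFReal _ (posDef_smul_inv_A X hs hτ)

theorem lintegral_sigmaPDF (hn : 2 ≤ n) (X : Matrix (Fin n) (Fin p) ℝ) {Y : Fin n → ℝ}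
    (hY : ∃ i i', Y i ≠ Y i') (β : Fin p → ℝ) {τ : Fin p → ℝ} (hτ : τ ∈ orthant p) :
    ∫⁻ s in Set.Ioi 0, ENNReal.ofReal (sigmaPDF X Y β τ s) = 1 := by
  have hn' : (2 : ℝ) ≤ n := by exact_mod_cast hn
  have hp' : (0 : ℝ) ≤ p := p.cast_nonneg
  simp_rw [sigmaPDF_eq]
  exact lintegral_inverseGammaPDFReal (by linarith) (half_pos (energy_pos X hY hτ β))

theorem lintegral_sigmaBlockedPDF (hn : 2 ≤ n) (X : Matrix (Fin n) (Fin p) ℝ) {Y : Fin n → ℝ}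
    (hY : ∃ i i', Y i ≠ Y i') {τ : Fin p → ℝ} (hτ : τ ∈ orthant p) :
    ∫⁻ s in Set.Ioi 0, ENNReal.ofReal (sigmaBlockedPDF X Y τ s) = 1 := by
  have hn' : (2 : ℝ) ≤ n := by exact_mod_cast hn
  exact lintegral_inverseGammaPDFReal (by linarith) (half_pos (minEnergy_pos X hY hτ))

end BayesLasso

/-! ### Invariance under a three-step Gibbs sweep -/

section ThreeStep

variable {U S F : Type*} [MeasurableSpace U] [MeasurableSpace S] [MeasurableSpace F]
  {μU : Measure U} {μS : Measure S} {ν : Measure F} [SFinite μU] [SFinite μS] [SFinite ν]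
  {a : U → S → F → ℝ≥0∞} {b : S → F → U → ℝ≥0∞} {c : U → F → S → ℝ≥0∞}

/-- One step of the three-step Gibbs sampler, as an iterated integral. -/
theorem lintegral_threeStep (ha : Measurable fun z : U × S × F => a z.1 z.2.1 z.2.2)
    (hb : Measurable fun z : S × F × U => b z.1 z.2.1 z.2.2)
    (hc : Measurable fun z : U × F × S => c z.1 z.2.1 z.2.2)
    {f : U × S → ℝ≥0∞} (hf : Measurable f) (x : U × S) :
    ∫⁻ y, (∫⁻ τ, c y.1 τ y.2 * b x.2 τ y.1 * a x.1 x.2 τ ∂ν) * f y ∂μU.prod μS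
      = ∫⁻ τ, a x.1 x.2 τ * ∫⁻ β, b x.2 τ β * ∫⁻ s, c β τ s * f (β, s) ∂μS ∂μU ∂ν := by
  have ha' : Measurable fun z : (U × S) × F => a x.1 x.2 z.2 :=
    ha.comp (by fun_prop : Measurable fun z : (U × S) × F => (x.1, x.2, z.2))
  have hb' : Measurable fun z : (U × S) × F => b x.2 z.2 z.1.1 :=
    hb.comp (by fun_prop : Measurable fun z : (U × S) × F => (x.2, z.2, z.1.1))
  have hc' : Measurable fun z : (U × S) × F => c z.1.1 z.2 z.1.2 :=
    hc.comp (by fun_prop : Measurable fun z : (U × S) × F => (z.1.1, z.2, z.1.2))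
  have hm : Measurable fun z : (U × S) × F =>
      c z.1.1 z.2 z.1.2 * b x.2 z.2 z.1.1 * a x.1 x.2 z.2 := (hc'.mul hb').mul ha'
  calc ∫⁻ y, (∫⁻ τ, c y.1 τ y.2 * b x.2 τ y.1 * a x.1 x.2 τ ∂ν) * f y ∂μU.prod μS
      = ∫⁻ y, ∫⁻ τ, c y.1 τ y.2 * b x.2 τ y.1 * a x.1 x.2 τ * f y ∂ν ∂μU.prod μS := by
        refine lintegral_congr fun y => (lintegral_mul_const _ ?_).symm
        exact hm.comp measurable_prodMk_left
    _ = ∫⁻ τ, ∫⁻ y, c y.1 τ y.2 * b x.2 τ y.1 * a x.1 x.2 τ * f y ∂μU.prod μS ∂ν :=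
        lintegral_lintegral_swap (hm.mul (hf.comp measurable_fst)).aemeasurable
    _ = ∫⁻ τ, a x.1 x.2 τ * ∫⁻ β, b x.2 τ β * ∫⁻ s, c β τ s * f (β, s) ∂μS ∂μU ∂ν := by
        refine lintegral_congr fun τ => ?_
        have hcτ : Measurable fun y : U × S => c y.1 τ y.2 * f y :=
          (hc'.comp (measurable_prodMk_right (y := τ))).mul hf
        have hbτ : Measurable fun β => b x.2 τ β :=
          hb.comp (by fun_prop : Measurable fun β : U => (x.2, τ, β))
        rw [lintegral_prod (fun y : U × S => c y.1 τ y.2 * b x.2 τ y.1 * a x.1 x.2 τ * f y)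
            ((hm.comp (measurable_prodMk_right (y := τ))).mul hf).aemeasurable,
          ← lintegral_const_mul (f := fun β => b x.2 τ β * ∫⁻ s, c β τ s * f (β, s) ∂μS) _
            (hbτ.mul hcτ.lintegral_prod_right')]
        refine lintegral_congr fun β => ?_
        have hcs : Measurable fun s => c β τ s * f (β, s) := hcτ.comp measurable_prodMk_left
        rw [← lintegral_const_mul _ hcs, ← lintegral_const_mul _ (hcs.const_mul _)]
        refine lintegral_congr fun s => ?_
        ring

theorem lintegral_threeStep_le_one (ha : Measurable fun z : U × S × F => a z.1 z.2.1 z.2.2)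
    (hb : Measurable fun z : S × F × U => b z.1 z.2.1 z.2.2)
    (hc : Measurable fun z : U × F × S => c z.1 z.2.1 z.2.2)
    {D : Set F} (hD : ∀ᵐ τ ∂ν, τ ∈ D) {x : U × S}
    (ha1 : ∫⁻ τ, a x.1 x.2 τ ∂ν = 1) (hb1 : ∀ τ ∈ D, ∫⁻ β, b x.2 τ β ∂μU = 1)
    (hc1 : ∀ τ ∈ D, ∀ β, ∫⁻ s, c β τ s ∂μS = 1) :
    ∫⁻ y, ∫⁻ τ, c y.1 τ y.2 * b x.2 τ y.1 * a x.1 x.2 τ ∂ν ∂μU.prod μS ≤ 1 := by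
  have h := lintegral_threeStep (μU := μU) (μS := μS) (ν := ν) ha hb hc (f := fun _ => 1)
    measurable_const x
  simp only [mul_one] at h
  rw [h, ← ha1]
  refine lintegral_mono_ae ?_
  filter_upwards [hD] with τ hτ
  simp_rw [hc1 τ hτ, mul_one, hb1 τ hτ, mul_one]
  exact le_rfl

/-- The three-step Gibbs sampler leaves the `(β, σ²)` marginal of the joint density invariant. -/
theorem lintegral_threeStep_invariant (ha : Measurable fun z : U × S × F => a z.1 z.2.1 z.2.2)
    (hb : Measurable fun z : S × F × U => b z.1 z.2.1 z.2.2)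
    (hc : Measurable fun z : U × F × S => c z.1 z.2.1 z.2.2)
    {G : U × S → ℝ≥0∞} (hG : Measurable G)
    {P : Set S} {D : Set F} (hP : ∀ᵐ s ∂μS, s ∈ P) (hD : ∀ᵐ τ ∂ν, τ ∈ D)
    (ha1 : ∀ s ∈ P, ∀ β, ∫⁻ τ, a β s τ ∂ν = 1)
    (hb1 : ∀ s ∈ P, ∀ τ ∈ D, ∫⁻ β, b s τ β ∂μU = 1)
    (hc1 : ∀ τ ∈ D, ∀ β, ∫⁻ s, c β τ s ∂μS = 1)
    (hGb : ∀ s ∈ P, ∀ τ ∈ D, ∃ m, ∀ β, G (β, s) * a β s τ = m * b s τ β)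
    (hGc : ∀ τ ∈ D, ∀ β, ∃ m, ∀ s ∈ P, G (β, s) * a β s τ = m * c β τ s)
    {f : U × S → ℝ≥0∞} (hf : Measurable f) :
    ∫⁻ x, ∫⁻ y, (∫⁻ τ, c y.1 τ y.2 * b x.2 τ y.1 * a x.1 x.2 τ ∂ν) * f y ∂μU.prod μS
        ∂(μU.prod μS).withDensity G
      = ∫⁻ y, f y ∂(μU.prod μS).withDensity G := by
  set g : U → F → ℝ≥0∞ := fun β τ => ∫⁻ s, c β τ s * f (β, s) ∂μS with hg
  set H : S → F → ℝ≥0∞ := fun s τ => ∫⁻ β, b s τ β * g β τ ∂μU with hH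
  have hgm : Measurable fun z : U × F => g z.1 z.2 := by
    have : Measurable fun z : (U × F) × S => c z.1.1 z.1.2 z.2 * f (z.1.1, z.2) :=
      (hc.comp (by fun_prop : Measurable fun z : (U × F) × S => (z.1.1, z.1.2, z.2))).mul
        (hf.comp (by fun_prop))
    exact this.lintegral_prod_right'
  have hHm : Measurable fun z : S × F => H z.1 z.2 := by
    have : Measurable fun z : (S × F) × U => b z.1.1 z.1.2 z.2 * g z.2 z.1.2 :=
      (hb.comp (by fun_prop : Measurable fun z : (S × F) × U => (z.1.1, z.1.2, z.2))).mul
        (hgm.comp (by fun_prop : Measurable fun z : (S × F) × U => (z.2, z.1.2)))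
    exact this.lintegral_prod_right'
  have hJ : Measurable fun z : U × S × F => G (z.1, z.2.1) * a z.1 z.2.1 z.2.2 :=
    (hG.comp (by fun_prop)).mul ha
  have hKm : Measurable fun x : U × S => ∫⁻ τ, a x.1 x.2 τ * H x.2 τ ∂ν := by
    have : Measurable fun z : (U × S) × F => a z.1.1 z.1.2 z.2 * H z.1.2 z.2 :=
      (ha.comp (by fun_prop : Measurable fun z : (U × S) × F => (z.1.1, z.1.2, z.2))).mul
        (hHm.comp (by fun_prop : Measurable fun z : (U × S) × F => (z.1.2, z.2)))
    exact this.lintegral_prod_right'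
  simp_rw [lintegral_threeStep ha hb hc hf]
  rw [lintegral_withDensity_mul hG hKm, lintegral_withDensity_mul hG hf,
    lintegral_prod_symm (fun x => G x * ∫⁻ τ, a x.1 x.2 τ * H x.2 τ ∂ν)
      (hG.mul hKm).aemeasurable]
  calc ∫⁻ s, ∫⁻ β, G (β, s) * ∫⁻ τ, a β s τ * H s τ ∂ν ∂μU ∂μS
      = ∫⁻ s, ∫⁻ τ, ∫⁻ β, G (β, s) * a β s τ * H s τ ∂μU ∂ν ∂μS := by
        refine lintegral_congr fun s => ?_
        rw [← lintegral_lintegral_swap]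
        · refine lintegral_congr fun β => ?_
          exact lintegral_const_mul_mul _
            (ha.comp (by fun_prop : Measurable fun τ : F => (β, s, τ)))
            (hHm.comp (by fun_prop : Measurable fun τ : F => (s, τ)))
        · exact ((hJ.comp (by fun_prop : Measurable fun z : U × F => (z.1, s, z.2))).mul
            (hHm.comp (by fun_prop : Measurable fun z : U × F => (s, z.2)))).aemeasurable
    -- Redrawing `β`: for fixed `(s, τ)` the joint density is `m · b`, and `H` does not depend on
    -- `β`, so averaging `g` against `b` is averaging it against the joint density.
    _ = ∫⁻ s, ∫⁻ τ, ∫⁻ β, G (β, s) * a β s τ * g β τ ∂μU ∂ν ∂μS := by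
        refine lintegral_congr_ae ?_
        filter_upwards [hP] with s hs
        refine lintegral_congr_ae ?_
        filter_upwards [hD] with τ hτ
        obtain ⟨m, hm⟩ := hGb s hs τ hτ
        have hbm : Measurable fun β => b s τ β :=
          hb.comp (by fun_prop : Measurable fun β : U => (s, τ, β))
        have hgm' : Measurable fun β => g β τ := hgm.comp measurable_prodMk_right
        simp_rw [hm]
        rw [lintegral_mul_const _ (hbm.const_mul m), lintegral_const_mul _ hbm, hb1 s hs τ hτ,
          mul_one, hH, lintegral_const_mul_mul _ hbm hgm']
    _ = ∫⁻ β, ∫⁻ τ, ∫⁻ s, G (β, s) * a β s τ * g β τ ∂μS ∂ν ∂μU := by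
        have hm : Measurable fun z : S × F × U => G (z.2.2, z.1) * a z.2.2 z.1 z.2.1 *
            g z.2.2 z.2.1 :=
          (hJ.comp (by fun_prop : Measurable fun z : S × F × U => (z.2.2, z.1, z.2.1))).mul
            (hgm.comp (by fun_prop : Measurable fun z : S × F × U => (z.2.2, z.2.1)))
        calc _ = ∫⁻ s, ∫⁻ β, ∫⁻ τ, G (β, s) * a β s τ * g β τ ∂ν ∂μU ∂μS := by
              refine lintegral_congr fun s => lintegral_lintegral_swap ?_
              exact (hm.comp (by fun_prop : Measurable fun z : F × U =>
                (s, z.1, z.2))).aemeasurable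
          _ = ∫⁻ β, ∫⁻ s, ∫⁻ τ, G (β, s) * a β s τ * g β τ ∂ν ∂μS ∂μU := by
              refine lintegral_lintegral_swap (Measurable.aemeasurable ?_)
              have : Measurable fun z : (S × U) × F => G (z.1.2, z.1.1) * a z.1.2 z.1.1 z.2 *
                  g z.1.2 z.2 :=
                hm.comp (by fun_prop : Measurable fun z : (S × U) × F => (z.1.1, z.2, z.1.2))
              exact this.lintegral_prod_right'
          _ = _ := by
              refine lintegral_congr fun β => lintegral_lintegral_swap ?_
              exact (hm.comp (by fun_prop : Measurable fun z : S × F =>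
                (z.1, z.2, β))).aemeasurable
    -- The same argument redraws `s`, with `(β, τ)` fixed and `c` in the role of `b`.
    _ = ∫⁻ β, ∫⁻ τ, ∫⁻ s, G (β, s) * a β s τ * f (β, s) ∂μS ∂ν ∂μU := by
        refine lintegral_congr fun β => lintegral_congr_ae ?_
        filter_upwards [hD] with τ hτ
        obtain ⟨m, hm⟩ := hGc τ hτ β
        have hcm : Measurable fun s => c β τ s :=
          hc.comp (by fun_prop : Measurable fun s : S => (β, τ, s))
        have hfm : Measurable fun s => f (β, s) := hf.comp measurable_prodMk_left
        have hJm : Measurable fun s => G (β, s) * a β s τ :=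
          hJ.comp (by fun_prop : Measurable fun s : S => (β, s, τ))
        have e1 : ∫⁻ s, G (β, s) * a β s τ ∂μS = m := by
          rw [← mul_one m, ← hc1 τ hτ β, ← lintegral_const_mul _ hcm]
          exact lintegral_congr_ae (hP.mono fun s hs => hm s hs)
        rw [lintegral_mul_const _ hJm, e1, hg, lintegral_const_mul_mul _ hcm hfm]
        refine lintegral_congr_ae (hP.mono fun s hs => ?_)
        simp only
        rw [hm s hs]
    _ = ∫⁻ y, G y * f y ∂μU.prod μS := by
        rw [lintegral_prod (fun y => G y * f y) (hG.mul hf).aemeasurable]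
        refine lintegral_congr fun β => ?_
        rw [← lintegral_lintegral_swap]
        · refine lintegral_congr_ae (hP.mono fun s hs => ?_)
          have ham : Measurable fun τ => a β s τ :=
            ha.comp (by fun_prop : Measurable fun τ : F => (β, s, τ))
          simp only
          rw [lintegral_mul_const _ (ham.const_mul _), lintegral_const_mul _ ham, ha1 s hs β,
            mul_one]
        · exact ((hJ.comp (by fun_prop : Measurable fun z : S × F => (β, z.1, z.2))).mul
            (hf.comp (by fun_prop : Measurable fun z : S × F => (β, z.1)))).aemeasurable

end ThreeStep

namespace BayesLasso

variable {n p : ℕ}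

/-! ### Properness of the posterior -/

theorem abs_mulVec_le (X : Matrix (Fin n) (Fin p) ℝ) (β : Fin p → ℝ) (i : Fin n) :
    |(X *ᵥ β) i| ≤ (∑ j, |X i j|) * ∑ j, |β j| := by
  rw [mulVec, dotProduct, Finset.sum_mul]
  refine (Finset.abs_sum_le_sum_abs _ _).trans (Finset.sum_le_sum fun j _ => ?_)
  rw [abs_mul]
  exact mul_le_mul_of_nonneg_left
    (Finset.single_le_sum (fun k _ => abs_nonneg (β k)) (Finset.mem_univ j)) (abs_nonneg _)

/-- At a coordinate with `Ỹ_i ≠ 0`, either the residual or `‖β‖₁` must be of the order of `|Ỹ_i|`.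
Half of the `ℓ¹` penalty is spent on this, and the other half remains for integrating over `β`. -/
theorem exists_residual_bound {lam : ℝ} (hlam : 0 < lam) (X : Matrix (Fin n) (Fin p) ℝ)
    {Y : Fin n → ℝ} (hY : ∃ i i', Y i ≠ Y i') :
    ∃ κ K : ℝ, 0 < κ ∧ ∀ (β : Fin p → ℝ) (s : ℝ), 0 < s →
      -residual X Y β / (2 * s) - ∑ j, lam * |β j| / √s
        ≤ K + -κ / √s + ∑ j, -(lam / 2 / √s * |β j|) := by
  obtain ⟨i, hi⟩ := Function.ne_iff.mp (centered_ne_zero hY)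
  have hi : centered Y i ≠ 0 := hi
  set M := ∑ j, |X i j| with hM
  have hM0 : 0 ≤ M := Finset.sum_nonneg fun j _ => abs_nonneg _
  -- Chosen so that `δ M ≤ λ/2`; the `+ 1` keeps the denominator nonzero when the row of `X`
  -- vanishes.
  set δ := lam / (2 * (M + 1)) with hδ
  have hδ0 : 0 < δ := by positivity
  have hδM : δ * M ≤ lam / 2 := by
    rw [hδ, div_mul_eq_mul_div, div_le_div_iff₀ (by positivity) (by norm_num)]
    nlinarith
  refine ⟨δ * |centered Y i|, δ ^ 2 / 2, by positivity, fun β s hs => ?_⟩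
  have hsq : 0 < √s := Real.sqrt_pos.mpr hs
  set r := |centered Y i - (X *ᵥ β) i| with hr
  set B := ∑ j, |β j| with hB
  have hB0 : 0 ≤ B := Finset.sum_nonneg fun j _ => abs_nonneg _
  have h1 : r ^ 2 ≤ residual X Y β := by
    rw [residual, dotProduct, hr, sq_abs, sq]
    exact Finset.single_le_sum (f := fun i => (centered Y - X *ᵥ β) i * (centered Y - X *ᵥ β) i)
      (fun i _ => mul_self_nonneg _) (Finset.mem_univ i)
  have h2 : |centered Y i| ≤ r + M * B := by
    have := abs_mulVec_le X β i
    have h3 := abs_add_le (centered Y i - (X *ᵥ β) i) ((X *ᵥ β) i)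
    rw [sub_add_cancel] at h3
    linarith
  -- The inequality `x²/2 ≥ δx - δ²/2` at `x = r/√s` makes the quadratic term linear, comparable
  -- with the penalty.
  have h3 : δ * (r / √s) - δ ^ 2 / 2 ≤ residual X Y β / (2 * s) := by
    have h4 : r ^ 2 / (2 * s) ≤ residual X Y β / (2 * s) := by gcongr
    have h5 : r ^ 2 / (2 * s) = (r / √s) ^ 2 / 2 := by
      rw [div_pow, Real.sq_sqrt hs.le]; field_simp
    nlinarith [sq_nonneg (r / √s - δ)]
  have h4 : ∑ j, lam * |β j| / √s = lam * B / √s := by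
    rw [hB, Finset.mul_sum, Finset.sum_div]
  have h5 : ∑ j, -(lam / 2 / √s * |β j|) = -(lam / 2 / √s * B) := by
    rw [hB, Finset.mul_sum, Finset.sum_neg_distrib]
  have h6 : δ * |centered Y i| / √s ≤ δ * (r / √s) + lam / 2 * B / √s := by
    rw [← mul_div_assoc, ← add_div]
    gcongr
    nlinarith [mul_le_mul_of_nonneg_right hδM hB0, mul_le_mul_of_nonneg_left h2 hδ0.le]
  have h7 : lam / 2 / √s * B = lam / 2 * B / √s := by ring
  have h8 : lam * B / √s = 2 * (lam / 2 * B / √s) := by ring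
  rw [h4, h5, neg_div, neg_div, h7, h8]
  linarith

theorem measurable_marginalReal (lam : ℝ) (X : Matrix (Fin n) (Fin p) ℝ) (Y : Fin n → ℝ) :
    Measurable fun x : (Fin p → ℝ) × ℝ => marginalReal lam X Y x.1 x.2 := by
  have h1 : ∀ i, Measurable fun z : (Fin p → ℝ) × ℝ => (centered Y - X *ᵥ z.1) i := fun i =>
    measurable_const.sub (measurable_mulVec (M := fun _ => X) (fun i j => measurable_const)
      (fun j => by fun_prop) i)
  have h2 := measurable_dotProduct h1 h1
  unfold marginalReal residual
  refine (measurable_const.mul (by fun_prop)).mul (Measurable.exp (Measurable.sub ?_ ?_))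
  · exact h2.neg.div (by fun_prop)
  · exact Finset.measurable_fun_sum _ fun j _ => by fun_prop

theorem sqrt_pow_eq_rpow {s : ℝ} (hs : 0 < s) (p : ℕ) : √s ^ p = s ^ ((p : ℝ) / 2) := by
  rw [Real.sqrt_eq_rpow, ← Real.rpow_natCast, ← Real.rpow_mul hs.le]
  ring_nf

/-- Each `β_j`-integral contributes `4√s/λ`. The resulting power of `s` is integrable at infinity
because `n ≥ 2`, and the factor `exp(-κ/√s)` handles `s → 0`. -/
theorem lintegral_marginalReal_lt_top (hn : 2 ≤ n) {lam : ℝ} (hlam : 0 < lam)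
    (X : Matrix (Fin n) (Fin p) ℝ) {Y : Fin n → ℝ} (hY : ∃ i i', Y i ≠ Y i') :
    ∫⁻ x in paramSet p, ENNReal.ofReal (marginalReal lam X Y x.1 x.2) < ∞ := by
  have hn' : (2 : ℝ) ≤ n := by exact_mod_cast hn
  obtain ⟨κ, K, hκ, hK⟩ := exists_residual_bound hlam X hY
  set c := (√(2 * Real.pi) / lam) ^ p * Real.exp K with hc
  have hc0 : 0 ≤ c := by positivity
  rw [volume_restrict_paramSet, lintegral_prod_symm _
    (measurable_marginalReal lam X Y).ennreal_ofReal.aemeasurable]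
  calc ∫⁻ s in Set.Ioi 0, ∫⁻ β, ENNReal.ofReal (marginalReal lam X Y β s)
      ≤ ∫⁻ s in Set.Ioi 0, ENNReal.ofReal (c * (4 / lam) ^ p) *
          ENNReal.ofReal (s ^ (-(((n : ℝ) - 1) / 2) - 1) * Real.exp (-κ / √s)) := by
        refine setLIntegral_mono' measurableSet_Ioi fun s hs => ?_
        have hs : 0 < s := hs
        have hsq : 0 < √s := Real.sqrt_pos.mpr hs
        set d := c * s ^ (-(((n : ℝ) + p - 1) / 2) - 1) * Real.exp (-κ / √s) with hd
        have hd0 : 0 ≤ d := by positivity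
        calc ∫⁻ β, ENNReal.ofReal (marginalReal lam X Y β s)
            ≤ ∫⁻ β : Fin p → ℝ, ENNReal.ofReal d *
                ∏ j, ENNReal.ofReal (Real.exp (-(lam / 2 / √s * |β j|))) := by
              refine lintegral_mono fun β => ?_
              rw [← ENNReal.ofReal_prod_of_nonneg fun j _ => (Real.exp_pos _).le,
                ← Real.exp_sum, ← ENNReal.ofReal_mul hd0]
              refine ENNReal.ofReal_le_ofReal ?_
              have h := Real.exp_le_exp.mpr (hK β s hs)
              rw [Real.exp_add, Real.exp_add] at h
              rw [marginalReal, hd, hc]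
              calc _ ≤ (√(2 * Real.pi) / lam) ^ p * s ^ (-(((n : ℝ) + p - 1) / 2) - 1) *
                    (Real.exp K * Real.exp (-κ / √s) *
                      Real.exp (∑ j, -(lam / 2 / √s * |β j|))) := by gcongr
                _ = _ := by ring
          _ = ENNReal.ofReal (d * (2 / (lam / 2 / √s)) ^ p) := by
              rw [lintegral_const_mul' _ _ ENNReal.ofReal_ne_top, volume_pi,
                lintegral_fin_prod_eq_prod (f := fun _ t =>
                  ENNReal.ofReal (Real.exp (-(lam / 2 / √s * |t|)))) _ fun j => by fun_prop]
              simp_rw [lintegral_exp_neg_mul_abs (show 0 < lam / 2 / √s by positivity)]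
              rw [Finset.prod_const, Finset.card_univ, Fintype.card_fin,
                ← ENNReal.ofReal_pow (by positivity), ← ENNReal.ofReal_mul hd0]
          _ ≤ _ := by
              rw [← ENNReal.ofReal_mul (by positivity)]
              refine ENNReal.ofReal_le_ofReal (le_of_eq ?_)
              have h1 : (2 / (lam / 2 / √s)) ^ p = (4 / lam) ^ p * s ^ ((p : ℝ) / 2) := by
                rw [← sqrt_pow_eq_rpow hs, ← mul_pow]
                congr 1
                field_simp
                norm_num
              have h2 : s ^ (-(((n : ℝ) - 1) / 2) - 1)
                  = s ^ (-(((n : ℝ) + p - 1) / 2) - 1) * s ^ ((p : ℝ) / 2) := by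
                rw [← Real.rpow_add hs]
                congr 1
                ring
              rw [h1, h2, hd]
              ring
    _ < ∞ := by
        rw [lintegral_const_mul' _ _ ENNReal.ofReal_ne_top]
        exact ENNReal.mul_lt_top ENNReal.ofReal_lt_top
          (lintegral_rpow_mul_exp_neg_div_sqrt_lt_top (by linarith) hκ)

/-! ### Finiteness of the trace of the blocked kernel -/

/-- In the Leibniz formula every entry of column `j` is at most `M + 1/τ_j` in absolute value, so
all `p!` terms obey the same product bound. -/
theorem exists_det_A_le (X : Matrix (Fin n) (Fin p) ℝ) :
    ∃ M : ℝ, 0 ≤ M ∧ ∀ τ ∈ orthant p, (A X τ).det ≤ p.factorial * ∏ j, (M + (τ j)⁻¹) := by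
  set M := ∑ i, ∑ j, |(Xᵀ * X) i j| with hM
  refine ⟨M, Finset.sum_nonneg fun i _ => Finset.sum_nonneg fun j _ => abs_nonneg _,
    fun τ hτ => ?_⟩
  have hτ0 := mem_orthant.mp hτ
  have hentry : ∀ i j, |A X τ i j| ≤ M + (τ j)⁻¹ := fun i j => by
    have h1 : |(Xᵀ * X) i j| ≤ M :=
      (Finset.single_le_sum (f := fun j => |(Xᵀ * X) i j|) (fun k _ => abs_nonneg _)
        (Finset.mem_univ j)).trans (Finset.single_le_sum (f := fun i => ∑ j, |(Xᵀ * X) i j|)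
          (fun k _ => Finset.sum_nonneg fun j _ => abs_nonneg _) (Finset.mem_univ i))
    have h2 : |Dinv τ i j| ≤ (τ j)⁻¹ := by
      have := inv_pos.mpr (hτ0 j)
      by_cases hij : i = j
      · rw [hij, Dinv, diagonal_apply_eq, abs_of_pos this]
      · rw [Dinv, diagonal_apply_ne _ hij, abs_zero]
        exact this.le
    rw [A, Matrix.add_apply]
    exact (abs_add_le _ _).trans (add_le_add h1 h2)
  calc (A X τ).det ≤ ∑ σ : Equiv.Perm (Fin p), ∏ j, |A X τ (σ j) j| := by
        rw [det_apply]
        refine Finset.sum_le_sum fun σ _ => (le_abs_self _).trans (le_of_eq ?_)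
        rw [Units.smul_def, zsmul_eq_mul, abs_mul, Finset.abs_prod]
        rcases Int.units_eq_one_or (Equiv.Perm.sign σ) with h | h <;> rw [h] <;> simp
    _ ≤ ∑ σ : Equiv.Perm (Fin p), ∏ j, (M + (τ j)⁻¹) :=
        Finset.sum_le_sum fun σ _ => Finset.prod_le_prod (fun j _ => abs_nonneg _)
          fun j _ => hentry (σ j) j
    _ = p.factorial * ∏ j, (M + (τ j)⁻¹) := by
        rw [Finset.sum_const, Finset.card_univ, Fintype.card_perm, Fintype.card_fin, nsmul_eq_mul]

theorem lintegral_sqrt_det_A_lt_top (X : Matrix (Fin n) (Fin p) ℝ) {c : ℝ} (hc : 0 < c) :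
    ∫⁻ τ in orthant p, ENNReal.ofReal (√(A X τ).det * Real.exp (∑ j, -(c * τ j))) < ∞ := by
  obtain ⟨M, hM, hdet⟩ := exists_det_A_le X
  calc ∫⁻ τ in orthant p, ENNReal.ofReal (√(A X τ).det * Real.exp (∑ j, -(c * τ j)))
      ≤ ∫⁻ τ in orthant p, ENNReal.ofReal √p.factorial *
          ∏ j, ENNReal.ofReal ((√M + (√(τ j))⁻¹) * Real.exp (-(c * τ j))) := by
        refine setLIntegral_mono' measurableSet_orthant fun τ hτ => ?_
        have hτ0 := mem_orthant.mp hτ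
        rw [← ENNReal.ofReal_prod_of_nonneg fun j _ => by positivity,
          ← ENNReal.ofReal_mul (by positivity), Finset.prod_mul_distrib, ← Real.exp_sum,
          ← mul_assoc]
        refine ENNReal.ofReal_le_ofReal (mul_le_mul_of_nonneg_right ?_ (Real.exp_pos _).le)
        refine (Real.sqrt_le_sqrt (hdet τ hτ)).trans ?_
        rw [Real.sqrt_mul (by positivity), Real.sqrt_prod _ fun j _ =>
          add_nonneg hM (inv_pos.mpr (hτ0 j)).le]
        refine mul_le_mul_of_nonneg_left (Finset.prod_le_prod (fun j _ => Real.sqrt_nonneg _)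
          fun j _ => ?_) (Real.sqrt_nonneg _)
        -- The bound `√(M + 1/τ) ≤ √M + 1/√τ` reduces each coordinate to gamma integrals of shapes
        -- `1` and `1/2`.
        rw [← Real.sqrt_inv]
        refine Real.sqrt_le_iff.mpr ⟨by positivity, ?_⟩
        have h1 := Real.sq_sqrt hM
        have h2 := Real.sq_sqrt (inv_pos.mpr (hτ0 j)).le
        nlinarith [Real.sqrt_nonneg M, Real.sqrt_nonneg (τ j)⁻¹,
          mul_nonneg (Real.sqrt_nonneg M) (Real.sqrt_nonneg (τ j)⁻¹)]
    _ < ∞ := by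
        rw [lintegral_const_mul' _ _ ENNReal.ofReal_ne_top, volume_restrict_orthant,
          lintegral_fin_prod_eq_prod (f := fun _ t =>
            ENNReal.ofReal ((√M + (√t)⁻¹) * Real.exp (-(c * t)))) _ fun j => by fun_prop]
        refine ENNReal.mul_lt_top ENNReal.ofReal_lt_top (ENNReal.prod_lt_top fun j _ => ?_)
        have h1 := lintegral_rpow_mul_exp_neg_mul_Ioi one_pos hc
        have h2 := lintegral_rpow_mul_exp_neg_mul_Ioi (show (0 : ℝ) < 1 / 2 by norm_num) hc
        calc ∫⁻ t in Set.Ioi 0, ENNReal.ofReal ((√M + (√t)⁻¹) * Real.exp (-(c * t)))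
            ≤ ∫⁻ t in Set.Ioi 0, (ENNReal.ofReal √M *
                ENNReal.ofReal (t ^ ((1 : ℝ) - 1) * Real.exp (-(c * t))) +
                ENNReal.ofReal (t ^ ((1 / 2 : ℝ) - 1) * Real.exp (-(c * t)))) := by
              refine setLIntegral_mono' measurableSet_Ioi fun t ht => ?_
              have ht : 0 < t := ht
              rw [← ENNReal.ofReal_mul (by positivity),
                ← ENNReal.ofReal_add (by positivity) (by positivity)]
              refine ENNReal.ofReal_le_ofReal (le_of_eq ?_)
              rw [show (1 / 2 - 1 : ℝ) = -(1 / 2) by norm_num, Real.rpow_neg ht.le,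
                ← Real.sqrt_eq_rpow, sub_self, Real.rpow_zero]
              ring
          _ < ∞ := by
              rw [lintegral_add_left (by fun_prop), lintegral_const_mul' _ _ ENNReal.ofReal_ne_top,
                h1, h2]
              exact ENNReal.add_lt_top.mpr ⟨ENNReal.mul_lt_top ENNReal.ofReal_lt_top
                ENNReal.ofReal_lt_top, ENNReal.ofReal_lt_top⟩

/-- The energy is used twice at half weight: one half is at least half of `minEnergy` and gives
decay in `s`, the other dominates the quadratic penalty and gives decay in `β` and `τ`. -/
theorem exponent_le (lam : ℝ) (X : Matrix (Fin n) (Fin p) ℝ) (Y : Fin n → ℝ) (β : Fin p → ℝ)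
    {s : ℝ} (hs : 0 < s) {τ : Fin p → ℝ} (hτ : τ ∈ orthant p) :
    (∑ j, -(|β j| - lam * √s * τ j) ^ 2 / (2 * s * τ j)) + -energy X Y β τ / (2 * s)
      ≤ -(minEnergy X Y τ / 4) / s + (∑ j, -(lam ^ 2 / 10 * τ j)) +
        ∑ j, -β j ^ 2 / (2 * (4 * s * τ j)) := by
  have hτ0 := mem_orthant.mp hτ
  have h1 : ∑ j, β j ^ 2 / τ j ≤ energy X Y β τ := by
    rw [energy, dotProduct_Dinv_mulVec, ← residual]
    linarith [residual_nonneg X Y β]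
  have h2 : -energy X Y β τ / (2 * s)
      ≤ -(minEnergy X Y τ / 4) / s + ∑ j, -(β j ^ 2 / (4 * s * τ j)) := by
    have h3 : ∑ j, -(β j ^ 2 / (4 * s * τ j)) = -(∑ j, β j ^ 2 / τ j) / (4 * s) := by
      rw [Finset.sum_neg_distrib, neg_div, Finset.sum_div]
      congr 1
      refine Finset.sum_congr rfl fun j _ => ?_
      have := hτ0 j
      field_simp
    rw [h3, show -(minEnergy X Y τ / 4) / s = -minEnergy X Y τ / (4 * s) by field_simp, ← add_div,
      div_le_div_iff₀ (by positivity) (by positivity)]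
    nlinarith [minEnergy_le_energy X Y hτ β]
  refine (add_le_add_right h2 _).trans ?_
  rw [add_left_comm, add_assoc, ← Finset.sum_add_distrib, ← Finset.sum_add_distrib]
  refine add_le_add_right (Finset.sum_le_sum fun j _ => ?_) _
  have ht := hτ0 j
  have h3 := Real.sq_sqrt hs.le
  -- The constants `1/10` and `1/8` are matched so that the difference is a perfect square: with `m
  -- = λ√s τ`, `5/8 β² - |β| m + 2/5 m² = 5/8 (|β| - 4/5 m)²`.
  have h4 : -(lam ^ 2 / 10 * τ j) + -β j ^ 2 / (2 * (4 * s * τ j))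
      - (-(|β j| - lam * √s * τ j) ^ 2 / (2 * s * τ j) + -(β j ^ 2 / (4 * s * τ j)))
      = 5 / 8 * (|β j| - 4 / 5 * lam * √s * τ j) ^ 2 / (s * τ j) := by
    rw [← sq_abs (β j)]
    field_simp
    ring_nf
    rw [h3]
    ring
  have h5 : 0 ≤ 5 / 8 * (|β j| - 4 / 5 * lam * √s * τ j) ^ 2 / (s * τ j) := by positivity
  linarith

/-- For fixed `τ`, the Gaussian integral over `β` gives `∏ √τ_j · s^(p/2)` up to a constant,
cancelling the factor `∏ τ_j^(-1/2)` of the law of `τ` and the power of `s` in `betaConst`. The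
integral over `s` then cancels the power of `minEnergy` up to `2^α`, so no lower bound for
`minEnergy` uniform in `τ` is needed. -/
theorem lintegral_trace_lt_top (hn : 2 ≤ n) {lam : ℝ} (hlam : 0 < lam)
    (X : Matrix (Fin n) (Fin p) ℝ) {Y : Fin n → ℝ} (hY : ∃ i i', Y i ≠ Y i') :
    ∫⁻ τ in orthant p, ∫⁻ x in paramSet p, ENNReal.ofReal (tauPDF lam x.1 x.2 τ) *
      ENNReal.ofReal (sigmaBlockedPDF X Y τ x.2 * betaPDF X Y x.2 τ x.1) < ∞ := by
  have hn' : (2 : ℝ) ≤ n := by exact_mod_cast hn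
  set α := ((n : ℝ) - 1) / 2 with hα
  have hα0 : 0 < α := by rw [hα]; linarith
  have hΓ := Real.Gamma_pos_of_pos hα0
  set c := (lam / √(2 * Real.pi)) ^ p * √(2 * Real.pi * 4) ^ p * (√((2 * Real.pi) ^ p))⁻¹ *
    2 ^ α with hc
  have hc0 : 0 ≤ c := by positivity
  refine lt_of_le_of_lt (setLIntegral_mono' measurableSet_orthant (g := fun τ =>
    ENNReal.ofReal c * ENNReal.ofReal (√(A X τ).det * Real.exp (∑ j, -(lam ^ 2 / 10 * τ j))))
    fun τ hτ => ?_) ?_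
  swap
  · rw [lintegral_const_mul' _ _ ENNReal.ofReal_ne_top]
    exact ENNReal.mul_lt_top ENNReal.ofReal_lt_top (lintegral_sqrt_det_A_lt_top X (by positivity))
  have hτ0 := mem_orthant.mp hτ
  have hC := minEnergy_pos X hY hτ
  have hdet := (posDef_A X hτ).det_pos
  set d := (lam / √(2 * Real.pi)) ^ p * (∏ j, (√(τ j))⁻¹) *
    ((minEnergy X Y τ / 2) ^ α / Real.Gamma α) * Real.exp (∑ j, -(lam ^ 2 / 10 * τ j)) with hd
  have hprod : 0 ≤ ∏ j, (√(τ j))⁻¹ := Finset.prod_nonneg fun j _ => by positivity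
  have hd0 : 0 ≤ d := by positivity
  have hbound : ∀ (s : ℝ), 0 < s → ∀ β, tauPDF lam β s τ *
      (sigmaBlockedPDF X Y τ s * betaPDF X Y s τ β)
      ≤ d * (s ^ (-α - 1) * Real.exp (-(minEnergy X Y τ / 4) / s) * (betaConst X s τ)⁻¹) *
        Real.exp (∑ j, -β j ^ 2 / (2 * (4 * s * τ j))) := fun s hs β => by
    have hbc := betaConst_pos X hs hτ
    have h := Real.exp_le_exp.mpr (exponent_le lam X Y β hs hτ)
    have e1 : Real.exp (-(minEnergy X Y τ / 2) / s) *
        Real.exp (-(energy X Y β τ - minEnergy X Y τ) / (2 * s))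
        = Real.exp (-energy X Y β τ / (2 * s)) := by
      rw [← Real.exp_add]
      congr 1
      field_simp
      ring
    rw [tauPDF_eq, sigmaBlockedPDF_eq, inverseGammaPDFReal, if_pos hs, betaPDF_eq X Y hs hτ, ← hα]
    calc _ = (lam / √(2 * Real.pi)) ^ p * (∏ j, (√(τ j))⁻¹) *
          ((minEnergy X Y τ / 2) ^ α / Real.Gamma α) * s ^ (-α - 1) * (betaConst X s τ)⁻¹ *
          (Real.exp (∑ j, -(|β j| - lam * √s * τ j) ^ 2 / (2 * s * τ j)) *
            Real.exp (-energy X Y β τ / (2 * s))) := by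
          rw [← e1]
          ring
      _ ≤ (lam / √(2 * Real.pi)) ^ p * (∏ j, (√(τ j))⁻¹) *
          ((minEnergy X Y τ / 2) ^ α / Real.Gamma α) * s ^ (-α - 1) * (betaConst X s τ)⁻¹ *
          Real.exp (-(minEnergy X Y τ / 4) / s + (∑ j, -(lam ^ 2 / 10 * τ j)) +
            ∑ j, -β j ^ 2 / (2 * (4 * s * τ j))) := by
          rw [← Real.exp_add]
          gcongr
      _ = _ := by
          rw [Real.exp_add, Real.exp_add, hd]
          ring
  have hm : Measurable fun x : (Fin p → ℝ) × ℝ => ENNReal.ofReal (tauPDF lam x.1 x.2 τ) *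
      ENNReal.ofReal (sigmaBlockedPDF X Y τ x.2 * betaPDF X Y x.2 τ x.1) :=
    ((measurable_tauPDF lam).comp (by fun_prop :
      Measurable fun x : (Fin p → ℝ) × ℝ => (x.1, x.2, τ))).ennreal_ofReal.mul
      (((measurable_sigmaBlockedPDF X Y).comp (by fun_prop :
        Measurable fun x : (Fin p → ℝ) × ℝ => (τ, x.2))).mul ((measurable_betaPDF X Y).comp
        (by fun_prop : Measurable fun x : (Fin p → ℝ) × ℝ => (x.2, τ, x.1)))).ennreal_ofReal
  rw [volume_restrict_paramSet, lintegral_prod_symm _ hm.aemeasurable]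
  set e := d * √(2 * Real.pi * 4) ^ p * (∏ j, √(τ j)) *
    (√((2 * Real.pi) ^ p * (A X τ)⁻¹.det))⁻¹ with he
  have he0 : 0 ≤ e := by positivity
  calc ∫⁻ s in Set.Ioi 0, ∫⁻ β, ENNReal.ofReal (tauPDF lam β s τ) *
        ENNReal.ofReal (sigmaBlockedPDF X Y τ s * betaPDF X Y s τ β)
      ≤ ∫⁻ s in Set.Ioi 0, ENNReal.ofReal e *
          ENNReal.ofReal (s ^ (-α - 1) * Real.exp (-(minEnergy X Y τ / 4) / s)) := by
        refine setLIntegral_mono' measurableSet_Ioi fun s hs => ?_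
        have hs : 0 < s := hs
        have hbc := betaConst_pos X hs hτ
        set f := d * (s ^ (-α - 1) * Real.exp (-(minEnergy X Y τ / 4) / s) *
          (betaConst X s τ)⁻¹) with hf
        have hf0 : 0 ≤ f := by positivity
        calc _ ≤ ∫⁻ β : Fin p → ℝ, ENNReal.ofReal f *
              ∏ j, ENNReal.ofReal (Real.exp (-β j ^ 2 / (2 * (4 * s * τ j)))) := by
              refine lintegral_mono fun β => ?_
              rw [← ENNReal.ofReal_mul (tauPDF_nonneg hlam _ _ _),
                ← ENNReal.ofReal_prod_of_nonneg fun j _ => (Real.exp_pos _).le,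
                ← Real.exp_sum, ← ENNReal.ofReal_mul hf0]
              exact ENNReal.ofReal_le_ofReal (hbound s hs β)
          _ = ENNReal.ofReal (f * ∏ j, √(2 * Real.pi * (4 * s * τ j))) := by
              rw [lintegral_const_mul' _ _ ENNReal.ofReal_ne_top, volume_pi,
                lintegral_fin_prod_eq_prod (f := fun j t =>
                  ENNReal.ofReal (Real.exp (-t ^ 2 / (2 * (4 * s * τ j))))) _
                  fun j => by fun_prop]
              rw [Finset.prod_congr rfl fun j _ => lintegral_exp_neg_sq_div
                (show 0 < 4 * s * τ j by have := hτ0 j; positivity),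
                ← ENNReal.ofReal_prod_of_nonneg fun j _ => Real.sqrt_nonneg _,
                ← ENNReal.ofReal_mul hf0]
          _ ≤ _ := by
              rw [← ENNReal.ofReal_mul he0]
              refine ENNReal.ofReal_le_ofReal (le_of_eq ?_)
              have h1 : ∏ j, √(2 * Real.pi * (4 * s * τ j))
                  = √(2 * Real.pi * 4) ^ p * s ^ ((p : ℝ) / 2) * ∏ j, √(τ j) := by
                rw [← sqrt_pow_eq_rpow hs]
                have : ∀ j, √(2 * Real.pi * (4 * s * τ j))
                    = √(2 * Real.pi * 4) * √s * √(τ j) := fun j => by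
                  rw [← Real.sqrt_mul (by positivity), ← Real.sqrt_mul (by positivity)]
                  congr 1
                  ring
                simp_rw [this]
                rw [Finset.prod_mul_distrib, Finset.prod_const, Finset.card_univ,
                  Fintype.card_fin, mul_pow]
              have h2 : s ^ ((p : ℝ) / 2) ≠ 0 := by positivity
              rw [h1, hf, he, betaConst_eq X hs, mul_inv]
              field_simp
    _ = ENNReal.ofReal (e * (Real.Gamma α / (minEnergy X Y τ / 4) ^ α)) := by
        rw [lintegral_const_mul' _ _ ENNReal.ofReal_ne_top,
          lintegral_rpow_mul_exp_neg_div_Ioi hα0 (by positivity), ← ENNReal.ofReal_mul he0]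
    _ ≤ _ := by
        rw [← ENNReal.ofReal_mul hc0]
        refine ENNReal.ofReal_le_ofReal (le_of_eq ?_)
        have h1 : (∏ j, (√(τ j))⁻¹) * ∏ j, √(τ j) = 1 := by
          rw [← Finset.prod_mul_distrib]
          exact Finset.prod_eq_one fun j _ => inv_mul_cancel₀ (Real.sqrt_pos.mpr (hτ0 j)).ne'
        have h2 : (√((2 * Real.pi) ^ p * (A X τ)⁻¹.det))⁻¹
            = (√((2 * Real.pi) ^ p))⁻¹ * √(A X τ).det := by
          rw [Real.sqrt_mul (by positivity), mul_inv, det_nonsing_inv, Ring.inverse_eq_inv',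
            Real.sqrt_inv, inv_inv]
        have h3 : (minEnergy X Y τ / 2) ^ α = 2 ^ α * (minEnergy X Y τ / 4) ^ α := by
          rw [← Real.mul_rpow (by norm_num) (by positivity)]
          congr 1
          ring
        have h4 : (minEnergy X Y τ / 4) ^ α ≠ 0 := by positivity
        rw [he, hd, hc, h2, h3]
        calc _ = ((∏ j, (√(τ j))⁻¹) * ∏ j, √(τ j)) *
              (((minEnergy X Y τ / 4) ^ α / (minEnergy X Y τ / 4) ^ α) *
              (Real.Gamma α / Real.Gamma α)) * ((lam / √(2 * Real.pi)) ^ p *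
              √(2 * Real.pi * 4) ^ p * (√((2 * Real.pi) ^ p))⁻¹ * 2 ^ α *
              (√(A X τ).det * Real.exp (∑ j, -(lam ^ 2 / 10 * τ j)))) := by ring
          _ = _ := by rw [h1, div_self h4, div_self hΓ.ne', one_mul, one_mul, one_mul]

/-! ### A minorization of the three-step kernel on dyadic shells -/

/-- The density depends on `β` and `s` only through `|β|/√s ≤ 1`, so the bound is the same at every
scale: the exponent's numerator is at most `s (1 + 2λ)²` and its denominator at least `2s`. -/
theorem exists_le_tauPDF {lam : ℝ} (hlam : 0 < lam) (p : ℕ) :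
    ∃ δ : ℝ, 0 < δ ∧ ∀ (β : Fin p → ℝ) (s : ℝ) (τ : Fin p → ℝ), 0 < s → (∀ i, |β i| ≤ √s) →
      (∀ i, τ i ∈ Set.Icc (1 : ℝ) 2) → δ ≤ tauPDF lam β s τ := by
  refine ⟨∏ _j : Fin p, lam / √(2 * Real.pi) * (√2)⁻¹ * Real.exp (-(1 + 2 * lam) ^ 2 / 2),
    Finset.prod_pos fun j _ => by positivity, fun β s τ hs hβ hτ => ?_⟩
  refine Finset.prod_le_prod (fun j _ => by positivity) fun j _ => ?_
  obtain ⟨h1, h2⟩ := hτ j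
  have hτ0 : 0 < τ j := by linarith
  have hsq : 0 < √s := Real.sqrt_pos.mpr hs
  have hexp : -(1 + 2 * lam) ^ 2 / 2 ≤ -(|β j| - lam * √s * τ j) ^ 2 / (2 * s * τ j) := by
    have h3 : (|β j| - lam * √s * τ j) ^ 2 ≤ (√s * (1 + 2 * lam)) ^ 2 := by
      refine sq_le_sq' ?_ ?_
      · have : lam * √s * τ j ≤ lam * √s * 2 := by gcongr
        nlinarith [abs_nonneg (β j)]
      · have : 0 ≤ lam * √s * τ j := by positivity
        nlinarith [hβ j, mul_pos hlam hsq]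
    rw [mul_pow, Real.sq_sqrt hs.le] at h3
    rw [div_le_div_iff₀ (by norm_num) (by positivity)]
    have h4 : 0 ≤ s * (1 + 2 * lam) ^ 2 := by positivity
    nlinarith
  have hinv : (√2)⁻¹ ≤ (√(τ j))⁻¹ := inv_anti₀ (Real.sqrt_pos.mpr hτ0) (Real.sqrt_le_sqrt h2)
  gcongr

theorem exists_energy_le (X : Matrix (Fin n) (Fin p) ℝ) (Y : Fin n → ℝ) :
    ∃ K : ℝ, 0 < K ∧ ∀ (q : ℝ) (β τ : Fin p → ℝ), 1 ≤ q → (∀ i, |β i| ≤ q) → (∀ i, 1 ≤ τ i) →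
      energy X Y β τ ≤ K * q ^ 2 := by
  refine ⟨∑ i, (|centered Y i| + (∑ j, |X i j|) * p) ^ 2 + p + 1, ?_, fun q β τ hq hβ hτ => ?_⟩
  · have : 0 ≤ ∑ i, (|centered Y i| + (∑ j, |X i j|) * p) ^ 2 :=
      Finset.sum_nonneg fun i _ => sq_nonneg _
    positivity
  have h1 : residual X Y β ≤ (∑ i, (|centered Y i| + (∑ j, |X i j|) * p) ^ 2) * q ^ 2 := by
    rw [residual, dotProduct, Finset.sum_mul]
    refine Finset.sum_le_sum fun i _ => ?_
    rw [← sq, ← mul_pow, ← sq_abs ((centered Y - X *ᵥ β) i)]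
    refine pow_le_pow_left₀ (abs_nonneg _) ?_ 2
    have hM : 0 ≤ ∑ j, |X i j| := Finset.sum_nonneg fun j _ => abs_nonneg _
    have h2 : ∑ j, |β j| ≤ p * q := by
      refine (Finset.sum_le_sum fun j _ => hβ j).trans (le_of_eq ?_)
      simp
    calc |(centered Y - X *ᵥ β) i| ≤ |centered Y i| + |(X *ᵥ β) i| := abs_sub _ _
      _ ≤ |centered Y i| * q + (∑ j, |X i j|) * (p * q) :=
          add_le_add (le_mul_of_one_le_right (abs_nonneg _) hq)
            ((abs_mulVec_le X β i).trans (mul_le_mul_of_nonneg_left h2 hM))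
      _ = (|centered Y i| + (∑ j, |X i j|) * p) * q := by ring
  have h2 : ∑ j, β j ^ 2 / τ j ≤ p * q ^ 2 := by
    calc ∑ j, β j ^ 2 / τ j ≤ ∑ _j : Fin p, q ^ 2 := by
          refine Finset.sum_le_sum fun j _ => (div_le_self (sq_nonneg _) (hτ j)).trans ?_
          rw [← sq_abs]
          exact pow_le_pow_left₀ (abs_nonneg _) (hβ j) 2
      _ = p * q ^ 2 := by simp
  rw [energy, dotProduct_Dinv_mulVec, ← residual]
  nlinarith [sq_nonneg q]

/-- `det A_τ` is continuous and nonzero on the compact cube `[1, 2]^p`. -/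
theorem exists_det_inv_A_le (X : Matrix (Fin n) (Fin p) ℝ) :
    ∃ d : ℝ, 0 < d ∧ ∀ τ : Fin p → ℝ, (∀ i, τ i ∈ Set.Icc (1 : ℝ) 2) →
      √((2 * Real.pi) ^ p * (A X τ)⁻¹.det) ≤ d := by
  have hK : IsCompact (Set.univ.pi fun _ : Fin p => Set.Icc (1 : ℝ) 2) :=
    isCompact_univ_pi fun _ => isCompact_Icc
  have hpos : ∀ τ ∈ Set.univ.pi fun _ : Fin p => Set.Icc (1 : ℝ) 2, τ ∈ orthant p :=
    fun τ hτ => mem_orthant.mpr fun j => by have := (hτ j trivial).1; linarith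
  have hcont : ContinuousOn (fun τ : Fin p → ℝ => (A X τ)⁻¹.det)
      (Set.univ.pi fun _ : Fin p => Set.Icc (1 : ℝ) 2) := by
    simp_rw [det_nonsing_inv, Ring.inverse_eq_inv']
    refine ContinuousOn.inv₀ ?_ fun τ hτ => (posDef_A X (hpos τ hτ)).det_pos.ne'
    simp_rw [det_apply]
    refine continuousOn_finsetSum _ fun σ _ => ContinuousOn.const_smul
      (continuousOn_finsetProd _ fun i _ => ?_) _
    simp_rw [A, Dinv, Matrix.add_apply, diagonal_apply]
    refine continuousOn_const.add ?_
    split_ifs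
    · exact (continuous_apply _).continuousOn.inv₀ fun τ hτ =>
        (mem_orthant.mp (hpos τ hτ) _).ne'
    · exact continuousOn_const
  obtain ⟨d, hd⟩ := hK.bddAbove_image hcont
  refine ⟨√((2 * Real.pi) ^ p * d) + 1, by positivity, fun τ hτ => ?_⟩
  have h := hd (Set.mem_image_of_mem _ (fun i _ => hτ i : τ ∈ Set.univ.pi fun _ => _))
  refine le_trans (Real.sqrt_le_sqrt ?_) (le_add_of_nonneg_right zero_le_one)
  gcongr

/-- At scale `q` the `σ²` density is of order `q^(-2)` and the `β` density of order `q^(-p)`,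
exactly compensating the volume of the target box. Keeping `β₁` away from zero bounds the inverse
gamma scale below by a multiple of `q²`. -/
theorem exists_le_threeStep_integrand (hn : 2 ≤ n) (hp : 0 < p) {lam : ℝ} (hlam : 0 < lam)
    (X : Matrix (Fin n) (Fin p) ℝ) {Y : Fin n → ℝ} (hY : ∃ i i', Y i ≠ Y i') :
    ∃ δ : ℝ, 0 < δ ∧ ∀ (q : ℝ) (β₀ β₁ τ : Fin p → ℝ) (s₀ s₁ : ℝ), 1 ≤ q →
      s₀ ∈ Set.Ico (q ^ 2) (4 * q ^ 2) → s₁ ∈ Set.Ico (q ^ 2) (4 * q ^ 2) →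
      (∀ i, |β₀ i| ≤ q) → (∀ i, β₁ i ∈ Set.Icc (q / 2) q) → (∀ i, τ i ∈ Set.Icc (1 : ℝ) 2) →
      δ * (q ^ p * q ^ 2)⁻¹ ≤ sigmaPDF X Y β₁ τ s₁ * betaPDF X Y s₀ τ β₁ * tauPDF lam β₀ s₀ τ := by
  have hn' : (2 : ℝ) ≤ n := by exact_mod_cast hn
  have hp' : (0 : ℝ) ≤ p := p.cast_nonneg
  obtain ⟨δ, hδ, hτlow⟩ := exists_le_tauPDF hlam p
  obtain ⟨K, hK, hE⟩ := exists_energy_le X Y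
  obtain ⟨d, hd, hdet⟩ := exists_det_inv_A_le X
  set a := ((n : ℝ) + p - 1) / 2 with ha
  have ha0 : 0 < a := by rw [ha]; linarith
  have hΓ := Real.Gamma_pos_of_pos ha0
  refine ⟨((1 / 16) ^ a / Real.Gamma a * 4 ^ (-a - 1) * Real.exp (-(K / 2))) *
    ((2 ^ p * d)⁻¹ * Real.exp (-(K / 2))) * δ, by positivity,
    fun q β₀ β₁ τ s₀ s₁ hq hs₀ hs₁ hβ₀ hβ₁ hτ => ?_⟩
  have hq0 : 0 < q := by linarith
  have hs₀0 : 0 < s₀ := lt_of_lt_of_le (by positivity) hs₀.1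
  have hs₁0 : 0 < s₁ := lt_of_lt_of_le (by positivity) hs₁.1
  have hτ' : τ ∈ orthant p := mem_orthant.mpr fun i => by linarith [(hτ i).1]
  have hβ₁' : ∀ i, |β₁ i| ≤ q := fun i => by
    rw [abs_of_nonneg (by linarith [(hβ₁ i).1])]
    exact (hβ₁ i).2
  have hEu := hE q β₁ τ hq hβ₁' fun i => (hτ i).1
  have hEl : q ^ 2 / 8 ≤ energy X Y β₁ τ := by
    have h0 : ∀ i, 0 ≤ β₁ i ^ 2 / τ i := fun i =>
      div_nonneg (sq_nonneg _) (mem_orthant.mp hτ' i).le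
    -- One coordinate suffices, since `(q/2)²/2 = q²/8`; this is where `p ≥ 1` enters.
    have h1 : q ^ 2 / 8 ≤ β₁ ⟨0, hp⟩ ^ 2 / τ ⟨0, hp⟩ := by
      obtain ⟨h2, h3⟩ := hτ ⟨0, hp⟩
      have h4 := (hβ₁ ⟨0, hp⟩).1
      rw [div_le_div_iff₀ (by norm_num) (by linarith)]
      nlinarith
    have h2 := Finset.single_le_sum (f := fun i => β₁ i ^ 2 / τ i) (fun i _ => h0 i)
      (Finset.mem_univ ⟨0, hp⟩)
    rw [energy, dotProduct_Dinv_mulVec, ← residual]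
    linarith [residual_nonneg X Y β₁]
  have hEpos := energy_pos X hY hτ' β₁
  have hsigma : ((1 / 16) ^ a / Real.Gamma a * 4 ^ (-a - 1) * Real.exp (-(K / 2))) * (q ^ 2)⁻¹
      ≤ sigmaPDF X Y β₁ τ s₁ := by
    have e1 : (q ^ 2) ^ a * (1 / 16) ^ a ≤ (energy X Y β₁ τ / 2) ^ a := by
      rw [← Real.mul_rpow (by positivity) (by norm_num)]
      exact Real.rpow_le_rpow (by positivity) (by linarith) ha0.le
    have e2 : 4 ^ (-a - 1) * (q ^ 2) ^ (-a - 1) ≤ s₁ ^ (-a - 1) := by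
      rw [← Real.mul_rpow (by norm_num) (by positivity)]
      exact Real.rpow_le_rpow_of_nonpos hs₁0 hs₁.2.le (by linarith)
    have e3 : Real.exp (-(K / 2)) ≤ Real.exp (-(energy X Y β₁ τ / 2) / s₁) := by
      refine Real.exp_le_exp.mpr ?_
      rw [neg_div, neg_le_neg_iff, div_le_iff₀ hs₁0]
      nlinarith [hs₁.1]
    have e4 : (q ^ 2) ^ a * (q ^ 2) ^ (-a - 1) = (q ^ 2)⁻¹ := by
      rw [← Real.rpow_add (by positivity), ← Real.rpow_neg_one]
      congr 1
      ring
    rw [sigmaPDF_eq, inverseGammaPDFReal, if_pos hs₁0, ← ha]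
    calc _ = (q ^ 2) ^ a * (1 / 16) ^ a / Real.Gamma a * (4 ^ (-a - 1) * (q ^ 2) ^ (-a - 1)) *
          Real.exp (-(K / 2)) := by rw [← e4]; ring
      _ ≤ _ := by gcongr
  have hbeta : (2 ^ p * d)⁻¹ * Real.exp (-(K / 2)) * (q ^ p)⁻¹ ≤ betaPDF X Y s₀ τ β₁ := by
    have hbc := betaConst_pos X hs₀0 hτ'
    have e1 : betaConst X s₀ τ ≤ 2 ^ p * d * q ^ p := by
      have h1 : √s₀ ≤ 2 * q := Real.sqrt_le_iff.mpr ⟨by positivity, by nlinarith [hs₀.2]⟩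
      rw [betaConst_eq X hs₀0, ← sqrt_pow_eq_rpow hs₀0]
      calc _ ≤ (2 * q) ^ p * d := by
            gcongr
            exact hdet τ hτ
        _ = _ := by ring
    have e2 : -(K / 2) ≤ -(energy X Y β₁ τ - minEnergy X Y τ) / (2 * s₀) := by
      rw [neg_div, neg_le_neg_iff, div_le_iff₀ (by positivity)]
      nlinarith [hs₀.1, minEnergy_pos X hY hτ']
    rw [betaPDF_eq X Y hs₀0 hτ']
    calc _ = (2 ^ p * d * q ^ p)⁻¹ * Real.exp (-(K / 2)) := by
          rw [mul_inv (2 ^ p * d)]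
          ring
      _ ≤ _ := by gcongr
  have htau : δ ≤ tauPDF lam β₀ s₀ τ :=
    hτlow β₀ s₀ τ hs₀0 (fun i => (hβ₀ i).trans (Real.le_sqrt_of_sq_le hs₀.1)) hτ
  calc _ = ((1 / 16) ^ a / Real.Gamma a * 4 ^ (-a - 1) * Real.exp (-(K / 2))) * (q ^ 2)⁻¹ *
        ((2 ^ p * d)⁻¹ * Real.exp (-(K / 2)) * (q ^ p)⁻¹) * δ := by
        rw [mul_inv]
        ring
    _ ≤ _ := by
        have h0 := betaPDF_nonneg X Y s₀ τ β₁
        have h1 : 0 ≤ sigmaPDF X Y β₁ τ s₁ := le_trans (by positivity) hsigma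
        gcongr

/-- The set of `(β, σ²)` with `4^j ≤ σ² < 4^{j+1}` and `|β_i| ≤ 2^j`. -/
def shell (p j : ℕ) : Set ((Fin p → ℝ) × ℝ) :=
  (Set.univ.pi fun _ => Set.Icc (-(2 : ℝ) ^ j) (2 ^ j)) ×ˢ Set.Ico (4 ^ j) (4 ^ (j + 1))

theorem measurableSet_shell (p j : ℕ) : MeasurableSet (shell p j) :=
  (MeasurableSet.univ_pi fun _ => measurableSet_Icc).prod measurableSet_Ico

theorem pairwise_disjoint_shell (p : ℕ) : Pairwise (Function.onFun Disjoint (shell p)) := by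
  have h : ∀ i j, i < j → Disjoint (shell p i) (shell p j) := fun i j hij => by
    refine Set.disjoint_left.mpr fun x hx hx' => ?_
    have h1 : (4 : ℝ) ^ (i + 1) ≤ 4 ^ j := pow_le_pow_right₀ (by norm_num) hij
    linarith [hx.2.2, hx'.2.1]
  intro i j hij
  rcases lt_or_gt_of_ne hij with h1 | h1
  · exact h i j h1
  · exact (h j i h1).symm

theorem shell_subset_paramSet (p j : ℕ) : shell p j ⊆ paramSet p := fun x hx =>
  ⟨trivial, lt_of_lt_of_le (by positivity) hx.2.1⟩

theorem volume_shell_ne_zero (p j : ℕ) : volume (shell p j) ≠ 0 := by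
  rw [shell, Measure.volume_eq_prod, Measure.prod_prod, volume_pi_pi, Real.volume_Ico]
  refine mul_ne_zero (Finset.prod_ne_zero_iff.mpr fun i _ => ?_) ?_
  · rw [Real.volume_Icc, Ne, ENNReal.ofReal_eq_zero, not_le]
    have : (0 : ℝ) < 2 ^ j := by positivity
    linarith
  · rw [Ne, ENNReal.ofReal_eq_zero, not_le, pow_succ]
    have : (0 : ℝ) < 4 ^ j := by positivity
    linarith

theorem exists_le_lintegral_threeStepKernel (hn : 2 ≤ n) (hp : 0 < p) {lam : ℝ} (hlam : 0 < lam)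
    (X : Matrix (Fin n) (Fin p) ℝ) {Y : Fin n → ℝ} (hY : ∃ i i', Y i ≠ Y i') :
    ∃ δ : ℝ, 0 < δ ∧ ∀ j, ∀ x ∈ shell p j, ENNReal.ofReal δ ≤
      ∫⁻ y in shell p j, threeStepKernel lam X Y x y ∂volume.restrict (paramSet p) := by
  obtain ⟨δ, hδ, h⟩ := exists_le_threeStep_integrand hn hp hlam X hY
  refine ⟨δ * (3 * (1 / 2) ^ p), by positivity, fun j x hx => ?_⟩
  set q : ℝ := 2 ^ j with hq
  have hq1 : 1 ≤ q := one_le_pow₀ (by norm_num)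
  have hq0 : 0 < q := by linarith
  have h4 : (4 : ℝ) ^ j = q ^ 2 := by rw [hq, ← pow_mul, mul_comm, pow_mul]; norm_num
  -- Restricting `τ` to this unit-volume cube and `(β, σ²)` to a box inside the shell loses only
  -- constants, the same for all `j`.
  set T : Set (Fin p → ℝ) := Set.univ.pi fun _ => Set.Icc (1 : ℝ) 2 with hT
  set B : Set (Fin p → ℝ) := Set.univ.pi fun _ => Set.Icc (q / 2) q with hB
  set I : Set ℝ := Set.Ico (q ^ 2) (4 * q ^ 2) with hI
  have hshell : shell p j = (Set.univ.pi fun _ => Set.Icc (-q) q) ×ˢ I := by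
    rw [shell, pow_succ, h4, mul_comm _ (4 : ℝ)]
  have hTm : MeasurableSet T := MeasurableSet.univ_pi fun _ => measurableSet_Icc
  have hBm : MeasurableSet B := MeasurableSet.univ_pi fun _ => measurableSet_Icc
  have hTo : T ⊆ orthant p := fun τ hτ => mem_orthant.mpr fun i => by
    linarith [(hτ i trivial).1]
  have hTvol : volume T = 1 := by
    rw [hT, volume_pi_pi]
    norm_num [Real.volume_Icc]
  have hRvol : volume (B ×ˢ I) = ENNReal.ofReal ((q / 2) ^ p * (3 * q ^ 2)) := by
    rw [Measure.volume_eq_prod, Measure.prod_prod, hB, volume_pi_pi, hI, Real.volume_Ico,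
      ENNReal.ofReal_mul (by positivity), ENNReal.ofReal_pow (by positivity)]
    simp only [Real.volume_Icc, Finset.prod_const, Finset.card_univ, Fintype.card_fin]
    congr 3 <;> ring
  have hRs : B ×ˢ I ⊆ shell p j := by
    rw [hshell]
    refine Set.prod_mono (Set.pi_mono fun i _ => Set.Icc_subset_Icc (by linarith) le_rfl) le_rfl
  rw [hshell] at hx
  have hxβ : ∀ i, |x.1 i| ≤ q := fun i => abs_le.mpr (hx.1 i trivial)
  rw [Measure.restrict_restrict (measurableSet_shell p j),
    Set.inter_eq_left.mpr (shell_subset_paramSet p j)]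
  calc ENNReal.ofReal (δ * (3 * (1 / 2) ^ p))
      = ENNReal.ofReal (δ * (q ^ p * q ^ 2)⁻¹) * volume (B ×ˢ I) := by
        rw [hRvol, ← ENNReal.ofReal_mul (by positivity), div_pow, div_pow, one_pow]
        congr 1
        field_simp
    _ = ∫⁻ _y in B ×ˢ I, ENNReal.ofReal (δ * (q ^ p * q ^ 2)⁻¹) := by
        rw [setLIntegral_const]
    _ ≤ ∫⁻ y in B ×ˢ I, threeStepKernel lam X Y x y := by
        refine setLIntegral_mono' (hBm.prod measurableSet_Ico) fun y hy => ?_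
        calc ENNReal.ofReal (δ * (q ^ p * q ^ 2)⁻¹)
            = ∫⁻ _τ in T, ENNReal.ofReal (δ * (q ^ p * q ^ 2)⁻¹) := by
              rw [setLIntegral_const, hTvol, mul_one]
          _ ≤ ∫⁻ τ in T, ENNReal.ofReal (sigmaPDF X Y y.1 τ y.2 * betaPDF X Y x.2 τ y.1 *
                tauPDF lam x.1 x.2 τ) :=
              setLIntegral_mono' hTm fun τ hτ => ENNReal.ofReal_le_ofReal
                (h q x.1 y.1 τ x.2 y.2 hq1 hx.2 hy.2 hxβ (fun i => hy.1 i trivial)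
                  fun i => hτ i trivial)
          _ ≤ threeStepKernel lam X Y x y := lintegral_mono_set hTo
    _ ≤ ∫⁻ y in shell p j, threeStepKernel lam X Y x y := lintegral_mono_set hRs

/-! ### The posterior -/

theorem marginalDensity_eq {lam : ℝ} (hlam : 0 < lam) {X : Matrix (Fin n) (Fin p) ℝ}
    {Y : Fin n → ℝ} {c : ℝ} (hc : 0 < c)
    (h : ∀ (β : Fin p → ℝ) (s : ℝ) (τ : Fin p → ℝ), 0 < s → τ ∈ orthant p →
      jointDensity lam X Y β s τ = ENNReal.ofReal (c * jointReal lam X Y β s τ))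
    {x : (Fin p → ℝ) × ℝ} (hx : x ∈ paramSet p) :
    marginalDensity lam X Y x = ENNReal.ofReal (c * marginalReal lam X Y x.1 x.2) := by
  have hs : 0 < x.2 := hx.2
  have hm := marginalReal_pos hlam X Y x.1 hs
  have h1 : marginalDensity lam X Y x = ∫⁻ τ in orthant p,
      ENNReal.ofReal (c * marginalReal lam X Y x.1 x.2) * ENNReal.ofReal (tauPDF lam x.1 x.2 τ) := by
    refine setLIntegral_congr_fun measurableSet_orthant fun τ hτ => ?_
    rw [h x.1 x.2 τ hs hτ, jointReal_eq_marginalReal_mul_tauPDF hlam X Y x.1 hs hτ, ← mul_assoc,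
      ENNReal.ofReal_mul (by positivity)]
  have ht : Measurable fun τ : Fin p → ℝ => ENNReal.ofReal (tauPDF lam x.1 x.2 τ) :=
    ((measurable_tauPDF lam).comp
      (by fun_prop : Measurable fun τ : Fin p → ℝ => (x.1, x.2, τ))).ennreal_ofReal
  rw [h1, lintegral_const_mul _ ht, lintegral_tauPDF hlam x.1 hs, mul_one]

theorem measurable_ofReal_marginalReal (lam c : ℝ) (X : Matrix (Fin n) (Fin p) ℝ)
    (Y : Fin n → ℝ) : Measurable fun x : (Fin p → ℝ) × ℝ =>
      ENNReal.ofReal (c * marginalReal lam X Y x.1 x.2) :=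
  ((measurable_marginalReal lam X Y).const_mul c).ennreal_ofReal

theorem ae_mem_paramSet (p : ℕ) :
    ∀ᵐ x ∂(volume : Measure ((Fin p → ℝ) × ℝ)).restrict (paramSet p), x ∈ paramSet p :=
  ae_restrict_mem measurableSet_paramSet

theorem ae_mem_orthant (p : ℕ) :
    ∀ᵐ τ ∂(volume : Measure (Fin p → ℝ)).restrict (orthant p), τ ∈ orthant p :=
  ae_restrict_mem measurableSet_orthant

theorem exists_posterior_eq (hn : 2 ≤ n) {lam : ℝ} (hlam : 0 < lam)
    (X : Matrix (Fin n) (Fin p) ℝ) (hX : ∀ j, ∑ i, X i j = 0) {Y : Fin n → ℝ}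
    (hY : ∃ i i', Y i ≠ Y i') :
    IsProbabilityMeasure (posterior lam X Y) ∧ ∃ c : ℝ, 0 < c ∧ posterior lam X Y =
      (volume.restrict (paramSet p)).withDensity fun x =>
        ENNReal.ofReal (c * marginalReal lam X Y x.1 x.2) := by
  obtain ⟨c, hc, hj⟩ := exists_jointDensity_eq hn hlam X hX Y
  have hU : unnormalizedPosterior lam X Y = (volume.restrict (paramSet p)).withDensity fun x =>
      ENNReal.ofReal (c * marginalReal lam X Y x.1 x.2) := by
    refine withDensity_congr_ae ?_
    filter_upwards [ae_mem_paramSet p] with x hx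
    exact marginalDensity_eq hlam hc hj hx
  set Z := unnormalizedPosterior lam X Y Set.univ with hZ
  have hZint : Z = ENNReal.ofReal c *
      ∫⁻ x in paramSet p, ENNReal.ofReal (marginalReal lam X Y x.1 x.2) := by
    rw [hZ, hU, withDensity_apply _ MeasurableSet.univ, Measure.restrict_univ,
      ← lintegral_const_mul _ (measurable_marginalReal lam X Y).ennreal_ofReal]
    simp_rw [ENNReal.ofReal_mul hc.le]
  have hZtop : Z ≠ ∞ := by
    rw [hZint]
    exact ENNReal.mul_ne_top ENNReal.ofReal_ne_top (lintegral_marginalReal_lt_top hn hlam X hY).ne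
  have hZ0 : Z ≠ 0 := by
    rw [hZint]
    -- The density is positive on `paramSet p`, so a zero integral would make that set null, though
    -- it contains a shell of positive volume.
    refine mul_ne_zero (by simpa using hc) fun h0 => ?_
    rw [lintegral_eq_zero_iff (measurable_marginalReal lam X Y).ennreal_ofReal] at h0
    have h1 : volume.restrict (paramSet p) = 0 := by
      rw [← ae_eq_bot, ← Filter.eventually_false_iff_eq_bot]
      filter_upwards [h0, ae_mem_paramSet p] with x hx hx'
      have := marginalReal_pos hlam X Y x.1 (show 0 < x.2 from hx'.2)
      simp only [Pi.zero_apply, ENNReal.ofReal_eq_zero] at hx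
      linarith
    have h2 : volume (shell p 0) = 0 := by
      rw [← Measure.restrict_eq_self volume (shell_subset_paramSet p 0), h1, Measure.coe_zero,
        Pi.zero_apply]
    exact volume_shell_ne_zero p 0 h2
  have hZr : 0 < Z.toReal := ENNReal.toReal_pos hZ0 hZtop
  refine ⟨⟨?_⟩, Z.toReal⁻¹ * c, by positivity, ?_⟩
  · rw [posterior, Measure.smul_apply, smul_eq_mul, ← hZ, ENNReal.inv_mul_cancel hZ0 hZtop]
  · rw [posterior, ← hZ, hU, ← withDensity_smul _ (measurable_ofReal_marginalReal lam c X Y)]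
    congr 1
    funext x
    rw [Pi.smul_apply, smul_eq_mul, mul_assoc Z.toReal⁻¹,
      ENNReal.ofReal_mul (inv_nonneg.mpr hZr.le), ENNReal.ofReal_inv_of_pos hZr,
      ENNReal.ofReal_toReal hZtop]

/-! ### The three-step sampler -/

theorem measurable_threeStepKernel (lam : ℝ) (X : Matrix (Fin n) (Fin p) ℝ) (Y : Fin n → ℝ) :
    Measurable (Function.uncurry (threeStepKernel lam X Y)) := by
  have h : Measurable fun z : (((Fin p → ℝ) × ℝ) × ((Fin p → ℝ) × ℝ)) × (Fin p → ℝ) =>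
      ENNReal.ofReal (sigmaPDF X Y z.1.2.1 z.2 z.1.2.2 * betaPDF X Y z.1.1.2 z.2 z.1.2.1 *
        tauPDF lam z.1.1.1 z.1.1.2 z.2) := by
    have h1 := (measurable_sigmaPDF X Y).comp (by fun_prop :
      Measurable fun z : (((Fin p → ℝ) × ℝ) × ((Fin p → ℝ) × ℝ)) × (Fin p → ℝ) =>
        (z.1.2.1, z.2, z.1.2.2))
    have h2 := (measurable_betaPDF X Y).comp (by fun_prop :
      Measurable fun z : (((Fin p → ℝ) × ℝ) × ((Fin p → ℝ) × ℝ)) × (Fin p → ℝ) =>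
        (z.1.1.2, z.2, z.1.2.1))
    have h3 := (measurable_tauPDF lam).comp (by fun_prop :
      Measurable fun z : (((Fin p → ℝ) × ℝ) × ((Fin p → ℝ) × ℝ)) × (Fin p → ℝ) =>
        (z.1.1.1, z.1.1.2, z.2))
    exact ((h1.mul h2).mul h3).ennreal_ofReal
  exact h.lintegral_prod_right'

theorem threeStepKernel_eq (hn : 2 ≤ n) (lam : ℝ) (X : Matrix (Fin n) (Fin p) ℝ)
    {Y : Fin n → ℝ} (hY : ∃ i i', Y i ≠ Y i') (x y : (Fin p → ℝ) × ℝ) :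
    threeStepKernel lam X Y x y = ∫⁻ τ in orthant p, ENNReal.ofReal (sigmaPDF X Y y.1 τ y.2) *
      ENNReal.ofReal (betaPDF X Y x.2 τ y.1) * ENNReal.ofReal (tauPDF lam x.1 x.2 τ) := by
  refine setLIntegral_congr_fun measurableSet_orthant fun τ hτ => ?_
  have hn' : (2 : ℝ) ≤ n := by exact_mod_cast hn
  have hp' : (0 : ℝ) ≤ p := p.cast_nonneg
  have h1 : 0 ≤ sigmaPDF X Y y.1 τ y.2 := by
    rw [sigmaPDF_eq]
    exact inverseGammaPDFReal_nonneg (by linarith) (half_pos (energy_pos X hY hτ y.1)) _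
  rw [ENNReal.ofReal_mul (mul_nonneg h1 (betaPDF_nonneg X Y _ _ _)), ENNReal.ofReal_mul h1]

theorem lintegral_threeStepKernel_le_one (hn : 2 ≤ n) {lam : ℝ} (hlam : 0 < lam)
    (X : Matrix (Fin n) (Fin p) ℝ) {Y : Fin n → ℝ} (hY : ∃ i i', Y i ≠ Y i')
    {x : (Fin p → ℝ) × ℝ} (hx : x ∈ paramSet p) :
    ∫⁻ y in paramSet p, threeStepKernel lam X Y x y ≤ 1 := by
  simp_rw [threeStepKernel_eq hn lam X hY, volume_restrict_paramSet]
  exact lintegral_threeStep_le_one (a := fun β s τ => ENNReal.ofReal (tauPDF lam β s τ))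
    (b := fun s τ β => ENNReal.ofReal (betaPDF X Y s τ β))
    (c := fun β τ s => ENNReal.ofReal (sigmaPDF X Y β τ s))
    (measurable_tauPDF lam).ennreal_ofReal (measurable_betaPDF X Y).ennreal_ofReal
    (measurable_sigmaPDF X Y).ennreal_ofReal (ae_mem_orthant p)
    (lintegral_tauPDF hlam x.1 hx.2) (fun τ hτ => lintegral_betaPDF X Y hx.2 hτ)
    fun τ hτ β => lintegral_sigmaPDF hn X hY β hτ

theorem lintegral_threeStepKernel_invariant (hn : 2 ≤ n) {lam : ℝ} (hlam : 0 < lam)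
    (X : Matrix (Fin n) (Fin p) ℝ) {Y : Fin n → ℝ} (hY : ∃ i i', Y i ≠ Y i') {c : ℝ} (hc : 0 < c)
    {f : (Fin p → ℝ) × ℝ → ℝ≥0∞} (hf : Measurable f) :
    (∫⁻ x, ∫⁻ y in paramSet p, threeStepKernel lam X Y x y * f y ∂volume
        ∂(volume.restrict (paramSet p)).withDensity fun x =>
          ENNReal.ofReal (c * marginalReal lam X Y x.1 x.2))
      = ∫⁻ y, f y ∂(volume.restrict (paramSet p)).withDensity fun x =>
          ENNReal.ofReal (c * marginalReal lam X Y x.1 x.2) := by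
  have hjoint : ∀ s : ℝ, 0 < s → ∀ τ ∈ orthant p, ∀ β,
      ENNReal.ofReal (c * marginalReal lam X Y β s) * ENNReal.ofReal (tauPDF lam β s τ)
        = ENNReal.ofReal (c * jointReal lam X Y β s τ) := fun s hs τ hτ β => by
    have := marginalReal_pos hlam X Y β hs
    rw [← ENNReal.ofReal_mul (by positivity), mul_assoc,
      ← jointReal_eq_marginalReal_mul_tauPDF hlam X Y β hs hτ]
  simp_rw [threeStepKernel_eq hn lam X hY, volume_restrict_paramSet]
  refine lintegral_threeStep_invariant
    (a := fun β s τ => ENNReal.ofReal (tauPDF lam β s τ))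
    (b := fun s τ β => ENNReal.ofReal (betaPDF X Y s τ β))
    (c := fun β τ s => ENNReal.ofReal (sigmaPDF X Y β τ s))
    (G := fun x => ENNReal.ofReal (c * marginalReal lam X Y x.1 x.2))
    (measurable_tauPDF lam).ennreal_ofReal (measurable_betaPDF X Y).ennreal_ofReal
    (measurable_sigmaPDF X Y).ennreal_ofReal (measurable_ofReal_marginalReal lam c X Y)
    (P := Set.Ioi 0) (ae_restrict_mem measurableSet_Ioi) (ae_mem_orthant p)
    (fun s hs β => lintegral_tauPDF hlam β hs) (fun s hs τ hτ => lintegral_betaPDF X Y hs hτ)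
    (fun τ hτ β => lintegral_sigmaPDF hn X hY β hτ)
    (fun s hs τ hτ => ⟨ENNReal.ofReal (c * sigmaTauReal lam X Y s τ), fun β => ?_⟩)
    (fun τ hτ β => ⟨ENNReal.ofReal (c * betaTauReal lam X Y β τ), fun s hs => ?_⟩) hf
  · have := sigmaTauReal_nonneg lam X Y (show 0 < s from hs) hτ
    rw [hjoint s hs τ hτ β, ← ENNReal.ofReal_mul (by positivity), mul_assoc,
      ← jointReal_eq_sigmaTauReal_mul_betaPDF lam X Y β hs hτ]
  · have := betaTauReal_nonneg hn lam X hY β hτ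
    rw [hjoint s hs τ hτ β, ← ENNReal.ofReal_mul (by positivity), mul_assoc,
      ← jointReal_eq_betaTauReal_mul_sigmaPDF hn lam X hY β hs hτ]

theorem exists_threeStep_markovOperator (hn : 2 ≤ n) (hp : 0 < p) {lam : ℝ} (hlam : 0 < lam)
    (X : Matrix (Fin n) (Fin p) ℝ) {Y : Fin n → ℝ} (hY : ∃ i i', Y i ≠ Y i') {c : ℝ} (hc : 0 < c)
    {π : Measure ((Fin p → ℝ) × ℝ)} [IsFiniteMeasure π]
    (hπ : π = (volume.restrict (paramSet p)).withDensity fun x =>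
      ENNReal.ofReal (c * marginalReal lam X Y x.1 x.2)) :
    ∃ K : Lp ℝ 2 π →L[ℝ] Lp ℝ 2 π, IsMarkovOperator π (threeStepKernel lam X Y) K ∧
      ¬ IsHilbertSchmidt K := by
  have hG := measurable_ofReal_marginalReal lam c X Y
  have hG0 : ∀ᵐ x ∂(volume : Measure ((Fin p → ℝ) × ℝ)).restrict (paramSet p),
      ENNReal.ofReal (c * marginalReal lam X Y x.1 x.2) ≠ 0 := by
    filter_upwards [ae_mem_paramSet p] with x hx
    have := marginalReal_pos hlam X Y x.1 (show 0 < x.2 from hx.2)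
    simpa using mul_pos hc this
  -- Positivity of the posterior density makes transition laws absolutely continuous with respect to
  -- `π`, and gives each shell positive posterior mass.
  have hμπ : volume.restrict (paramSet p) ≪ π := by
    rw [hπ]
    exact withDensity_absolutelyContinuous' hG.aemeasurable hG0
  have hπμ : π ≪ volume.restrict (paramSet p) := by
    rw [hπ]
    exact withDensity_absolutelyContinuous _ _
  have hk := measurable_threeStepKernel lam X Y
  have hle : ∀ᵐ x ∂π, ∫⁻ y in paramSet p, threeStepKernel lam X Y x y ≤ 1 :=
    hπμ.ae_le (by
      filter_upwards [ae_mem_paramSet p] with x hx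
      exact lintegral_threeStepKernel_le_one hn hlam X hY hx)
  obtain ⟨K, hK⟩ := exists_markovOperator_of_density (π := π) hk hle fun f hf => by
    rw [hπ]
    exact lintegral_threeStepKernel_invariant hn hlam X hY hc hf
  obtain ⟨δ, hδ, hmin⟩ := exists_le_lintegral_threeStepKernel hn hp hlam X hY
  refine ⟨K, hK, not_isHilbertSchmidt_of_minorization
    (fun g => (hK g).mono fun x hx => hx.2)
    (Filter.Eventually.of_forall fun x => (withDensity_absolutelyContinuous _ _).trans hμπ) hle
    (measurableSet_shell p) (pairwise_disjoint_shell p) (fun j h0 => ?_) hδ hmin⟩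
  have h1 := hμπ h0
  rw [Measure.restrict_eq_self _ (shell_subset_paramSet p j)] at h1
  exact volume_shell_ne_zero p j h1

/-! ### The blocked sampler -/

theorem measurable_sigmaBlockedPDF_mul_betaPDF (X : Matrix (Fin n) (Fin p) ℝ) (Y : Fin n → ℝ) :
    Measurable fun z : (Fin p → ℝ) × ((Fin p → ℝ) × ℝ) =>
      ENNReal.ofReal (sigmaBlockedPDF X Y z.1 z.2.2 * betaPDF X Y z.2.2 z.1 z.2.1) := by
  have h1 := (measurable_sigmaBlockedPDF X Y).comp (by fun_prop :
    Measurable fun z : (Fin p → ℝ) × ((Fin p → ℝ) × ℝ) => (z.1, z.2.2))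
  have h2 := (measurable_betaPDF X Y).comp (by fun_prop :
    Measurable fun z : (Fin p → ℝ) × ((Fin p → ℝ) × ℝ) => (z.2.2, z.1, z.2.1))
  exact (h1.mul h2).ennreal_ofReal

theorem sigmaBlockedPDF_nonneg (hn : 2 ≤ n) (X : Matrix (Fin n) (Fin p) ℝ)
    {Y : Fin n → ℝ} (hY : ∃ i i', Y i ≠ Y i') {τ : Fin p → ℝ} (hτ : τ ∈ orthant p) (s : ℝ) :
    0 ≤ sigmaBlockedPDF X Y τ s := by
  have hn' : (2 : ℝ) ≤ n := by exact_mod_cast hn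
  rw [sigmaBlockedPDF_eq]
  exact inverseGammaPDFReal_nonneg (by linarith) (half_pos (minEnergy_pos X hY hτ)) _

theorem lintegral_sigmaBlockedPDF_mul_betaPDF (hn : 2 ≤ n) (X : Matrix (Fin n) (Fin p) ℝ)
    {Y : Fin n → ℝ} (hY : ∃ i i', Y i ≠ Y i') {τ : Fin p → ℝ} (hτ : τ ∈ orthant p) :
    ∫⁻ x in paramSet p, ENNReal.ofReal (sigmaBlockedPDF X Y τ x.2 * betaPDF X Y x.2 τ x.1)
      = 1 := by
  have hm : Measurable fun x : (Fin p → ℝ) × ℝ =>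
      ENNReal.ofReal (sigmaBlockedPDF X Y τ x.2 * betaPDF X Y x.2 τ x.1) := by
    have h1 := (measurable_sigmaBlockedPDF X Y).comp (by fun_prop :
      Measurable fun x : (Fin p → ℝ) × ℝ => (τ, x.2))
    have h2 := (measurable_betaPDF X Y).comp (by fun_prop :
      Measurable fun x : (Fin p → ℝ) × ℝ => (x.2, τ, x.1))
    exact (h1.mul h2).ennreal_ofReal
  rw [volume_restrict_paramSet, lintegral_prod_symm _ hm.aemeasurable,
    ← lintegral_sigmaBlockedPDF hn X hY hτ]
  refine setLIntegral_congr_fun measurableSet_Ioi fun s hs => ?_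
  have hb : Measurable fun β : Fin p → ℝ => ENNReal.ofReal (betaPDF X Y s τ β) :=
    ((measurable_betaPDF X Y).comp
      (by fun_prop : Measurable fun β : Fin p → ℝ => (s, τ, β))).ennreal_ofReal
  simp_rw [ENNReal.ofReal_mul (sigmaBlockedPDF_nonneg hn X hY hτ s)]
  rw [lintegral_const_mul _ hb, lintegral_betaPDF X Y hs hτ, mul_one]

theorem blockedKernel_eq {lam : ℝ} (hlam : 0 < lam) (X : Matrix (Fin n) (Fin p) ℝ)
    (Y : Fin n → ℝ) (x y : (Fin p → ℝ) × ℝ) :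
    blockedKernel lam X Y x y = ∫⁻ τ in orthant p, ENNReal.ofReal (tauPDF lam x.1 x.2 τ) *
      ENNReal.ofReal (sigmaBlockedPDF X Y τ y.2 * betaPDF X Y y.2 τ y.1) := by
  refine lintegral_congr fun τ => ?_
  rw [mul_assoc, ENNReal.ofReal_mul (tauPDF_nonneg hlam _ _ _)]

theorem measurable_tauReal (lam : ℝ) (X : Matrix (Fin n) (Fin p) ℝ) (Y : Fin n → ℝ) :
    Measurable (tauReal lam X Y) := by
  have h1 : Measurable fun τ : Fin p → ℝ => (A X τ)⁻¹.det :=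
    measurable_matrix_det (measurable_matrix_inv (measurable_A_apply X))
  have h2 := measurable_minEnergy X Y
  unfold tauReal tauWeight
  refine (Measurable.mul (Finset.measurable_fun_prod _ fun j _ => by fun_prop) ?_).mul ?_
  · exact (h1.const_mul _).sqrt
  · exact measurable_const.div ((h2.div_const 2).pow_const _)

theorem exists_blocked_markovOperator (hn : 2 ≤ n) {lam : ℝ} (hlam : 0 < lam)
    (X : Matrix (Fin n) (Fin p) ℝ) {Y : Fin n → ℝ} (hY : ∃ i i', Y i ≠ Y i') {c : ℝ} (hc : 0 < c)
    {π : Measure ((Fin p → ℝ) × ℝ)} [IsFiniteMeasure π]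
    (hπ : π = (volume.restrict (paramSet p)).withDensity fun x =>
      ENNReal.ofReal (c * marginalReal lam X Y x.1 x.2)) :
    ∃ K : Lp ℝ 2 π →L[ℝ] Lp ℝ 2 π, IsMarkovOperator π (blockedKernel lam X Y) K ∧
      IsTraceClass K ∧ IsHilbertSchmidt K := by
  have hfin : ∫⁻ x in paramSet p, ENNReal.ofReal (c * marginalReal lam X Y x.1 x.2) ≠ ∞ := by
    have h := measure_ne_top π Set.univ
    rwa [hπ, withDensity_apply _ MeasurableSet.univ, Measure.restrict_univ] at h
  subst hπ
  have ha : Measurable fun z : ((Fin p → ℝ) × ℝ) × (Fin p → ℝ) =>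
      ENNReal.ofReal (tauPDF lam z.1.1 z.1.2 z.2) :=
    ((measurable_tauPDF lam).comp (by fun_prop :
      Measurable fun z : ((Fin p → ℝ) × ℝ) × (Fin p → ℝ) => (z.1.1, z.1.2, z.2))).ennreal_ofReal
  obtain ⟨K, hK, htr⟩ := exists_traceClass_markovOperator
    (μ := volume.restrict (paramSet p)) (ν := volume.restrict (orthant p))
    (G := fun x => ENNReal.ofReal (c * marginalReal lam X Y x.1 x.2))
    (T := fun τ => ENNReal.ofReal (c * tauReal lam X Y τ))
    (a := fun x τ => ENNReal.ofReal (tauPDF lam x.1 x.2 τ))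
    (b := fun τ x => ENNReal.ofReal (sigmaBlockedPDF X Y τ x.2 * betaPDF X Y x.2 τ x.1))
    (measurable_ofReal_marginalReal lam c X Y)
    ((measurable_tauReal lam X Y).const_mul c).ennreal_ofReal ha
    (measurable_sigmaBlockedPDF_mul_betaPDF X Y) hfin
    (by
      filter_upwards [ae_mem_paramSet p] with x hx
      have := marginalReal_pos hlam X Y x.1 (show 0 < x.2 from hx.2)
      exact ⟨by simpa using mul_pos hc this, ENNReal.ofReal_ne_top⟩)
    (by
      filter_upwards [ae_mem_paramSet p] with x hx
      filter_upwards [ae_mem_orthant p] with τ hτ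
      have hs : 0 < x.2 := hx.2
      have h1 := marginalReal_pos hlam X Y x.1 hs
      have h2 := tauReal_nonneg hn lam X hY hτ
      rw [← ENNReal.ofReal_mul (by positivity), ← ENNReal.ofReal_mul (by positivity), mul_assoc,
        ← jointReal_eq_marginalReal_mul_tauPDF hlam X Y x.1 hs hτ,
        jointReal_eq_sigmaTauReal_mul_betaPDF lam X Y x.1 hs hτ,
        sigmaTauReal_eq_tauReal_mul_sigmaBlockedPDF hn lam X hY hs hτ]
      congr 1
      ring)
    (by
      filter_upwards [ae_mem_paramSet p] with x hx
      exact lintegral_tauPDF hlam x.1 hx.2)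
    (by
      filter_upwards [ae_mem_orthant p] with τ hτ
      exact lintegral_sigmaBlockedPDF_mul_betaPDF hn X hY hτ)
    (lintegral_trace_lt_top hn hlam X hY).ne
  refine ⟨K, fun g => ?_, htr⟩
  filter_upwards [hK g] with x hx
  have hkx : blockedKernel lam X Y x = fun y => ∫⁻ τ in orthant p,
      ENNReal.ofReal (tauPDF lam x.1 x.2 τ) *
      ENNReal.ofReal (sigmaBlockedPDF X Y τ y.2 * betaPDF X Y y.2 τ y.1) :=
    funext (blockedKernel_eq hlam X Y x)
  rw [transitionMeasure, hkx]
  exact hx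

end BayesLasso

/-- `IsMarkovOperator` prescribes `K g` almost everywhere and so determines the operator; the
existential statements therefore concern the Markov operators themselves. -/
theorem theorem2 (n p : ℕ) (hp : 0 < p) (lam : ℝ) (hlam : 0 < lam)
    (X : Matrix (Fin n) (Fin p) ℝ) (hX : ∀ j, ∑ i, X i j = 0)
    (Y : Fin n → ℝ) (hY : ∃ i i', Y i ≠ Y i') :
    IsProbabilityMeasure (BayesLasso.posterior lam X Y) ∧
    (∃ Khat : Lp ℝ 2 (BayesLasso.posterior lam X Y) →L[ℝ] Lp ℝ 2 (BayesLasso.posterior lam X Y),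
      BayesLasso.IsMarkovOperator (BayesLasso.posterior lam X Y)
        (BayesLasso.threeStepKernel lam X Y) Khat ∧
      ¬ IsHilbertSchmidt Khat) ∧
    (∃ K : Lp ℝ 2 (BayesLasso.posterior lam X Y) →L[ℝ] Lp ℝ 2 (BayesLasso.posterior lam X Y),
      BayesLasso.IsMarkovOperator (BayesLasso.posterior lam X Y)
        (BayesLasso.blockedKernel lam X Y) K ∧
      IsTraceClass K ∧ IsHilbertSchmidt K) := by
  have hn : 2 ≤ n := by
    obtain ⟨i, i', h⟩ := hY
    have h1 : i ≠ i' := fun h2 => h (h2 ▸ rfl)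
    have h2 := Fin.val_ne_of_ne h1
    omega
  obtain ⟨hprob, c, hc, hπ⟩ := BayesLasso.exists_posterior_eq hn hlam X hX hY
  exact ⟨hprob, BayesLasso.exists_threeStep_markovOperator hn hp hlam X hY hc hπ,
    BayesLasso.exists_blocked_markovOperator hn hlam X hY hc hπ⟩
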